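/- **Setting.** Let $\sigma$ be a substitution on $\mathcal A=\{1,\dots,n\}$ (each letter is sent to a non-empty word), with incidence matrix $(M_\sigma)_{b,a}=|\sigma(a)|_b$ and abelianization map $\mathbf l$. Assume that $\sigma$ is a primitive unit Pisot substitution: $M_\sigma$ is primitive and its dominant eigenvalue $\beta$ is a Pisot number which is a unit. Let $f$ be the minimal polynomial of $\beta$, $d=\deg f$, $\bar n=n-d+1$, and $\det(xI-M_\sigma)=f(x)g(x)$. Write $\mathbb R^n=\mathbb K_e\oplus\mathbb K_c\oplus\mathbb K_n$, where $\mathbb K_e$ is the $\beta$-eigenline of $M_\sigma$, $\mathbb K_c$ the $(d-1)$-dimensional sum of the eigenspaces of the Galois conjugates of $\beta$ other than $\beta$, and $\mathbb K_n=f(M_\sigma)\mathbb R^n$. Let $\pi_e,\pi_c$ be the corresponding projections onto $\mathbb K_e,\mathbb K_c$, and $\lambda$ the Lebesgue measure on $\mathbb K_c$. *Faces.* $\mathcal O_k$ is the set of wedges $\underline a=a_1\wedge\dots\wedge a_k$ with $a_1<\dots<a_k$, $\mathbf l(\underline a)=\sum_i\mathbf e_{a_i}$, and $C_k$ (resp.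 $C_k^*$) is the free $\mathbb Z$-module on the faces $(\mathbf x,\underline a)$ (resp. dual faces $(\mathbf x,\underline a)^*$), $\mathbf x\in\mathbb Z^n$, $\underline a\in\mathcal O_k$. The support of a face is $\overline{(\mathbf x,\underline a)}=\{\mathbf x+\sum_i t_i\mathbf e_{a_i}:t_i\in[0,1]\}$; for $P\in C_k$, $\{P\}$ is the set of faces occurring in $P$ with non-zero coefficient and $\overline P$ the union of their supports. $P$ is *geometric* if its non-zero coefficients are $\pm1$; a geometric $P$ *projects well* if the sets $\pi_c\overline F$, $F\in\{P\}$, have pairwise disjoint interiors. *Dual maps.* For $\underline a\in\mathcal O_k$ and a permutation $\tau$ of $\{1,\dots,k\}$, $\sigma(\underline b)=\mathbf p\,\underline a_\tau\mathbf s$ means $\sigma(b_i)=p_i\,a_{\tau(i)}\,s_i$ for all $i$; put $\mathbf l(\mathbf p)=\sum_i\mathbf l(p_i)$, $\mathbf l(\mathbf s)=\sum_i\mathbf l(s_i)$. Let $$\mathbf E_k^*(\sigma)(\mathbf x,\underline a)^*=\sum_{\underline b\in\mathcal O_k}\ \sum_{\tau}\ \sum_{\sigma(\underline b)=\mathbf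 p\underline a_\tau\mathbf s}\operatorname{sgn}(\tau)\,\bigl(M_\sigma^{-1}(\mathbf x-\mathbf l(\mathbf p)),\underline b\bigr)^*,$$ $\varphi_k:(\mathbf x,\underline a)^*\mapsto(-1)^{a_1+\dots+a_k}(\mathbf x+\mathbf l(\underline a),\underline a^*)$, where $\underline a^*\in\mathcal O_{n-k}$ is the complement of $\underline a$, and $\mathbf E^{d-1}(\sigma)=\varphi_{\bar n}\circ\mathbf E_{\bar n}^*(\sigma)\circ\varphi_{\bar n}^{-1}$ on $C_{d-1}$. Let $\mathcal S$ be the set of faces $(\mathbf x+\mathbf l(\underline a),\underline a^*)$ with $\mathbf x\in\mathbb Z^n$, $\underline a\in\mathcal O_{\bar n}$ and $\pi_e(\mathbf x)\in[-\pi_e(\mathbf l(\underline a)),\mathbf 0)$. *Nice reducible substitution.* This means: (S1) $\mathbf E^{d-1}(\sigma)(U)$ is geometric and projects well for each $U\in\mathcal S$; (S2) if $U_1\ne U_2$ are in $\mathcal S$ and $U_1+U_2$ projects well, then $\{\mathbf E^{d-1}(\sigma)(U_1)\}$ and $\{\mathbf E^{d-1}(\sigma)(U_2)\}$ are disjoint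 and $\mathbf E^{d-1}(\sigma)(U_1+U_2)$ projects well; (P) for some choice of orientation of the elements of $\mathcal O_{\bar n}$ (e.g. the increasing one), all terms in the sum defining $\mathbf E_{\bar n}^*(\sigma)$ of a positively oriented dual face are positively oriented (so no cancellation occurs), and in this basis the matrix $\bigwedge^{\bar n}\,{}^tM_\sigma$ is primitive; (N) all roots of $g$ are simple and of modulus one, and $g(0)=1$. *Strong coincidence.* For all $\underline a_0,\underline b_0\in\mathcal O_{\bar n}$ such that $(\mathbf 0,\underline a_0^*)+(\mathbf 0,\underline b_0^*)$ is geometric and projects well, there are $k\ge1$ and chains $\sigma(\underline a_i)=\mathbf p_i\underline a_{i+1}\mathbf s_i$, $\sigma(\underline b_i)=\mathbf p_i'\underline b_{i+1}\mathbf s_i'$ ($0\le i<k$; wedges taken up to the order of their letters) with $\underline a_k=\underline b_k$ and $\sum_{i<k}M_\sigma^{k-1-i}\mathbf l(\mathbf s_i)=\sum_{i<k}M_\sigma^{k-1-i}\mathbf l(\mathbf s_i')$. **Theorem.** Let $\sigma$ be a nice reducible substitution satisfying the strong coincidence condition. Let $\mathcal U\in C_{d-1}$ be a well-projecting geometric element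 with all faces based at $\mathbf 0$, and let $m\ge1$ witness the geometric finiteness property for $\mathcal U$: $\{\mathcal U\}\subseteq\{\mathbf E^{d-1}(\sigma)^m(\mathcal U)\}$, and the sets $\pi_c\overline F$ with $F\in\Gamma_{\mathcal U}:=\bigcup_{k\ge0}\{\mathbf E^{d-1}(\sigma)^{mk}(\mathcal U)\}$ cover $\mathbb K_c$. Then: 1. (Rauzy fractals) for each $\underline a\in\mathcal O_{d-1}$ there is a non-empty compact set $\mathcal R(\underline a)\subset\mathbb K_c$ such that, for all $(\mathbf x,\underline a)\in\mathcal S$, $M_\sigma^k\,\pi_c\bigl(\overline{\mathbf E^{d-1}(\sigma)^k(\mathbf x,\underline a)}\bigr)\to\mathcal R(\underline a)+\pi_c(\mathbf x)$ in the Hausdorff metric as $k\to\infty$; 2. (tiling) the sets $\mathcal R(\underline a)+\pi_c(\mathbf x)$, $(\mathbf x,\underline a)\in\Gamma_{\mathcal U}$, are compact, cover $\mathbb K_c$, and $\lambda$-almost every point of $\mathbb K_c$ lies in the tile of exactly one face of $\Gamma_{\mathcal U}$; 3. (self-replication) $M_\sigma$ is bijective on $\mathbb K_c$, $\Gamma_{\mathcal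 U}$ is the disjoint union of the sets $\{\mathbf E^{d-1}(\sigma)^m(F)\}$, $F\in\Gamma_{\mathcal U}$, and for each $(\mathbf x,\underline a)\in\Gamma_{\mathcal U}$ $$M_\sigma^{-m}\bigl(\mathcal R(\underline a)+\pi_c(\mathbf x)\bigr)=\bigcup_{(\mathbf y,\underline b)\in\{\mathbf E^{d-1}(\sigma)^m(\mathbf x,\underline a)\}}\bigl(\mathcal R(\underline b)+\pi_c(\mathbf y)\bigr);$$ 4. (aperiodicity) if $v\in\mathbb K_c$ and translation by $v$ maps the collection $\{\mathcal R(\underline a)+\pi_c(\mathbf x):(\mathbf x,\underline a)\in\Gamma_{\mathcal U}\}$ onto itself, then $v=0$. -/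

import Mathlib

open Filter Topology Set
open scoped Polynomial

noncomputable section

namespace RauzyTiling

/-! ### Substitutions and Pisot numbers -/

/-- A substitution on the alphabet `Fin n`: every letter is sent to a non-empty word. -/
structure Substitution (n : ℕ) where
  word : Fin n → List (Fin n)
  word_ne_nil : ∀ a, word a ≠ []

/-- The abelianization `l(w)` of a word: the vector counting the occurrences of each letter. -/
def abel {n : ℕ} (w : List (Fin n)) : Fin n → ℤ := fun b => (w.count b : ℤ)

/-- The incidence matrix `(M_σ)_{b,a} = |σ(a)|_b`. -/
def incidence {n : ℕ} (σ : Substitution n) : Matrix (Fin n) (Fin n) ℤ :=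
  Matrix.of fun b a => abel (σ.word a) b

/-- A Pisot number: a real algebraic integer `β > 1` all of whose other Galois conjugates have
modulus less than one. -/
def IsPisotNumber (β : ℝ) : Prop :=
  IsIntegral ℤ β ∧ 1 < β ∧
    ∀ z : ℂ, Polynomial.aeval z (minpoly ℤ β) = 0 → z ≠ (β : ℂ) → ‖z‖ < 1

/-- `β` is the dominant eigenvalue of the incidence matrix of `σ`. -/
def IsDominantEigenvalue {n : ℕ} (σ : Substitution n) (β : ℝ) : Prop :=
  Polynomial.aeval β (incidence σ).charpoly = 0 ∧
    ∀ z : ℂ, Polynomial.aeval z (incidence σ).charpoly = 0 → ‖z‖ ≤ β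

/-- `σ` is a primitive unit Pisot substitution with Pisot root `β`. The norm of `β` is, up to sign,
the constant coefficient of its minimal polynomial. -/
structure IsPrimitiveUnitPisot {n : ℕ} (σ : Substitution n) (β : ℝ) : Prop where
  primitive : (incidence σ).IsPrimitive
  dominant : IsDominantEigenvalue σ β
  pisot : IsPisotNumber β
  unit : IsUnit ((minpoly ℤ β).coeff 0)

/-- The degree `d` of the Pisot number `β`. -/
def deg (β : ℝ) : ℕ := (minpoly ℤ β).natDegree

/-- The neutral polynomial `g`, i.e. `det (x I - M_σ) = f(x) g(x)` with `f` the minimal polynomial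
of `β`. -/
def neutralPoly {n : ℕ} (σ : Substitution n) (β : ℝ) : ℤ[X] :=
  (incidence σ).charpoly /ₘ minpoly ℤ β

/-! ### The representation space

`ℝⁿ` is modelled as `Fin n → ℝ`: of its topology only norm-independent notions are used. -/

/-- The action of `M_σ` on `ℝⁿ`. -/
def actR {n : ℕ} (σ : Substitution n) : Module.End ℝ (Fin n → ℝ) :=
  Matrix.toLin' ((incidence σ).map (Int.cast : ℤ → ℝ))

/-- The minimal polynomial `f` of `β`, with real coefficients. -/
def pisotPolyR (β : ℝ) : ℝ[X] := (minpoly ℤ β).map (Int.castRingHom ℝ)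

/-- The expanding line `K_e`: the eigenspace of `β`. -/
def expSpace {n : ℕ} (σ : Substitution n) (β : ℝ) : Submodule ℝ (Fin n → ℝ) :=
  Module.End.eigenspace (actR σ) β

/-- The contracting space `K_c`: the (real) sum of the eigenspaces of the Galois conjugates of `β`
other than `β` itself, that is, the kernel of `(f / (x - β))(M_σ)`. -/
def contrSpace {n : ℕ} (σ : Substitution n) (β : ℝ) : Submodule ℝ (Fin n → ℝ) :=
  LinearMap.ker
    (Polynomial.aeval (actR σ) (pisotPolyR β /ₘ (Polynomial.X - Polynomial.C β)))

/-- The neutral space `K_n = f(M_σ) ℝⁿ`. -/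
def neutralSpace {n : ℕ} (σ : Substitution n) (β : ℝ) : Submodule ℝ (Fin n → ℝ) :=
  LinearMap.range (Polynomial.aeval (actR σ) (pisotPolyR β))

open Classical in
/-- The linear projection of `V` onto `p` along a complement `q`
(with value `0` if `p` and `q` are not complementary). -/
def projAlong {V : Type*} [AddCommGroup V] [Module ℝ V] (p q : Submodule ℝ V) : V →ₗ[ℝ] p :=
  if h : IsCompl p q then Submodule.projectionOnto p q h else 0

/-- The projection `π_c` onto `K_c` for the decomposition `ℝⁿ = K_e ⊕ K_c ⊕ K_n`. -/
def projC {n : ℕ} (σ : Substitution n) (β : ℝ) : (Fin n → ℝ) →ₗ[ℝ] contrSpace σ β :=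
  projAlong (contrSpace σ β) (expSpace σ β ⊔ neutralSpace σ β)

/-- The projection `π_e` onto `K_e` for the decomposition `ℝⁿ = K_e ⊕ K_c ⊕ K_n`. -/
def projE {n : ℕ} (σ : Substitution n) (β : ℝ) : (Fin n → ℝ) →ₗ[ℝ] expSpace σ β :=
  projAlong (expSpace σ β) (contrSpace σ β ⊔ neutralSpace σ β)

theorem actR_mem_contrSpace {n : ℕ} (σ : Substitution n) (β : ℝ) :
    ∀ x ∈ contrSpace σ β, actR σ x ∈ contrSpace σ β := by
  intro x hx
  have hx0 := LinearMap.mem_ker.mp hx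
  refine LinearMap.mem_ker.mpr ?_
  have h : Commute (actR σ) (Polynomial.aeval (actR σ)
      (pisotPolyR β /ₘ (Polynomial.X - Polynomial.C β))) := by
    have h2 := Polynomial.commute_X (pisotPolyR β /ₘ (Polynomial.X - Polynomial.C β))
    simpa using h2.map (Polynomial.aeval (actR σ))
  have h3 := LinearMap.congr_fun h.eq x
  simp only [Module.End.mul_apply] at h3
  rw [← h3, hx0, map_zero]

/-- The restriction of `M_σ` to the contracting space `K_c`. -/
def actC {n : ℕ} (σ : Substitution n) (β : ℝ) : Module.End ℝ (contrSpace σ β) :=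
  (actR σ).restrict (actR_mem_contrSpace σ β)

/-- An integer vector seen in `ℝⁿ`. -/
def toReal {n : ℕ} (x : Fin n → ℤ) : Fin n → ℝ := fun i => (x i : ℝ)

/-! ### Faces, chains and dual maps

A type `a₁ ∧ ⋯ ∧ a_k` with `a₁ < ⋯ < a_k` is the `k`-element set `{a₁, …, a_k}` of letters, so that
`O_k` is the set of finsets of cardinality `k`. All dimensions are treated at once: a chain is an
element of `⊕_k C_k`, and it lies in `C_k` if all the types of its faces have cardinality `k`. -/

/-- A face `(x, a)`, or a dual face `(x, a)^*`: a base point and a type. -/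
abbrev Face (n : ℕ) := (Fin n → ℤ) × Finset (Fin n)

/-- Finite formal integer combinations of faces (or of dual faces). -/
abbrev Chain (n : ℕ) := Face n →₀ ℤ

/-- The abelianization of a type: `l(a) = e_{a₁} + ⋯ + e_{a_k}`. -/
def abelType {n : ℕ} (a : Finset (Fin n)) : Fin n → ℤ := ∑ i ∈ a, Pi.single i 1

/-- The support of the face `(x, a)` in `ℝⁿ`: all `x + ∑ tᵢ e_{aᵢ}` with `tᵢ ∈ [0,1]`. -/
def faceSupport {n : ℕ} (F : Face n) : Set (Fin n → ℝ) :=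
  {y | ∃ t : Fin n → ℝ, (∀ i, t i ∈ Set.Icc (0 : ℝ) 1) ∧
    y = toReal F.1 + ∑ i ∈ F.2, t i • (Pi.single i 1 : Fin n → ℝ)}

/-- The support of a chain: the union of the supports of the faces that appear in it. -/
def chainSupport {n : ℕ} (P : Chain n) : Set (Fin n → ℝ) :=
  ⋃ F ∈ P.support, faceSupport F

/-- A chain is geometric if all its non-zero coefficients are `1` or `-1`. -/
def IsGeometric {n : ℕ} (P : Chain n) : Prop :=
  ∀ F ∈ P.support, P F = 1 ∨ P F = -1

/-- The signature of a bijection between two sets of letters, i.e. of the permutation obtained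
when both are listed in increasing order: the parity of the number of inversions. -/
def bijSign {n : ℕ} {b a : Finset (Fin n)} (τ : b ≃ a) : ℤˣ :=
  (-1) ^ (Finset.univ.filter fun p : b × b => p.1 < p.2 ∧ τ p.2 < τ p.1).card

/-- A choice of one position in each of the words `σ(i)`, `i ∈ b`. -/
abbrev Positions {n : ℕ} (σ : Substitution n) (b : Finset (Fin n)) :=
  (i : b) → Fin (σ.word i).length

/-- The positions `j` and the bijection `τ` give a decomposition `σ(b) = p a_τ s`: the letter of
`σ(i)` at position `j i` is `τ i`, for every `i ∈ b`. -/
def IsDecomp {n : ℕ} (σ : Substitution n) {b a : Finset (Fin n)} (τ : b ≃ a)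
    (j : Positions σ b) : Prop :=
  ∀ i : b, (σ.word i).get (j i) = (τ i : Fin n)

/-- `l(p)`, the sum of the abelianizations of the prefixes. -/
def prefixVec {n : ℕ} (σ : Substitution n) {b : Finset (Fin n)} (j : Positions σ b) :
    Fin n → ℤ := ∑ i : b, abel ((σ.word i).take (j i))

/-- `l(s)`, the sum of the abelianizations of the suffixes. -/
def suffixVec {n : ℕ} (σ : Substitution n) {b : Finset (Fin n)} (j : Positions σ b) :
    Fin n → ℤ := ∑ i : b, abel ((σ.word i).drop (j i + 1))

open Classical in
/-- The dual map `E_k^*(σ)` on dual faces, for all `k` at once: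
`(x, a)^* ↦ ∑ sgn(τ) (M_σ⁻¹ (x - l(p)), b)^*`, the sum being over all `b ∈ O_k` and all
decompositions `σ(b) = p a_τ s`. (Only sets `b` with as many elements as `a` contribute.) -/
def dualMap {n : ℕ} (σ : Substitution n) : Chain n →ₗ[ℤ] Chain n :=
  Finsupp.linearCombination ℤ fun F : Face n =>
    ∑ b : Finset (Fin n), ∑ τ : b ≃ F.2, ∑ j : Positions σ b,
      if IsDecomp σ τ j then
        Finsupp.single ((incidence σ)⁻¹.mulVec (F.1 - prefixVec σ j), b) (bijSign τ : ℤ)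
      else 0

/-- The sign `(-1)^{a₁ + ⋯ + a_k}` of a type, the letters being numbered `1, …, n`. -/
def typeSign {n : ℕ} (a : Finset (Fin n)) : ℤ := (-1) ^ (∑ i ∈ a, ((i : ℕ) + 1))

/-- The face transverse to a dual face, without its sign: `(x, a)^* ↦ (x + l(a), a^*)`, where the
type `a^*` is the complement of `a`. -/
def transverse {n : ℕ} (F : Face n) : Face n := (F.1 + abelType F.2, F.2ᶜ)

/-- The Poincaré map `φ_k`, for all `k` at once. -/
def poincare {n : ℕ} : Chain n →ₗ[ℤ] Chain n :=
  Finsupp.linearCombination ℤ fun F : Face n => Finsupp.single (transverse F) (typeSign F.2)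

/-- The inverse of the Poincaré map. -/
def poincareInv {n : ℕ} : Chain n →ₗ[ℤ] Chain n :=
  Finsupp.linearCombination ℤ fun F : Face n =>
    Finsupp.single (F.1 - abelType F.2ᶜ, F.2ᶜ) (typeSign F.2ᶜ)

theorem typeSign_mul_self {n : ℕ} (a : Finset (Fin n)) : typeSign a * typeSign a = 1 := by
  unfold typeSign
  rw [← pow_add, ← two_mul, pow_mul]
  simp

theorem poincareInv_poincare {n : ℕ} (P : Chain n) : poincareInv (poincare P) = P := by
  have h : (poincareInv (n := n)).comp poincare = LinearMap.id := by
    refine Finsupp.lhom_ext fun F c => ?_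
    simp only [poincare, poincareInv, transverse, LinearMap.comp_apply, LinearMap.id_apply,
      Finsupp.linearCombination_single, Finsupp.smul_single, smul_eq_mul, mul_assoc,
      typeSign_mul_self, mul_one, compl_compl, add_sub_cancel_right]
  exact LinearMap.congr_fun h P

theorem poincare_poincareInv {n : ℕ} (P : Chain n) : poincare (poincareInv P) = P := by
  have h : (poincare (n := n)).comp poincareInv = LinearMap.id := by
    refine Finsupp.lhom_ext fun F c => ?_
    simp only [poincare, poincareInv, transverse, LinearMap.comp_apply, LinearMap.id_apply,
      Finsupp.linearCombination_single, Finsupp.smul_single, smul_eq_mul, mul_assoc,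
      typeSign_mul_self, mul_one, compl_compl, sub_add_cancel]
  exact LinearMap.congr_fun h P

/-- The geometric dual map `E^k(σ)`, for all `k` at once: the conjugate of `E_{n-k}^*(σ)` by the
Poincaré map. -/
def geomDual {n : ℕ} (σ : Substitution n) : Module.End ℤ (Chain n) :=
  poincare ∘ₗ dualMap σ ∘ₗ poincareInv

theorem geomDual_poincare {n : ℕ} (σ : Substitution n) (P : Chain n) :
    geomDual σ (poincare P) = poincare (dualMap σ P) := by
  simp [geomDual, poincareInv_poincare]

/-! ### Stepped surfaces and nice reducible substitutions -/

/-- The projection `π_c` of the support of a face. -/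
def projFace {n : ℕ} (σ : Substitution n) (β : ℝ) (F : Face n) : Set (contrSpace σ β) :=
  projC σ β '' faceSupport F

/-- A chain projects well onto `K_c`: it is geometric and the projections of its distinct faces have
disjoint interiors. -/
def ProjectsWell {n : ℕ} (σ : Substitution n) (β : ℝ) (P : Chain n) : Prop :=
  IsGeometric P ∧ ∀ F ∈ P.support, ∀ G ∈ P.support, F ≠ G →
    Disjoint (interior (projFace σ β F)) (interior (projFace σ β G))

/-- The set `S^*` of dual faces `(x, a)^*` with `a ∈ O_{n-d+1}` and
`π_e(x) ∈ [-π_e(l(a)), 0)`, where `[z₁, z₂) = {(1 - t) z₁ + t z₂ : t ∈ [0, 1)}`. -/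
def dualNearFaces {n : ℕ} (σ : Substitution n) (β : ℝ) : Set (Face n) :=
  {F | F.2.card = n + 1 - deg β ∧ ∃ t ∈ Set.Ico (0 : ℝ) 1,
    projE σ β (toReal F.1) = (1 - t) • (-projE σ β (toReal (abelType F.2))) + t • 0}

/-- The set `S` of faces near to `K_c`. -/
def nearFaces {n : ℕ} (σ : Substitution n) (β : ℝ) : Set (Face n) :=
  transverse '' dualNearFaces σ β

/-- The matrix `⋀^k (ᵗM_σ)` of the minors of order `k`, indexed by `O_k`. -/
def dualMatrix {n : ℕ} (σ : Substitution n) (k : ℕ) :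
    Matrix {a : Finset (Fin n) // a.card = k} {a : Finset (Fin n) // a.card = k} ℤ :=
  Matrix.of fun b a =>
    ((incidence σ).transpose.submatrix (b.1.orderEmbOfFin b.2) (a.1.orderEmbOfFin a.2)).det

/-- The geometric dual of the single face `F` with coefficient one. -/
def geomDualFace {n : ℕ} (σ : Substitution n) (F : Face n) : Chain n :=
  geomDual σ (Finsupp.single F 1)

/-- Nice reducible substitutions. In `positivity`, `ε` is a choice of orientation of the wedges of
`n-d+1` letters (`ε = 1` being the increasing order of the letters): with respect to it, every term
of the image under `E_{n-d+1}^*(σ)` of a positive dual face is positive, so that no two terms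
cancel, and the matrix of `E_{n-d+1}^*(σ)` is primitive. -/
structure IsNice {n : ℕ} (σ : Substitution n) (β : ℝ) : Prop where
  single_face : ∀ U ∈ nearFaces σ β, ProjectsWell σ β (geomDualFace σ U)
  two_faces : ∀ U₁ ∈ nearFaces σ β, ∀ U₂ ∈ nearFaces σ β, U₁ ≠ U₂ →
    ProjectsWell σ β (Finsupp.single U₁ 1 + Finsupp.single U₂ 1) →
    Disjoint (geomDualFace σ U₁).support (geomDualFace σ U₂).support ∧
      ProjectsWell σ β (geomDual σ (Finsupp.single U₁ 1 + Finsupp.single U₂ 1))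
  positivity : ∃ ε : {a : Finset (Fin n) // a.card = n + 1 - deg β} → ℤˣ,
    (∀ a b : {a : Finset (Fin n) // a.card = n + 1 - deg β}, ∀ (τ : b.1 ≃ a.1)
      (j : Positions σ b.1), IsDecomp σ τ j → bijSign τ = ε a * ε b) ∧
    (Matrix.of fun b a => (ε b : ℤ) * dualMatrix σ (n + 1 - deg β) b a * (ε a : ℤ)).IsPrimitive
  neutral : (∀ z : ℂ, Polynomial.aeval z (neutralPoly σ β) = 0 →
      ‖z‖ = 1 ∧ Polynomial.aeval z (neutralPoly σ β).derivative ≠ 0) ∧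
    (neutralPoly σ β).eval 0 = 1

/-- The set of faces `Γ_U = ⋃_{k ≥ 0} {E^{d-1}(σ)^{mk}(U)}`. -/
def steppedSurface {n : ℕ} (σ : Substitution n) (m : ℕ) (U : Chain n) : Set (Face n) :=
  {F | ∃ k : ℕ, F ∈ ((geomDual σ ^ (m * k)) U).support}

/-- The integer `m` witnesses the geometric finiteness property of `σ` for `U`. -/
def GeometricFiniteness {n : ℕ} (σ : Substitution n) (β : ℝ) (m : ℕ) (U : Chain n) : Prop :=
  1 ≤ m ∧ U.support ⊆ ((geomDual σ ^ m) U).support ∧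
    ⋃ F ∈ steppedSurface σ m U, projFace σ β F = Set.univ

/-! ### Strong coincidence -/

/-- `σ(a) = p b s` with `l(s) = v` for some `p`, `s`, up to the order of the letters of `b`. -/
def SuffixEdge {n : ℕ} (σ : Substitution n) (a b : Finset (Fin n)) (v : Fin n → ℤ) : Prop :=
  ∃ (τ : a ≃ b) (j : Positions σ a), IsDecomp σ τ j ∧ suffixVec σ j = v

/-- There are `σ(a_i) = p_i a_{i+1} s_i` for `0 ≤ i < k` with `a_0 = a`, `a_k = c` and
`M^{k-1} l(s_0) + ⋯ + M l(s_{k-2}) + l(s_{k-1}) = v`. -/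
def SuffixPath {n : ℕ} (σ : Substitution n) (k : ℕ) (a c : Finset (Fin n)) (v : Fin n → ℤ) :
    Prop :=
  ∃ (w : ℕ → Finset (Fin n)) (s : ℕ → Fin n → ℤ), w 0 = a ∧ w k = c ∧
    (∀ i < k, SuffixEdge σ (w i) (w (i + 1)) (s i)) ∧
    ∑ i ∈ Finset.range k, ((incidence σ) ^ (k - 1 - i)).mulVec (s i) = v

/-- `σ` has a coincidence for `a` and `b`. -/
def HasCoincidence {n : ℕ} (σ : Substitution n) (a b : Finset (Fin n)) : Prop :=
  ∃ k : ℕ, 1 ≤ k ∧ ∃ (c : Finset (Fin n)) (v : Fin n → ℤ),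
    SuffixPath σ k a c v ∧ SuffixPath σ k b c v

/-- The (suffix) strong coincidence condition. -/
def StrongCoincidence {n : ℕ} (σ : Substitution n) (β : ℝ) : Prop :=
  ∀ a b : Finset (Fin n), a.card = n + 1 - deg β → b.card = n + 1 - deg β →
    ProjectsWell σ β (Finsupp.single ((0 : Fin n → ℤ), aᶜ) 1 + Finsupp.single (0, bᶜ) 1) →
    HasCoincidence σ a b

/-! ### Rauzy fractals and tilings -/

/-- `L` is a non-empty compact set to which `u` converges in the Hausdorff metric. -/
def IsHausdorffLimit {K : Type*} [PseudoEMetricSpace K] (u : ℕ → Set K) (L : Set K) : Prop :=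
  L.Nonempty ∧ IsCompact L ∧
    Tendsto (fun k => Metric.hausdorffEDist (u k) L) atTop (𝓝 0)

/-- The renormalized projected patch `M_σ^k π_c(supp (E^{d-1}(σ)^k (x, a)))`. -/
def renormPatch {n : ℕ} (σ : Substitution n) (β : ℝ) (F : Face n) (k : ℕ) :
    Set (contrSpace σ β) :=
  (actC σ β ^ k) '' (projC σ β '' chainSupport ((geomDual σ ^ k) (Finsupp.single F 1)))

/-- The Rauzy fractal `R(a)`: the Hausdorff limit of the renormalized patches of `(0, a)`. -/
def rauzyFractal {n : ℕ} (σ : Substitution n) (β : ℝ) (a : Finset (Fin n)) :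
    Set (contrSpace σ β) :=
  Classical.epsilon fun L => IsHausdorffLimit (renormPatch σ β (0, a)) L

/-- The tile `R(a) + π_c(x)` of the face `(x, a)`. -/
def tile {n : ℕ} (σ : Substitution n) (β : ℝ) (F : Face n) : Set (contrSpace σ β) :=
  (fun z => z + projC σ β (toReal F.1)) '' rauzyFractal σ β F.2

/-- The family `T` is a tiling of `K`: a covering by compact sets such that almost every point of
`K` (for the Lebesgue measure, i.e. a Haar measure) lies in exactly one of them. -/
structure IsTiling {K ι : Type*} [NormedAddCommGroup K] [NormedSpace ℝ K] [FiniteDimensional ℝ K]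
    [MeasurableSpace K] [BorelSpace K] (T : ι → Set K) : Prop where
  isCompact : ∀ i, IsCompact (T i)
  covers : ⋃ i, T i = Set.univ
  ae_unique : ∀ᵐ z ∂(MeasureTheory.Measure.addHaar : MeasureTheory.Measure K), ∃! i, z ∈ T i

/-- The tiles of the faces in `Γ` are self-replicating under the `m`-th power of the expansion
`M_σ⁻¹` of `K_c`: the faces of `Γ` are the disjoint union of their images under `E^{d-1}(σ)^m`, and
inflating a tile gives the union of the tiles of the faces in its image. -/
structure IsSelfReplicating {n : ℕ} (σ : Substitution n) (β : ℝ) (m : ℕ) (Γ : Set (Face n)) :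
    Prop where
  expansion_bijective : Function.Bijective (actC σ β)
  stable : ⋃ F ∈ Γ, (((geomDual σ ^ m) (Finsupp.single F 1)).support : Set (Face n)) = Γ
  disjoint : ∀ F ∈ Γ, ∀ G ∈ Γ, F ≠ G →
    Disjoint ((geomDual σ ^ m) (Finsupp.single F 1)).support
      ((geomDual σ ^ m) (Finsupp.single G 1)).support
  subdivide : ∀ F ∈ Γ, (actC σ β ^ m) ⁻¹' tile σ β F =
    ⋃ G ∈ ((geomDual σ ^ m) (Finsupp.single F 1)).support, tile σ β G

/-- A collection of subsets of `K` is aperiodic if no non-zero translation maps it to itself. -/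
def IsAperiodic {K : Type*} [AddCommGroup K] (C : Set (Set K)) : Prop :=
  ∀ v : K, (fun T : Set K => (fun z => z + v) '' T) '' C = C → v = 0

end RauzyTiling

end

namespace RauzyTiling

variable {n : ℕ} {σ : Substitution n} {β : ℝ}

/-! ### Growth of orbits of linear maps -/

/-! The characteristic polynomial is a product of three pairwise coprime factors, with roots of
modulus `β > 1`, less than one, and exactly one. Hence `ℝⁿ` splits into invariant pieces, `M_σ`
contracts `K_c` geometrically, and `M_σ` is invertible over `ℤ`. The support of an iterate of the
dual map is described by the relations `Child` and `Desc`. Positivity excludes cancellation inside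
the image of one face, and the hypotheses on one and two faces propagate to all iterates
(`Admissible.geomDual`), so distinct faces of a well-projecting chain never share a descendant of
the same generation.

A face and `M_σ` applied to any of its children project to within bounded distance, so consecutive
renormalized patches differ by `O(ρ ^ k)` with `ρ < 1`. Completeness gives the Rauzy fractals, and
passing to the limit in the composition of generations gives the subdivision rule `preimage_tile`.

Null overlaps come from a volume count. Let `δ` be the factor by which `M_σ⁻¹` scales volume on
`K_c`. Subdivision gives `δ r(a) ≤ ∑ r(b)` for the volumes `r` of the fractals, the sum running over
the image of a face of type `a`. If this were strict for one type, primitivity would make the excess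
recur in a fixed proportion of the faces of each generation, and total volumes would outgrow `δ ^
k`. But a patch of generation `k` has only `O(δ ^ k)` faces, since their projections have disjoint
interiors inside an inflated ball (`exists_card_patch_le`). So equality holds
(`sum_fractalVolume_patch_one`), and tiles within one patch overlap in null sets. Strong coincidence
places two different types of `U`, at a common base point, in the patch of a single face. Together
with inflation this gives null overlaps throughout the stepped surface.

Covering follows from the covering by projected faces, local finiteness and a pigeonhole argument.
For aperiodicity, the multiples of a period give infinitely many faces of one type whose base points
advance linearly in `K_c`. An integer vector has zero contracting component exactly when its
expanding component is zero (`projC_toReal_eq_zero_iff`), so the expanding coordinates also advance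
linearly. They are bounded on faces near `K_c`, so the period vanishes. -/

theorem exists_norm_pow_apply_le_of_prod {W : Type*} [NormedAddCommGroup W] [NormedSpace ℂ W]
    (S : Module.End ℂ W) {ρ : ℝ} (l : List ℂ) (hl : ∀ z ∈ l, ‖z‖ < ρ) (x : W)
    (hx : Polynomial.aeval S (l.map fun z => Polynomial.X - Polynomial.C z).prod x = 0) :
    ∃ C : ℝ, ∀ k : ℕ, ‖(S ^ k) x‖ ≤ C * ρ ^ k := by
  induction l generalizing x with
  | nil =>
    simp only [List.map_nil, List.prod_nil, map_one, Module.End.one_apply] at hx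
    exact ⟨0, fun k => by simp [hx]⟩
  | cons z l ih =>
    have hz : ‖z‖ < ρ := hl z (by simp)
    have hρ : 0 < ρ := (norm_nonneg z).trans_lt hz
    obtain ⟨C, hC⟩ := ih (fun w hw => hl w (by simp [hw])) (S x - z • x) (by
      rw [List.map_cons, List.prod_cons, mul_comm, map_mul] at hx
      simpa [Algebra.algebraMap_eq_smul_one] using hx)
    -- Splitting off one root `z` leaves `S x - z • x`, killed by the remaining factors. The
    -- constant `K` satisfies `‖z‖ * K + C ≤ K * ρ`, which closes the recurrence `S ^ (k + 1) x = z
    -- • S ^ k x + S ^ k (S x - z • x)`.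
    refine ⟨max ‖x‖ (C / (ρ - ‖z‖)), fun k => ?_⟩
    induction k with
    | zero => simp
    | succ k ihk =>
      have h1 : (S ^ (k + 1)) x = z • (S ^ k) x + (S ^ k) (S x - z • x) := by
        rw [pow_succ, Module.End.mul_apply, map_sub, map_smul]; abel
      have h2 : C ≤ max ‖x‖ (C / (ρ - ‖z‖)) * (ρ - ‖z‖) := by
        rw [← div_le_iff₀ (by linarith)]; exact le_max_right _ _
      rw [h1]
      calc ‖z • (S ^ k) x + (S ^ k) (S x - z • x)‖
          ≤ ‖z‖ * ‖(S ^ k) x‖ + ‖(S ^ k) (S x - z • x)‖ := by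
            rw [← norm_smul]; exact norm_add_le _ _
        _ ≤ ‖z‖ * (max ‖x‖ (C / (ρ - ‖z‖)) * ρ ^ k) +
            (max ‖x‖ (C / (ρ - ‖z‖)) * (ρ - ‖z‖)) * ρ ^ k := by
            gcongr
            exact (hC k).trans (by gcongr)
        _ = _ := by ring

/-- Real vectors annihilated by a polynomial whose complex roots have modulus less than `ρ` have
orbits that grow at most like `ρ ^ k`. -/
theorem exists_norm_pow_apply_le {n : ℕ} (A : Matrix (Fin n) (Fin n) ℝ) {ρ : ℝ} {p : ℝ[X]}
    (hp : p.Monic) (hroot : ∀ z : ℂ, Polynomial.aeval z p = 0 → ‖z‖ < ρ) (x : Fin n → ℝ)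
    (hx : Polynomial.aeval (Matrix.toLin' A) p x = 0) :
    ∃ C : ℝ, ∀ k : ℕ, ‖(Matrix.toLin' A ^ k) x‖ ≤ C * ρ ^ k := by
  set S : Module.End ℂ (Fin n → ℂ) := Matrix.toLin' (A.map Complex.ofReal) with hS
  let c : (Fin n → ℝ) → (Fin n → ℂ) := fun y i => (y i : ℂ)
  have hc : ∀ y, c (Matrix.toLin' A y) = S (c y) := by
    intro y
    ext i
    simp [c, hS, Matrix.toLin'_apply, Matrix.mulVec, dotProduct]
  have hck : ∀ (k : ℕ) y, c ((Matrix.toLin' A ^ k) y) = (S ^ k) (c y) := by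
    intro k
    induction k with
    | zero => intro y; simp
    | succ k ih => intro y; rw [pow_succ, pow_succ, Module.End.mul_apply, Module.End.mul_apply,
        ih, hc]
  have hcn : ∀ y, ‖c y‖ = ‖y‖ := by
    intro y
    simp [c, Pi.norm_def]
  have hcp : ∀ p : ℝ[X], Polynomial.aeval S (p.map (algebraMap ℝ ℂ)) (c x) =
      c (Polynomial.aeval (Matrix.toLin' A) p x) := by
    intro p
    induction p using Polynomial.induction_on' with
    | add p q hp hq =>
      simp only [Polynomial.map_add, map_add, LinearMap.add_apply, hp, hq]
      ext i; simp [c]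
    | monomial k a =>
      simp only [Polynomial.map_monomial, Polynomial.aeval_monomial, Module.End.mul_apply,
        Module.algebraMap_end_apply]
      rw [← hck]
      ext i; simp [c]
  have hsplit := (IsAlgClosed.splits (p.map (algebraMap ℝ ℂ))).eq_prod_roots_of_monic
    (hp.map _)
  obtain ⟨C, hC⟩ := exists_norm_pow_apply_le_of_prod S (ρ := ρ)
    (p.map (algebraMap ℝ ℂ)).roots.toList (fun z hz => hroot z (by
      have := (Polynomial.mem_roots'.1 (Multiset.mem_toList.1 hz)).2
      rwa [Polynomial.IsRoot, Polynomial.eval_map_algebraMap] at this)) (c x) (by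
      rw [← Multiset.prod_coe, ← Multiset.map_coe, Multiset.coe_toList, ← hsplit, hcp, hx]
      ext i; simp [c])
  exact ⟨C, fun k => by rw [← hcn, hck]; exact hC k⟩

/-- The moduli of the complex roots of a polynomial, if less than `r`, are bounded away from
`r`. -/
theorem exists_lt_forall_root_norm_lt {p : ℝ[X]} (hp : p ≠ 0) {r : ℝ} (hr : 0 < r)
    (hroot : ∀ z : ℂ, Polynomial.aeval z p = 0 → ‖z‖ < r) :
    ∃ ρ, 0 < ρ ∧ ρ < r ∧ ∀ z : ℂ, Polynomial.aeval z p = 0 → ‖z‖ < ρ := by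
  have h : ∀ᶠ ρ in 𝓝[<] r, ∀ z ∈ (p.map (algebraMap ℝ ℂ)).roots.toFinset, ‖z‖ < ρ := by
    rw [Filter.eventually_all_finset]
    intro z hz
    have := (Polynomial.mem_roots'.1 (Multiset.mem_toFinset.1 hz)).2
    rw [Polynomial.IsRoot, Polynomial.eval_map_algebraMap] at this
    filter_upwards [Ioo_mem_nhdsLT (hroot z this)] with ρ hρ using hρ.1
  obtain ⟨ρ, h1, h2⟩ := (h.and (Ioo_mem_nhdsLT hr)).exists
  refine ⟨ρ, h2.1, h2.2, fun z hz => h1 z ?_⟩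
  rw [Multiset.mem_toFinset, Polynomial.mem_roots', Polynomial.IsRoot,
    Polynomial.eval_map_algebraMap]
  exact ⟨(Polynomial.map_ne_zero_iff (algebraMap ℝ ℂ).injective).2 hp, hz⟩

/-! ### Spectral decompositions -/

theorem isCompl_ker_of_isCoprime {V : Type*} [AddCommGroup V] [Module ℝ V] (T : Module.End ℝ V)
    {p q : ℝ[X]} (h : IsCoprime p q) (h0 : Polynomial.aeval T (p * q) = 0) :
    IsCompl (LinearMap.ker (Polynomial.aeval T p)) (LinearMap.ker (Polynomial.aeval T q)) := by
  refine ⟨Polynomial.disjoint_ker_aeval_of_isCoprime T h, ?_⟩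
  rw [codisjoint_iff, Polynomial.sup_ker_aeval_eq_ker_aeval_mul_of_coprime T h, h0,
    LinearMap.ker_zero]

theorem range_aeval_eq_ker_of_isCoprime {V : Type*} [AddCommGroup V] [Module ℝ V]
    (T : Module.End ℝ V) {p q : ℝ[X]} (h : IsCoprime p q) (h0 : Polynomial.aeval T (p * q) = 0) :
    LinearMap.range (Polynomial.aeval T p) = LinearMap.ker (Polynomial.aeval T q) := by
  ext x
  constructor
  · rintro ⟨y, rfl⟩
    rw [LinearMap.mem_ker, ← Module.End.mul_apply, ← map_mul, mul_comm, h0, LinearMap.zero_apply]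
  · intro hx
    obtain ⟨a, b, hab⟩ := h
    -- Evaluated at a vector killed by `q(T)`, the Bézout identity `a * p + b * q = 1` exhibits it
    -- as `p(T)` applied to `a(T) x`.
    refine ⟨Polynomial.aeval T a x, ?_⟩
    have := congrArg (fun r => Polynomial.aeval T r x) hab
    simp only [map_add, map_mul, LinearMap.add_apply, Module.End.mul_apply,
      LinearMap.mem_ker.1 hx, map_zero, add_zero, map_one, Module.End.one_apply] at this
    rw [← Module.End.mul_apply, ← map_mul, mul_comm, map_mul, Module.End.mul_apply, this]

/-! ### The characteristic polynomial -/

theorem IsPisotNumber.monic_minpoly (hβ : IsPisotNumber β) : (minpoly ℤ β).Monic :=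
  minpoly.monic hβ.1

theorem charpoly_eq (hσ : IsPrimitiveUnitPisot σ β) :
    (incidence σ).charpoly = minpoly ℤ β * neutralPoly σ β := by
  have h : minpoly ℤ β ∣ (incidence σ).charpoly :=
    minpoly.isIntegrallyClosed_dvd hσ.pisot.1 hσ.dominant.1
  have h2 := Polynomial.modByMonic_add_div (incidence σ).charpoly (minpoly ℤ β)
  rw [(Polynomial.modByMonic_eq_zero_iff_dvd hσ.pisot.monic_minpoly).2 h, zero_add] at h2
  exact h2.symm

theorem monic_neutralPoly (hσ : IsPrimitiveUnitPisot σ β) : (neutralPoly σ β).Monic := by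
  have h := (incidence σ).charpoly_monic
  rw [charpoly_eq hσ] at h
  exact hσ.pisot.monic_minpoly.of_mul_monic_left h

theorem deg_pos (hσ : IsPrimitiveUnitPisot σ β) : 1 ≤ deg β :=
  minpoly.natDegree_pos hσ.pisot.1

theorem deg_le (hσ : IsPrimitiveUnitPisot σ β) : deg β ≤ n := by
  have h := (incidence σ).charpoly_natDegree_eq_dim
  rw [charpoly_eq hσ, hσ.pisot.monic_minpoly.natDegree_mul (monic_neutralPoly hσ),
    Fintype.card_fin] at h
  unfold deg
  omega

/-- Up to sign the determinant is `f(0) g(0)`: the first factor is a unit because `β` is one, the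
second equals one by neutrality. -/
theorem isUnit_det_incidence (hσ : IsPrimitiveUnitPisot σ β) (hnice : IsNice σ β) :
    IsUnit (incidence σ).det := by
  have h : IsUnit ((incidence σ).charpoly.coeff 0) := by
    rw [charpoly_eq hσ, Polynomial.mul_coeff_zero,
      Polynomial.coeff_zero_eq_eval_zero (neutralPoly σ β), hnice.neutral.2, mul_one]
    exact hσ.unit
  rw [Matrix.det_eq_sign_charpoly_coeff]
  exact (((isUnit_one (M := ℤ)).neg).pow _).mul h

/-- The minimal polynomial of `β` divided by `x - β`. -/
noncomputable def contrPoly (β : ℝ) : ℝ[X] := pisotPolyR β /ₘ (Polynomial.X - Polynomial.C β)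

/-- The neutral polynomial with real coefficients. -/
noncomputable def neutralPolyR (σ : Substitution n) (β : ℝ) : ℝ[X] :=
  (neutralPoly σ β).map (Int.castRingHom ℝ)

theorem pisotPolyR_eq :
    pisotPolyR β = (Polynomial.X - Polynomial.C β) * contrPoly β := by
  have h : (pisotPolyR β).IsRoot β := by
    rw [Polynomial.IsRoot, pisotPolyR, Polynomial.eval_map]
    exact minpoly.aeval ℤ β
  exact (Polynomial.mul_divByMonic_eq_iff_isRoot.2 h).symm

theorem monic_contrPoly (hβ : IsPisotNumber β) : (contrPoly β).Monic := by
  have h : (pisotPolyR β).Monic := hβ.monic_minpoly.map _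
  rw [pisotPolyR_eq] at h
  exact (Polynomial.monic_X_sub_C β).of_mul_monic_left h

theorem monic_neutralPolyR (hσ : IsPrimitiveUnitPisot σ β) : (neutralPolyR σ β).Monic :=
  (monic_neutralPoly hσ).map _

/-- Minimal polynomials over `ℚ` are separable, so `β` is a simple root of `f`. -/
theorem eval_contrPoly_ne_zero (hβ : IsPisotNumber β) : (contrPoly β).eval β ≠ 0 := by
  have hirr : (minpoly ℚ β).Separable :=
    (minpoly.irreducible (hβ.1.tower_top (A := ℚ))).separable
  have h1 : pisotPolyR β = (minpoly ℚ β).map (algebraMap ℚ ℝ) := by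
    rw [minpoly.isIntegrallyClosed_eq_field_fractions' ℚ hβ.1, Polynomial.map_map, pisotPolyR]
    congr 1
  have h2 : (pisotPolyR β).Separable := h1 ▸ hirr.map
  rw [pisotPolyR_eq] at h2
  have h3 := h2.isCoprime
  intro h0
  obtain ⟨a, b, hab⟩ := h3
  have := congrArg (Polynomial.eval β) hab
  simp [h0] at this

theorem aeval_pisotPolyR (z : ℂ) :
    Polynomial.aeval z (pisotPolyR β) = Polynomial.aeval z (minpoly ℤ β) := by
  rw [pisotPolyR]
  exact Polynomial.aeval_map_algebraMap (R := ℤ) (A := ℝ) z (minpoly ℤ β)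

theorem norm_lt_one_of_aeval_contrPoly (hβ : IsPisotNumber β) (z : ℂ)
    (hz : Polynomial.aeval z (contrPoly β) = 0) : ‖z‖ < 1 := by
  refine hβ.2.2 z ?_ ?_
  · rw [← aeval_pisotPolyR, pisotPolyR_eq, map_mul, hz, mul_zero]
  · rintro rfl
    apply eval_contrPoly_ne_zero hβ
    have h := Polynomial.aeval_algebraMap_apply ℂ β (contrPoly β)
    rw [Complex.coe_algebraMap, hz] at h
    simpa using h.symm

theorem norm_eq_one_of_aeval_neutralPolyR (hnice : IsNice σ β) (z : ℂ)
    (hz : Polynomial.aeval z (neutralPolyR σ β) = 0) : ‖z‖ = 1 := by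
  refine (hnice.neutral.1 z ?_).1
  rw [← hz, neutralPolyR]
  exact (Polynomial.aeval_map_algebraMap (R := ℤ) (A := ℝ) z (neutralPoly σ β)).symm

theorem isCoprime_of_no_common_root {p q : ℝ[X]}
    (h : ∀ z : ℂ, Polynomial.aeval z p = 0 → Polynomial.aeval z q ≠ 0) : IsCoprime p q := by
  rw [Polynomial.isCoprime_iff_aeval_ne_zero_of_isAlgClosed ℝ ℂ]
  intro z
  by_cases hz : Polynomial.aeval z p = 0
  · exact Or.inr (h z hz)
  · exact Or.inl hz

theorem norm_eq_of_aeval_X_sub_C (hβ : IsPisotNumber β) (z : ℂ)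
    (hz : Polynomial.aeval z (Polynomial.X - Polynomial.C β) = 0) : ‖z‖ = β := by
  simp only [map_sub, Polynomial.aeval_X, Polynomial.aeval_C, sub_eq_zero] at hz
  rw [hz, Complex.coe_algebraMap, Complex.norm_real, Real.norm_of_nonneg (by linarith [hβ.2.1])]

/-- Here and in the next two results, common complex roots are excluded by their moduli: `β > 1`,
less than one, or equal to one. -/
theorem isCoprime_X_sub_C_contrPoly (hβ : IsPisotNumber β) :
    IsCoprime (Polynomial.X - Polynomial.C β) (contrPoly β) :=
  isCoprime_of_no_common_root fun z hz hz' => by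
    have h1 := norm_eq_of_aeval_X_sub_C hβ z hz
    have h2 := norm_lt_one_of_aeval_contrPoly hβ z hz'
    linarith [hβ.2.1]

theorem isCoprime_X_sub_C_neutralPolyR (hβ : IsPisotNumber β) (hnice : IsNice σ β) :
    IsCoprime (Polynomial.X - Polynomial.C β) (neutralPolyR σ β) :=
  isCoprime_of_no_common_root fun z hz hz' => by
    have h1 := norm_eq_of_aeval_X_sub_C hβ z hz
    have h2 := norm_eq_one_of_aeval_neutralPolyR hnice z hz'
    linarith [hβ.2.1]

theorem isCoprime_contrPoly_neutralPolyR (hβ : IsPisotNumber β) (hnice : IsNice σ β) :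
    IsCoprime (contrPoly β) (neutralPolyR σ β) :=
  isCoprime_of_no_common_root fun z hz hz' => by
    have h1 := norm_lt_one_of_aeval_contrPoly hβ z hz
    have h2 := norm_eq_one_of_aeval_neutralPolyR hnice z hz'
    linarith

theorem aeval_actR_eq_zero (hσ : IsPrimitiveUnitPisot σ β) :
    Polynomial.aeval (actR σ)
      ((Polynomial.X - Polynomial.C β) * contrPoly β * neutralPolyR σ β) = 0 := by
  have h : (actR σ).charpoly =
      (Polynomial.X - Polynomial.C β) * contrPoly β * neutralPolyR σ β := by
    rw [actR, Matrix.charpoly_toLin', ← pisotPolyR_eq, pisotPolyR, neutralPolyR,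
      ← Polynomial.map_mul, ← charpoly_eq hσ]
    exact (incidence σ).charpoly_map (Int.castRingHom ℝ)
  rw [← h]
  exact (actR σ).aeval_self_charpoly

/-! ### The splitting into expanding, contracting and neutral spaces -/

theorem expSpace_eq_ker : expSpace σ β =
    LinearMap.ker (Polynomial.aeval (actR σ) (Polynomial.X - Polynomial.C β)) := by
  rw [expSpace, Module.End.eigenspace_def]
  simp [Algebra.algebraMap_eq_smul_one]

theorem contrSpace_eq_ker : contrSpace σ β =
    LinearMap.ker (Polynomial.aeval (actR σ) (contrPoly β)) := rfl

theorem neutralSpace_eq_ker (hσ : IsPrimitiveUnitPisot σ β) (hnice : IsNice σ β) :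
    neutralSpace σ β = LinearMap.ker (Polynomial.aeval (actR σ) (neutralPolyR σ β)) := by
  rw [neutralSpace, pisotPolyR_eq]
  exact range_aeval_eq_ker_of_isCoprime _
    ((isCoprime_X_sub_C_neutralPolyR hσ.pisot hnice).mul_left
      (isCoprime_contrPoly_neutralPolyR hσ.pisot hnice)) (aeval_actR_eq_zero hσ)

theorem expSpace_sup_neutralSpace (hσ : IsPrimitiveUnitPisot σ β) (hnice : IsNice σ β) :
    expSpace σ β ⊔ neutralSpace σ β = LinearMap.ker (Polynomial.aeval (actR σ)
      ((Polynomial.X - Polynomial.C β) * neutralPolyR σ β)) := by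
  rw [expSpace_eq_ker, neutralSpace_eq_ker hσ hnice,
    Polynomial.sup_ker_aeval_eq_ker_aeval_mul_of_coprime _
      (isCoprime_X_sub_C_neutralPolyR hσ.pisot hnice)]

theorem contrSpace_sup_neutralSpace (hσ : IsPrimitiveUnitPisot σ β) (hnice : IsNice σ β) :
    contrSpace σ β ⊔ neutralSpace σ β = LinearMap.ker (Polynomial.aeval (actR σ)
      (contrPoly β * neutralPolyR σ β)) := by
  rw [contrSpace_eq_ker, neutralSpace_eq_ker hσ hnice,
    Polynomial.sup_ker_aeval_eq_ker_aeval_mul_of_coprime _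
      (isCoprime_contrPoly_neutralPolyR hσ.pisot hnice)]

theorem isCompl_contrSpace (hσ : IsPrimitiveUnitPisot σ β) (hnice : IsNice σ β) :
    IsCompl (contrSpace σ β) (expSpace σ β ⊔ neutralSpace σ β) := by
  rw [expSpace_sup_neutralSpace hσ hnice, contrSpace_eq_ker]
  refine isCompl_ker_of_isCoprime _ ((isCoprime_X_sub_C_contrPoly hσ.pisot).symm.mul_right
    (isCoprime_contrPoly_neutralPolyR hσ.pisot hnice)) ?_
  rw [← aeval_actR_eq_zero hσ]
  congr 1
  ring

theorem isCompl_expSpace (hσ : IsPrimitiveUnitPisot σ β) (hnice : IsNice σ β) :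
    IsCompl (expSpace σ β) (contrSpace σ β ⊔ neutralSpace σ β) := by
  rw [contrSpace_sup_neutralSpace hσ hnice, expSpace_eq_ker]
  refine isCompl_ker_of_isCoprime _ ((isCoprime_X_sub_C_contrPoly hσ.pisot).mul_right
    (isCoprime_X_sub_C_neutralPolyR hσ.pisot hnice)) ?_
  rw [← aeval_actR_eq_zero hσ]
  congr 1
  ring

theorem projC_eq (hσ : IsPrimitiveUnitPisot σ β) (hnice : IsNice σ β) :
    projC σ β = Submodule.projectionOnto _ _ (isCompl_contrSpace hσ hnice) :=
  dif_pos _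

theorem projE_eq (hσ : IsPrimitiveUnitPisot σ β) (hnice : IsNice σ β) :
    projE σ β = Submodule.projectionOnto _ _ (isCompl_expSpace hσ hnice) :=
  dif_pos _

theorem projC_of_mem (hσ : IsPrimitiveUnitPisot σ β) (hnice : IsNice σ β)
    (y : contrSpace σ β) : projC σ β (y : Fin n → ℝ) = y := by
  rw [projC_eq hσ hnice, Submodule.projectionOnto_apply_left]

theorem projC_eq_zero_iff (hσ : IsPrimitiveUnitPisot σ β) (hnice : IsNice σ β)
    (x : Fin n → ℝ) : projC σ β x = 0 ↔ Polynomial.aeval (actR σ)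
      ((Polynomial.X - Polynomial.C β) * neutralPolyR σ β) x = 0 := by
  rw [projC_eq hσ hnice, Submodule.projectionOnto_apply_eq_zero_iff,
    expSpace_sup_neutralSpace hσ hnice, LinearMap.mem_ker]

theorem projE_eq_zero_iff (hσ : IsPrimitiveUnitPisot σ β) (hnice : IsNice σ β)
    (x : Fin n → ℝ) : projE σ β x = 0 ↔ Polynomial.aeval (actR σ)
      (contrPoly β * neutralPolyR σ β) x = 0 := by
  rw [projE_eq hσ hnice, Submodule.projectionOnto_apply_eq_zero_iff,
    contrSpace_sup_neutralSpace hσ hnice, LinearMap.mem_ker]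

theorem aeval_actR_comm (p : ℝ[X]) (x : Fin n → ℝ) :
    Polynomial.aeval (actR σ) p (actR σ x) = actR σ (Polynomial.aeval (actR σ) p x) := by
  have h : Commute (Polynomial.aeval (actR σ) p) (actR σ) := by
    simpa using (Polynomial.commute_X p).symm.map (Polynomial.aeval (actR σ))
  exact LinearMap.congr_fun h.eq x

/-- Both `K_c` and its complement are kernels of polynomials in `M_σ`, hence invariant, so the
projection intertwines the actions. -/
theorem projC_actR (hσ : IsPrimitiveUnitPisot σ β) (hnice : IsNice σ β) (x : Fin n → ℝ) :
    projC σ β (actR σ x) = actC σ β (projC σ β x) := by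
  have h1 : projC σ β (actR σ (x - projC σ β x)) = 0 := by
    rw [projC_eq_zero_iff hσ hnice, aeval_actR_comm,
      (projC_eq_zero_iff hσ hnice _).1 (by rw [map_sub, projC_of_mem hσ hnice, sub_self]),
      map_zero]
  rw [map_sub, map_sub, sub_eq_zero] at h1
  rw [h1]
  exact projC_of_mem hσ hnice (actC σ β (projC σ β x))

theorem actR_of_mem_expSpace {x : Fin n → ℝ} (hx : x ∈ expSpace σ β) : actR σ x = β • x :=
  Module.End.mem_eigenspace_iff.1 hx

theorem projE_actR (hσ : IsPrimitiveUnitPisot σ β) (hnice : IsNice σ β) (x : Fin n → ℝ) :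
    projE σ β (actR σ x) = β • projE σ β x := by
  have hid : ∀ y : expSpace σ β, projE σ β (y : Fin n → ℝ) = y := fun y => by
    rw [projE_eq hσ hnice, Submodule.projectionOnto_apply_left]
  have h1 : projE σ β (actR σ (x - projE σ β x)) = 0 := by
    rw [projE_eq_zero_iff hσ hnice, aeval_actR_comm,
      (projE_eq_zero_iff hσ hnice _).1 (by rw [map_sub, hid, sub_self]), map_zero]
  rw [map_sub, map_sub, sub_eq_zero, actR_of_mem_expSpace (projE σ β x).2, map_smul, hid] at h1
  exact h1

/-! ### Contraction on the contracting space -/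

theorem coe_actC_pow (k : ℕ) (y : contrSpace σ β) :
    ((actC σ β ^ k) y : Fin n → ℝ) = (actR σ ^ k) y := by
  induction k with
  | zero => simp
  | succ k ih => rw [pow_succ', pow_succ', Module.End.mul_apply, Module.End.mul_apply, ← ih]; rfl

/-- The bound for single orbits becomes uniform by expanding a vector in the finitely many
projections of the canonical basis. -/
theorem exists_norm_actC_pow_le (hσ : IsPrimitiveUnitPisot σ β) (hnice : IsNice σ β) :
    ∃ C ρ : ℝ, 0 ≤ C ∧ 0 < ρ ∧ ρ < 1 ∧ ∀ (k : ℕ) (y : contrSpace σ β),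
      ‖(actC σ β ^ k) y‖ ≤ C * ρ ^ k * ‖y‖ := by
  obtain ⟨ρ, h0, h1, hρ⟩ := exists_lt_forall_root_norm_lt (monic_contrPoly hσ.pisot).ne_zero
    one_pos (norm_lt_one_of_aeval_contrPoly hσ.pisot)
  have h : ∀ y : contrSpace σ β, ∃ C : ℝ, ∀ k : ℕ, ‖(actC σ β ^ k) y‖ ≤ C * ρ ^ k := fun y => by
    obtain ⟨C, hC⟩ := exists_norm_pow_apply_le _ (monic_contrPoly hσ.pisot) hρ
      (y : Fin n → ℝ) (LinearMap.mem_ker.1 y.2)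
    refine ⟨C, fun k => ?_⟩
    rw [Submodule.coe_norm, coe_actC_pow]
    exact hC k
  choose C hC using h
  have hC0 : ∀ y, 0 ≤ C y := fun y => by
    have := (norm_nonneg _).trans (hC y 0)
    simpa using this
  refine ⟨∑ i : Fin n, C (projC σ β (Pi.single i 1)), ρ,
    Finset.sum_nonneg fun i _ => hC0 _, h0, h1, fun k y => ?_⟩
  have hy : y = ∑ i : Fin n, (y : Fin n → ℝ) i • projC σ β (Pi.single i 1) := by
    conv_lhs => rw [← projC_of_mem hσ hnice y, pi_eq_sum_univ' (y : Fin n → ℝ)]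
    rw [map_sum]
    refine Finset.sum_congr rfl fun i _ => ?_
    rw [map_smul]
  have hk : (actC σ β ^ k) y =
      ∑ i : Fin n, (y : Fin n → ℝ) i • (actC σ β ^ k) (projC σ β (Pi.single i 1)) := by
    conv_lhs => rw [hy]
    simp only [map_sum, map_smul]
  rw [hk, Finset.sum_mul, Finset.sum_mul]
  refine (norm_sum_le _ _).trans (Finset.sum_le_sum fun i _ => ?_)
  rw [norm_smul, mul_comm]
  have h2 : ‖(y : Fin n → ℝ) i‖ ≤ ‖y‖ := norm_le_pi_norm (y : Fin n → ℝ) i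
  exact mul_le_mul (hC _ k) h2 (norm_nonneg _) (mul_nonneg (hC0 _) (by positivity))

/-! ### Integer vectors -/

theorem actR_toReal (x : Fin n → ℤ) :
    actR σ (toReal x) = toReal ((incidence σ).mulVec x) := by
  ext i
  simp [actR, toReal, Matrix.mulVec, dotProduct]

theorem toReal_add (x y : Fin n → ℤ) : toReal (x + y) = toReal x + toReal y := by
  ext i; simp [toReal]

theorem toReal_sub (x y : Fin n → ℤ) : toReal (x - y) = toReal x - toReal y := by
  ext i; simp [toReal]

theorem toReal_smul (c : ℤ) (x : Fin n → ℤ) : toReal (c • x) = (c : ℝ) • toReal x := by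
  ext i; simp [toReal]

@[simp] theorem toReal_zero : toReal (0 : Fin n → ℤ) = 0 := by
  ext i; simp [toReal]

theorem mulVec_inv_incidence (hσ : IsPrimitiveUnitPisot σ β) (hnice : IsNice σ β)
    (x : Fin n → ℤ) : (incidence σ).mulVec ((incidence σ)⁻¹.mulVec x) = x := by
  rw [Matrix.mulVec_mulVec, Matrix.mul_nonsing_inv _ (isUnit_det_incidence hσ hnice),
    Matrix.one_mulVec]

theorem inv_incidence_mulVec (hσ : IsPrimitiveUnitPisot σ β) (hnice : IsNice σ β)
    (x : Fin n → ℤ) : (incidence σ)⁻¹.mulVec ((incidence σ).mulVec x) = x := by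
  rw [Matrix.mulVec_mulVec, Matrix.nonsing_inv_mul _ (isUnit_det_incidence hσ hnice),
    Matrix.one_mulVec]

theorem actR_injective (hσ : IsPrimitiveUnitPisot σ β) (hnice : IsNice σ β) :
    Function.Injective (actR σ) := by
  have hM : IsUnit ((incidence σ).map (Int.cast : ℤ → ℝ)) := by
    have h := ((Matrix.isUnit_iff_isUnit_det _).2 (isUnit_det_incidence hσ hnice)).map
      (Int.castRingHom ℝ).mapMatrix
    exact h
  have h := Matrix.mulVec_injective_of_isUnit hM
  intro x y hxy
  exact h (by simpa [actR, Matrix.toLin'_apply] using hxy)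

theorem actC_bijective (hσ : IsPrimitiveUnitPisot σ β) (hnice : IsNice σ β) :
    Function.Bijective (actC σ β) := by
  have hinj : Function.Injective (actC σ β) := fun x y hxy =>
    Subtype.ext (actR_injective hσ hnice (congrArg Subtype.val hxy))
  exact ⟨hinj, LinearMap.injective_iff_surjective.1 hinj⟩

theorem eq_zero_of_norm_toReal_lt_one {x : Fin n → ℤ} (hx : ‖toReal x‖ < 1) : x = 0 := by
  ext i
  have h := (norm_le_pi_norm (toReal x) i).trans_lt hx
  have h2 : |x i| < 1 := by
    rw [toReal, Real.norm_eq_abs] at h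
    exact_mod_cast h
  simpa using h2

/-- The forward orbit consists of integer vectors and tends to zero, so it reaches zero; injectivity
of `M_σ` carries this back to the start. -/
theorem eq_zero_of_toReal_mem_contrSpace (hσ : IsPrimitiveUnitPisot σ β) (hnice : IsNice σ β)
    {x : Fin n → ℤ} (hx : toReal x ∈ contrSpace σ β) : toReal x = 0 := by
  obtain ⟨C, ρ, -, hρ0, hρ, h⟩ := exists_norm_actC_pow_le hσ hnice
  have hint : ∀ (k : ℕ) (x : Fin n → ℤ), (actR σ ^ k) (toReal x) =
      toReal (((incidence σ) ^ k).mulVec x) := by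
    intro k
    induction k with
    | zero => simp
    | succ k ih =>
      intro x
      rw [pow_succ, Module.End.mul_apply, actR_toReal, ih, Matrix.mulVec_mulVec, ← pow_succ]
  have hlim : Tendsto (fun k : ℕ => C * ρ ^ k * ‖(⟨toReal x, hx⟩ : contrSpace σ β)‖)
      atTop (𝓝 0) := by
    simpa using ((tendsto_pow_atTop_nhds_zero_of_lt_one hρ0.le hρ).const_mul C).mul_const
      ‖(⟨toReal x, hx⟩ : contrSpace σ β)‖
  obtain ⟨k, hk⟩ := (hlim.eventually (gt_mem_nhds one_pos)).exists
  have h1 := (h k ⟨toReal x, hx⟩).trans_lt hk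
  rw [Submodule.coe_norm, coe_actC_pow, hint] at h1
  have h2 := eq_zero_of_norm_toReal_lt_one h1
  have h3 : (actR σ ^ k) (toReal x) = 0 := by rw [hint, h2, toReal_zero]
  have h4 : Function.Injective (actR σ ^ k) := by
    rw [Module.End.coe_pow]; exact (actR_injective hσ hnice).iterate k
  exact h4 (h3.trans (map_zero _).symm)

/-- Since `M_σ` is invertible over `ℤ`, the backward orbit stays integral, while it shrinks like
`β⁻¹ ^ k`. -/
theorem eq_zero_of_toReal_mem_expSpace (hσ : IsPrimitiveUnitPisot σ β) (hnice : IsNice σ β)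
    {x : Fin n → ℤ} (hx : toReal x ∈ expSpace σ β) : toReal x = 0 := by
  have hβ := hσ.pisot.2.1
  have hβ0 : β ≠ 0 := by linarith
  have h : ∀ k : ℕ, ∃ y : Fin n → ℤ, toReal y = (β⁻¹) ^ k • toReal x := by
    intro k
    induction k with
    | zero => exact ⟨x, by simp⟩
    | succ k ih =>
      obtain ⟨y, hy⟩ := ih
      refine ⟨(incidence σ)⁻¹.mulVec y, actR_injective hσ hnice ?_⟩
      rw [actR_toReal, mulVec_inv_incidence hσ hnice, map_smul, actR_of_mem_expSpace hx, hy,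
        smul_smul, pow_succ, mul_assoc, inv_mul_cancel₀ hβ0, mul_one]
  have hlim : Tendsto (fun k : ℕ => (β⁻¹) ^ k * ‖toReal x‖) atTop (𝓝 0) := by
    simpa using (tendsto_pow_atTop_nhds_zero_of_lt_one (by positivity)
      (inv_lt_one_of_one_lt₀ hβ)).mul_const ‖toReal x‖
  obtain ⟨k, hk⟩ := (hlim.eventually (gt_mem_nhds one_pos)).exists
  obtain ⟨y, hy⟩ := h k
  have h1 : y = 0 := eq_zero_of_norm_toReal_lt_one (by
    rw [hy, norm_smul, Real.norm_of_nonneg (by positivity)]; exact hk)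
  rw [h1, toReal_zero] at hy
  exact (smul_eq_zero.1 hy.symm).resolve_left (by positivity)

theorem exists_toReal_eq_aeval_neutralPolyR (x : Fin n → ℤ) :
    ∃ y : Fin n → ℤ, toReal y = Polynomial.aeval (actR σ) (neutralPolyR σ β) (toReal x) := by
  unfold neutralPolyR
  induction neutralPoly σ β using Polynomial.induction_on' with
  | add p q hp hq =>
    obtain ⟨y, hy⟩ := hp
    obtain ⟨z, hz⟩ := hq
    exact ⟨y + z, by rw [toReal_add, hy, hz, Polynomial.map_add, map_add, LinearMap.add_apply]⟩
  | monomial k a =>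
    have h : ∀ k : ℕ, ∃ y : Fin n → ℤ, toReal y = (actR σ ^ k) (toReal x) := by
      intro k
      induction k with
      | zero => exact ⟨x, by simp⟩
      | succ k ih =>
        obtain ⟨y, hy⟩ := ih
        exact ⟨(incidence σ).mulVec y, by
          rw [← actR_toReal, hy, pow_succ', Module.End.mul_apply]⟩
    obtain ⟨y, hy⟩ := h k
    refine ⟨a • y, ?_⟩
    rw [toReal_smul, hy, Polynomial.map_monomial, Polynomial.aeval_monomial,
      Module.End.mul_apply, Module.algebraMap_end_apply]
    rfl

/-- For an integer vector the expanding component vanishes if and only if the contracting one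
does. -/
theorem projC_toReal_eq_zero_iff (hσ : IsPrimitiveUnitPisot σ β) (hnice : IsNice σ β)
    (x : Fin n → ℤ) : projC σ β (toReal x) = 0 ↔ projE σ β (toReal x) = 0 := by
  -- Applying `g(M_σ)` kills the neutral component and keeps the vector integral. If one of the
  -- other two components vanishes, the result lies in `K_e` or in `K_c`, where zero is the only
  -- integer vector.
  obtain ⟨y, hy⟩ := exists_toReal_eq_aeval_neutralPolyR (σ := σ) (β := β) x
  rw [projC_eq_zero_iff hσ hnice, projE_eq_zero_iff hσ hnice, map_mul, map_mul,
    Module.End.mul_apply, Module.End.mul_apply, ← hy]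
  constructor
  · intro h
    rw [eq_zero_of_toReal_mem_expSpace hσ hnice (by rwa [expSpace_eq_ker, LinearMap.mem_ker]),
      map_zero]
  · intro h
    rw [eq_zero_of_toReal_mem_contrSpace hσ hnice (LinearMap.mem_ker.2 h), map_zero]

/-! ### Positivity of the expanding coordinate -/

/-- The eigenspace is at most a line because `β` is a simple root of the characteristic polynomial.
-/
theorem finrank_expSpace_le_one (hσ : IsPrimitiveUnitPisot σ β) (hnice : IsNice σ β) :
    Module.finrank ℝ (expSpace σ β) ≤ 1 := by
  refine ((actR σ).finrank_eigenspace_le β).trans ?_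
  have h : (actR σ).charpoly =
      (Polynomial.X - Polynomial.C β) * (contrPoly β * neutralPolyR σ β) := by
    rw [actR, Matrix.charpoly_toLin', ← mul_assoc, ← pisotPolyR_eq, pisotPolyR, neutralPolyR,
      ← Polynomial.map_mul, ← charpoly_eq hσ]
    exact (incidence σ).charpoly_map (Int.castRingHom ℝ)
  by_contra! h2
  have h3 := (Polynomial.le_rootMultiplicity_iff (actR σ).charpoly_monic.ne_zero).1 h2
  rw [h, pow_two] at h3
  have h4 := (mul_dvd_mul_iff_left (Polynomial.X_sub_C_ne_zero β)).1 h3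
  have h5 := (isCoprime_X_sub_C_contrPoly hσ.pisot).mul_right
    (isCoprime_X_sub_C_neutralPolyR hσ.pisot hnice)
  exact Polynomial.not_isUnit_X_sub_C β (h5.isUnit_of_dvd' dvd_rfl h4)

theorem actR_nonneg {x : Fin n → ℝ} (hx : 0 ≤ x) : 0 ≤ actR σ x := by
  intro i
  rw [actR, Matrix.toLin'_apply, Matrix.mulVec, dotProduct]
  refine Finset.sum_nonneg fun j _ => mul_nonneg ?_ (hx j)
  simp [incidence, abel]

theorem actR_pow_nonneg (k : ℕ) {x : Fin n → ℝ} (hx : 0 ≤ x) : 0 ≤ (actR σ ^ k) x := by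
  induction k with
  | zero => simpa
  | succ k ih => rw [pow_succ', Module.End.mul_apply]; exact actR_nonneg ih

theorem coe_projE_of_mem (hσ : IsPrimitiveUnitPisot σ β) (hnice : IsNice σ β)
    (y : expSpace σ β) : projE σ β (y : Fin n → ℝ) = y := by
  rw [projE_eq hσ hnice, Submodule.projectionOnto_apply_left]

theorem norm_lt_of_aeval_contrPoly_mul (hσ : IsPrimitiveUnitPisot σ β) (hnice : IsNice σ β)
    (z : ℂ) (hz : Polynomial.aeval z (contrPoly β * neutralPolyR σ β) = 0) : ‖z‖ < β := by
  rw [map_mul, mul_eq_zero] at hz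
  have hβ := hσ.pisot.2.1
  rcases hz with hz | hz
  · exact (norm_lt_one_of_aeval_contrPoly hσ.pisot z hz).trans hβ
  · rwa [norm_eq_one_of_aeval_neutralPolyR hnice z hz]

/-- The component of `x` off `K_e` grows at most like `ρ ^ k` with `ρ < β`, so the expanding
component is the limit of the non-negative vectors `β ^ (-k) M_σ ^ k x`. -/
theorem projE_nonneg (hσ : IsPrimitiveUnitPisot σ β) (hnice : IsNice σ β) {x : Fin n → ℝ}
    (hx : 0 ≤ x) : 0 ≤ (projE σ β x : Fin n → ℝ) := by
  have hβ : 0 < β := one_pos.trans hσ.pisot.2.1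
  have hmon := (monic_contrPoly hσ.pisot).mul (monic_neutralPolyR hσ)
  obtain ⟨ρ, h0, h1, hρ⟩ := exists_lt_forall_root_norm_lt hmon.ne_zero hβ
    (norm_lt_of_aeval_contrPoly_mul hσ hnice)
  obtain ⟨C, hC⟩ := exists_norm_pow_apply_le _ hmon hρ (x - (projE σ β x : Fin n → ℝ))
    ((projE_eq_zero_iff hσ hnice _).1 (by
      rw [map_sub, coe_projE_of_mem hσ hnice, sub_self]))
  have hpow : ∀ k : ℕ, (actR σ ^ k) (projE σ β x : Fin n → ℝ) = β ^ k • projE σ β x := by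
    intro k
    induction k with
    | zero => simp
    | succ k ih =>
      rw [pow_succ, Module.End.mul_apply, actR_of_mem_expSpace (projE σ β x).2, map_smul, ih,
        smul_smul, pow_succ']
  intro i
  have hlim : Tendsto (fun k : ℕ => -(C * (ρ / β) ^ k)) atTop (𝓝 0) := by
    simpa using ((tendsto_pow_atTop_nhds_zero_of_lt_one (by positivity)
      ((div_lt_one hβ).2 h1)).const_mul C).neg
  refine le_of_tendsto' hlim fun k => ?_
  have h2 : 0 ≤ (actR σ ^ k) x i := actR_pow_nonneg k hx i
  have h3 : (actR σ ^ k) (x - (projE σ β x : Fin n → ℝ)) i = (actR σ ^ k) x i -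
      β ^ k * (projE σ β x : Fin n → ℝ) i := by
    rw [map_sub, hpow]; simp
  have h4 : (actR σ ^ k) (x - (projE σ β x : Fin n → ℝ)) i ≤ C * ρ ^ k :=
    (le_abs_self _).trans ((norm_le_pi_norm _ i).trans (hC k))
  rw [h3] at h4
  have h5 : 0 < β ^ k := by positivity
  rw [div_pow, ← mul_div_assoc, ← neg_div, div_le_iff₀ h5]
  linarith

theorem actR_pow_single (p : ℕ) (i : Fin n) : (actR σ ^ p) (Pi.single i 1) =
    ∑ j, ((incidence σ ^ p) j i : ℝ) • (Pi.single j 1 : Fin n → ℝ) := by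
  have h : actR σ ^ p = Matrix.toLin' ((incidence σ ^ p).map (Int.cast : ℤ → ℝ)) := by
    rw [actR, ← Matrix.toLin'_pow]
    congr 1
    exact (map_pow (Int.castRingHom ℝ).mapMatrix (incidence σ) p).symm
  ext k
  simp [h, Matrix.toLin'_apply, Pi.single_apply]

/-- The expanding component is governed by a linear form that is positive on the canonical basis. -/
theorem exists_expanding_coordinate (hσ : IsPrimitiveUnitPisot σ β) (hnice : IsNice σ β) :
    ∃ (u : expSpace σ β) (ℓ : (Fin n → ℝ) →ₗ[ℝ] ℝ), u ≠ 0 ∧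
      (∀ x, projE σ β x = ℓ x • u) ∧ (∀ i, 0 < ℓ (Pi.single i 1)) ∧
      ∀ x, ℓ (actR σ x) = β * ℓ x := by
  have hβ : 0 < β := one_pos.trans hσ.pisot.2.1
  -- Otherwise `projE σ β` would vanish identically, yet it fixes any eigenvector for `β`.
  have hne : ∃ i : Fin n, projE σ β (Pi.single i 1) ≠ 0 := by
    by_contra! h
    have h0 : projE σ β = 0 := by
      refine LinearMap.pi_ext' fun i => LinearMap.ext_ring ?_
      simpa using h i
    obtain ⟨v, hv⟩ : ∃ v : Fin n → ℝ, Module.End.HasEigenvector (actR σ) β v := by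
      refine Module.End.HasEigenvalue.exists_hasEigenvector ?_
      rw [Module.End.hasEigenvalue_iff_isRoot_charpoly, actR, Matrix.charpoly_toLin',
        Polynomial.IsRoot]
      have h1 := (incidence σ).charpoly_map (Int.castRingHom ℝ)
      have h2 := hσ.dominant.1
      rw [Polynomial.aeval_def, ← Polynomial.eval_map] at h2
      rw [← h2]
      exact congrArg _ h1
    have h3 := coe_projE_of_mem hσ hnice ⟨v, hv.1⟩
    rw [h0] at h3
    exact hv.2 (congrArg Subtype.val h3.symm)
  obtain ⟨i₀, hi₀⟩ := hne
  set u := projE σ β (Pi.single i₀ 1) with hu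
  have hu0 : (0 : Fin n → ℝ) ≤ u := projE_nonneg hσ hnice (by
    intro j; by_cases h : j = i₀ <;> simp [h])
  have hspan : ∀ y : expSpace σ β, ∃ c : ℝ, c • u = y := by
    refine (finrank_eq_one_iff_of_nonzero' u hi₀).1 (le_antisymm
      (finrank_expSpace_le_one hσ hnice) ?_)
    exact Module.finrank_pos_iff_exists_ne_zero.2 ⟨u, hi₀⟩
  obtain ⟨j, hj⟩ : ∃ j, (u : Fin n → ℝ) j ≠ 0 := by
    by_contra! h
    exact hi₀ (Subtype.ext (funext h))
  have hj0 : 0 < (u : Fin n → ℝ) j := lt_of_le_of_ne (hu0 j) hj.symm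
  let ℓ : (Fin n → ℝ) →ₗ[ℝ] ℝ :=
    ((u : Fin n → ℝ) j)⁻¹ • (LinearMap.proj j ∘ₗ (expSpace σ β).subtype ∘ₗ projE σ β)
  have hℓ : ∀ x, ℓ x = ((u : Fin n → ℝ) j)⁻¹ * (projE σ β x : Fin n → ℝ) j := fun x => rfl
  have hℓT : ∀ x, ℓ (actR σ x) = β * ℓ x := fun x => by
    rw [hℓ, hℓ, projE_actR hσ hnice, Submodule.coe_smul, Pi.smul_apply, smul_eq_mul]; ring
  have hℓ0 : ∀ i, 0 ≤ ℓ (Pi.single i 1) := fun i => by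
    rw [hℓ]
    refine mul_nonneg (by positivity) (projE_nonneg hσ hnice (fun k => ?_) j)
    by_cases h : k = i <;> simp [h]
  have hℓi : ℓ (Pi.single i₀ 1) = 1 := by
    rw [hℓ, ← hu, inv_mul_cancel₀ hj]
  refine ⟨u, ℓ, hi₀, fun x => ?_, fun i => ?_, hℓT⟩
  · obtain ⟨c, hc⟩ := hspan (projE σ β x)
    rw [hℓ, ← hc, Submodule.coe_smul, Pi.smul_apply, smul_eq_mul, mul_comm c, ← mul_assoc,
      inv_mul_cancel₀ hj, one_mul]
  -- A power of `M_σ` has positive entries, so `β ^ p * ℓ(eᵢ)` is at least a positive multiple of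
  -- `ℓ(e_{i₀}) = 1`.
  · obtain ⟨p, -, hp⟩ := hσ.primitive.exists_pos_pow
    have h1 : ∀ k : ℕ, ∀ x, ℓ ((actR σ ^ k) x) = β ^ k * ℓ x := fun k => by
      induction k with
      | zero => simp
      | succ k ih => intro x; rw [pow_succ', Module.End.mul_apply, hℓT, ih]; ring
    have h2 := h1 p (Pi.single i 1)
    rw [actR_pow_single, map_sum] at h2
    simp only [map_smul, smul_eq_mul] at h2
    have h3 : ((incidence σ ^ p) i₀ i : ℝ) * ℓ (Pi.single i₀ 1) ≤
        ∑ j, ((incidence σ ^ p) j i : ℝ) * ℓ (Pi.single j 1) :=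
      Finset.single_le_sum (f := fun j => ((incidence σ ^ p) j i : ℝ) * ℓ (Pi.single j 1))
        (fun j _ => mul_nonneg (by exact_mod_cast (hp j i).le) (hℓ0 j)) (Finset.mem_univ i₀)
    rw [hℓi, mul_one, h2] at h3
    have h4 : (0 : ℝ) < (incidence σ ^ p) i₀ i := by exact_mod_cast hp i₀ i
    exact pos_of_mul_pos_right (h4.trans_le h3) (by positivity)

/-! ### Abelianizations -/

theorem abel_append (v w : List (Fin n)) : abel (v ++ w) = abel v + abel w := by
  ext b; simp [abel]

theorem abel_cons (i : Fin n) (w : List (Fin n)) : abel (i :: w) = Pi.single i 1 + abel w := by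
  ext b
  by_cases h : i = b
  · subst h; simp [abel, add_comm]
  · simp [abel, h, Ne.symm h]

theorem abel_eq_take_add_drop (w : List (Fin n)) (j : Fin w.length) :
    abel w = abel (w.take j) + Pi.single (w.get j) 1 + abel (w.drop (j + 1)) := by
  conv_lhs => rw [← List.take_append_drop j w, List.drop_eq_getElem_cons j.2]
  rw [abel_append, abel_cons, add_assoc]
  rfl

theorem incidence_mulVec_single (i : Fin n) :
    (incidence σ).mulVec (Pi.single i 1) = abel (σ.word i) := by
  ext b
  simp [incidence]

/-- This identity trades prefixes for suffixes. It yields the suffix form of the geometric dual map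
and the preservation of faces near `K_c`. -/
theorem incidence_mulVec_abelType {b a : Finset (Fin n)} {τ : b ≃ a} {j : Positions σ b}
    (h : IsDecomp σ τ j) :
    (incidence σ).mulVec (abelType b) = prefixVec σ j + abelType a + suffixVec σ j := by
  have h1 : (incidence σ).mulVec (abelType b) = ∑ i : b, abel (σ.word i) := by
    rw [abelType, Matrix.mulVec_sum, ← Finset.sum_coe_sort]
    exact Finset.sum_congr rfl fun i _ => incidence_mulVec_single _
  have h2 : abelType a = ∑ i : b, Pi.single ((σ.word i).get (j i)) 1 := by
    rw [abelType, ← Finset.sum_coe_sort, ← Equiv.sum_comp τ]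
    exact Finset.sum_congr rfl fun i _ => by rw [h i]
  rw [h1, h2, prefixVec, suffixVec, ← Finset.sum_add_distrib, ← Finset.sum_add_distrib]
  exact Finset.sum_congr rfl fun i _ => abel_eq_take_add_drop _ _

/-! ### Descendants of faces -/

/-- `H` is one of the faces of the patch that the geometric dual map assigns to `F`. -/
def Child (σ : Substitution n) (F H : Face n) : Prop :=
  ∃ (τ : (H.2ᶜ : Finset (Fin n)) ≃ (F.2ᶜ : Finset (Fin n))) (j : Positions σ H.2ᶜ),
    IsDecomp σ τ j ∧ (incidence σ).mulVec H.1 = F.1 + suffixVec σ j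

/-- `H` is a descendant of `F` of generation `k`. -/
def Desc (σ : Substitution n) : ℕ → Face n → Face n → Prop
  | 0, F, H => F = H
  | k + 1, F, H => ∃ G, Desc σ k F G ∧ Child σ G H

theorem desc_one {F H : Face n} : Desc σ 1 F H ↔ Child σ F H := by
  simp [Desc]

theorem desc_add {k l : ℕ} {F H : Face n} :
    Desc σ (k + l) F H ↔ ∃ G, Desc σ k F G ∧ Desc σ l G H := by
  induction l generalizing H with
  | zero => simp [Desc]
  | succ l ih =>
    rw [← add_assoc]
    simp only [Desc, ih]
    constructor
    · rintro ⟨G, ⟨G', h1, h2⟩, h3⟩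
      exact ⟨G', h1, G, h2, h3⟩
    · rintro ⟨G', h1, G, h2, h3⟩
      exact ⟨G, ⟨G', h1, h2⟩, h3⟩

theorem Child.card_eq {F H : Face n} (h : Child σ F H) : H.2.card = F.2.card := by
  obtain ⟨τ, -⟩ := h
  have h1 := Fintype.card_congr τ
  rw [Fintype.card_coe, Fintype.card_coe, Finset.card_compl, Finset.card_compl] at h1
  have h2 := Finset.card_le_univ F.2
  have h3 := Finset.card_le_univ H.2
  omega

theorem Desc.card_eq {k : ℕ} {F H : Face n} (h : Desc σ k F H) : H.2.card = F.2.card := by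
  induction k generalizing H with
  | zero => rw [show F = H from h]
  | succ k ih =>
    obtain ⟨G, h1, h2⟩ := h
    rw [h2.card_eq, ih h1]

theorem Child.translate {F H : Face n} (h : Child σ F H) (z : Fin n → ℤ) :
    Child σ (F.1 + (incidence σ).mulVec z, F.2) (H.1 + z, H.2) := by
  obtain ⟨τ, j, h1, h2⟩ := h
  refine ⟨τ, j, h1, ?_⟩
  rw [Matrix.mulVec_add, h2]
  exact add_right_comm _ _ _

/-- As `M_σ` is invertible over `ℤ`, this covariance reduces questions about any face to the face of
the same type at the origin. -/
theorem Desc.translate {k : ℕ} {F H : Face n} (h : Desc σ k F H) (z : Fin n → ℤ) :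
    Desc σ k (F.1 + (incidence σ ^ k).mulVec z, F.2) (H.1 + z, H.2) := by
  induction k generalizing H z with
  | zero =>
    have h : F = H := h
    subst h
    simp [Desc]
  | succ k ih =>
    obtain ⟨G, h1, h2⟩ := h
    refine ⟨_, ?_, h2.translate z⟩
    have := ih h1 ((incidence σ).mulVec z)
    rwa [Matrix.mulVec_mulVec, ← pow_succ] at this

/-! ### The geometric dual map on faces -/

-- The shifts by `l(a)` and `l(b)` in the Poincaré map and its inverse turn the prefix formula of
-- the dual map into this suffix formula.
open Classical in
theorem geomDual_single (hσ : IsPrimitiveUnitPisot σ β) (hnice : IsNice σ β) (F : Face n) :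
    geomDual σ (Finsupp.single F 1) =
      ∑ b : Finset (Fin n), ∑ τ : b ≃ (F.2ᶜ : Finset (Fin n)), ∑ j : Positions σ b,
      if IsDecomp σ τ j then
        Finsupp.single ((incidence σ)⁻¹.mulVec (F.1 + suffixVec σ j), bᶜ)
          (typeSign F.2ᶜ * (bijSign τ * typeSign b))
      else 0 := by
  rw [geomDual, LinearMap.comp_apply, LinearMap.comp_apply, poincareInv,
    Finsupp.linearCombination_single, one_smul, dualMap, Finsupp.linearCombination_single,
    map_smul, map_sum, Finset.smul_sum]
  refine Finset.sum_congr rfl fun b _ => ?_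
  rw [map_sum, Finset.smul_sum]
  refine Finset.sum_congr rfl fun τ _ => ?_
  rw [map_sum, Finset.smul_sum]
  refine Finset.sum_congr rfl fun j _ => ?_
  split_ifs with h
  · rw [poincare, Finsupp.linearCombination_single, Finsupp.smul_single, Finsupp.smul_single,
      smul_eq_mul, smul_eq_mul, transverse]
    congr 2
    rw [← inv_incidence_mulVec hσ hnice (abelType b), ← Matrix.mulVec_add,
      incidence_mulVec_abelType h]
    congr 1
    ext i
    simp only [Pi.add_apply, Pi.sub_apply]
    ring
  · simp

theorem child_of_mem_support (hσ : IsPrimitiveUnitPisot σ β) (hnice : IsNice σ β)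
    {F H : Face n} (h : H ∈ (geomDual σ (Finsupp.single F 1)).support) : Child σ F H := by
  classical
  rw [geomDual_single hσ hnice] at h
  obtain ⟨b, -, h⟩ := Finset.mem_biUnion.1 (Finsupp.support_finsetSum h)
  obtain ⟨τ, -, h⟩ := Finset.mem_biUnion.1 (Finsupp.support_finsetSum h)
  obtain ⟨j, -, h⟩ := Finset.mem_biUnion.1 (Finsupp.support_finsetSum h)
  split_ifs at h with hd
  · have h1 := Finset.mem_singleton.1 (Finsupp.support_single_subset h)
    obtain ⟨x, a⟩ := H
    obtain ⟨rfl, rfl⟩ := Prod.mk.inj h1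
    have key : ∀ c : Finset (Fin n), c = b → ∃ (τ : (c : Finset (Fin n)) ≃
        (F.2ᶜ : Finset (Fin n))) (j' : Positions σ c), IsDecomp σ τ j' ∧
        suffixVec σ j' = suffixVec σ j := by
      rintro c rfl
      exact ⟨τ, j, hd, rfl⟩
    obtain ⟨τ', j', h2, h3⟩ := key bᶜᶜ (compl_compl b)
    exact ⟨τ', j', h2, by rw [mulVec_inv_incidence hσ hnice, h3]⟩
  · simp at h

/-- By the positivity condition all terms located at the face `H` carry one common sign, so the term
coming from the given decomposition cannot be cancelled. -/
theorem mem_support_of_child (hσ : IsPrimitiveUnitPisot σ β) (hnice : IsNice σ β)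
    {F H : Face n} (hF : (F.2ᶜ).card = n + 1 - deg β) (h : Child σ F H) :
    H ∈ (geomDual σ (Finsupp.single F 1)).support := by
  classical
  obtain ⟨ε, hε, -⟩ := hnice.positivity
  obtain ⟨τ₀, j₀, hd₀, hH⟩ := h
  have hcard : ∀ {b : Finset (Fin n)}, (b ≃ (F.2ᶜ : Finset (Fin n))) →
      b.card = n + 1 - deg β := fun {b} τ => by
    rw [← hF, ← Fintype.card_coe, ← Fintype.card_coe]; exact Fintype.card_congr τ
  set s : ℤ := typeSign F.2ᶜ * ((ε ⟨F.2ᶜ, hF⟩ : ℤ) * (ε ⟨H.2ᶜ, hcard τ₀⟩ : ℤ) * typeSign H.2ᶜ)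
    with hs
  have hss : s * s = 1 := by
    have h1 : ∀ e : ℤˣ, (e : ℤ) * (e : ℤ) = 1 := fun e => by
      rw [← Units.val_mul, Int.units_mul_self, Units.val_one]
    calc s * s = (typeSign F.2ᶜ * typeSign F.2ᶜ) *
          ((ε ⟨F.2ᶜ, hF⟩ : ℤ) * (ε ⟨F.2ᶜ, hF⟩ : ℤ)) *
          ((ε ⟨H.2ᶜ, hcard τ₀⟩ : ℤ) * (ε ⟨H.2ᶜ, hcard τ₀⟩ : ℤ)) *
          (typeSign H.2ᶜ * typeSign H.2ᶜ) := by rw [hs]; ring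
      _ = 1 := by rw [typeSign_mul_self, typeSign_mul_self, h1, h1]; norm_num
  have hval : ∀ (b : Finset (Fin n)) (τ : b ≃ (F.2ᶜ : Finset (Fin n))) (j : Positions σ b),
      IsDecomp σ τ j → b = H.2ᶜ → typeSign F.2ᶜ * (bijSign τ * typeSign b) = s := by
    rintro b τ j hd rfl
    rw [hε ⟨F.2ᶜ, hF⟩ ⟨H.2ᶜ, hcard τ₀⟩ τ j hd, hs]
    push_cast
    ring
  suffices hpos : 0 < s * geomDual σ (Finsupp.single F 1) H by
    rw [Finsupp.mem_support_iff]
    intro h0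
    rw [h0, mul_zero] at hpos
    exact lt_irrefl _ hpos
  rw [geomDual_single hσ hnice]
  simp only [Finsupp.finsetSum_apply, Finset.mul_sum]
  have hnn : ∀ (b : Finset (Fin n)) (τ : b ≃ (F.2ᶜ : Finset (Fin n))) (j : Positions σ b),
      0 ≤ s * (if IsDecomp σ τ j then
        Finsupp.single ((incidence σ)⁻¹.mulVec (F.1 + suffixVec σ j), bᶜ)
          (typeSign F.2ᶜ * (bijSign τ * typeSign b)) else 0 : Chain n) H := by
    intro b τ j
    split_ifs with hd
    · rw [Finsupp.single_apply]
      split_ifs with h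
      · rw [hval b τ j hd (by rw [← h, compl_compl]), hss]; exact zero_le_one
      · simp
    · simp
  refine Finset.sum_pos' (fun b _ => Finset.sum_nonneg fun τ _ => Finset.sum_nonneg fun j _ =>
    hnn b τ j) ⟨H.2ᶜ, Finset.mem_univ _, ?_⟩
  refine Finset.sum_pos' (fun τ _ => Finset.sum_nonneg fun j _ => hnn _ τ j)
    ⟨τ₀, Finset.mem_univ _, ?_⟩
  refine Finset.sum_pos' (fun j _ => hnn _ τ₀ j) ⟨j₀, Finset.mem_univ _, ?_⟩
  rw [if_pos hd₀, hval _ τ₀ j₀ hd₀ rfl, Finsupp.single_apply, if_pos, hss]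
  · exact zero_lt_one
  · rw [← hH, inv_incidence_mulVec hσ hnice, compl_compl]

theorem mem_support_geomDual_single_iff (hσ : IsPrimitiveUnitPisot σ β) (hnice : IsNice σ β)
    {F H : Face n} (hF : F.2.card = deg β - 1) :
    H ∈ (geomDual σ (Finsupp.single F 1)).support ↔ Child σ F H := by
  refine ⟨child_of_mem_support hσ hnice, mem_support_of_child hσ hnice ?_⟩
  have h1 := deg_pos hσ
  have h2 := deg_le hσ
  rw [Finset.card_compl, Fintype.card_fin, hF]
  omega

/-! ### Faces near to the contracting space -/

theorem apply_toReal_nonneg {ℓ : (Fin n → ℝ) →ₗ[ℝ] ℝ} (hℓ : ∀ i, 0 < ℓ (Pi.single i 1))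
    {x : Fin n → ℤ} (hx : 0 ≤ x) : 0 ≤ ℓ (toReal x) := by
  have h : toReal x = ∑ i, (x i : ℝ) • (Pi.single i 1 : Fin n → ℝ) := by
    ext k; simp [toReal, Pi.single_apply]
  rw [h, map_sum]
  refine Finset.sum_nonneg fun i _ => ?_
  rw [map_smul]
  exact mul_nonneg (by exact_mod_cast hx i) (hℓ i).le

theorem apply_toReal_abelType {ℓ : (Fin n → ℝ) →ₗ[ℝ] ℝ} (a : Finset (Fin n)) :
    ℓ (toReal (abelType a)) = ∑ i ∈ a, ℓ (Pi.single i 1) := by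
  rw [← map_sum]
  congr 1
  ext k
  simp [toReal, abelType, Finset.sum_apply, Pi.single_apply]

/-- The shift by `l(a)` moves the half-open interval `[-ℓ(l(a)), 0)` to `[0, ℓ(l(a)))`; the
parameter `t` is the relative position in it. -/
theorem mem_nearFaces_iff (hσ : IsPrimitiveUnitPisot σ β) {u : expSpace σ β}
    {ℓ : (Fin n → ℝ) →ₗ[ℝ] ℝ} (hu : u ≠ 0) (hproj : ∀ x, projE σ β x = ℓ x • u)
    (hℓ : ∀ i, 0 < ℓ (Pi.single i 1)) (F : Face n) :
    F ∈ nearFaces σ β ↔ F.2.card = deg β - 1 ∧ 0 ≤ ℓ (toReal F.1) ∧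
      ℓ (toReal F.1) < ℓ (toReal (abelType F.2ᶜ)) := by
  have h1 := deg_pos hσ
  have h2 := deg_le hσ
  have hcond : ∀ (x : Fin n → ℤ) (a : Finset (Fin n)) (t : ℝ),
      projE σ β (toReal x) = (1 - t) • (-projE σ β (toReal (abelType a))) + t • 0 ↔
        ℓ (toReal x) = -((1 - t) * ℓ (toReal (abelType a))) := by
    intro x a t
    rw [hproj, hproj, smul_zero, add_zero, smul_neg, smul_smul, ← neg_smul]
    exact ⟨fun h => smul_left_injective ℝ hu h, fun h => by rw [h]⟩
  constructor
  · rintro ⟨⟨x, a⟩, ⟨hc, t, ht, h⟩, rfl⟩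
    rw [hcond] at h
    simp only [transverse, compl_compl, toReal_add, map_add] at hc h ⊢
    have hpos : 0 < ℓ (toReal (abelType a)) := by
      rw [apply_toReal_abelType]
      exact Finset.sum_pos (fun i _ => hℓ i) (Finset.card_pos.1 (by omega))
    refine ⟨?_, ?_, ?_⟩
    · rw [Finset.card_compl, Fintype.card_fin, hc]; omega
    · rw [h]; nlinarith [ht.1]
    · rw [h]; nlinarith [ht.2]
  · rintro ⟨hc, h3, h4⟩
    have hpos : 0 < ℓ (toReal (abelType F.2ᶜ)) := h3.trans_lt h4
    refine ⟨(F.1 - abelType F.2ᶜ, F.2ᶜ), ⟨?_, ℓ (toReal F.1) / ℓ (toReal (abelType F.2ᶜ)),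
      ⟨by positivity, (div_lt_one hpos).2 h4⟩, ?_⟩, ?_⟩
    · rw [Finset.card_compl, Fintype.card_fin, hc]; omega
    · rw [hcond, toReal_sub, map_sub, sub_mul, div_mul_cancel₀ _ hpos.ne', one_mul, neg_sub]
    · simp [transverse]

theorem abel_nonneg (w : List (Fin n)) : 0 ≤ abel w := fun b => by simp [abel]

theorem card_of_mem_nearFaces (hσ : IsPrimitiveUnitPisot σ β) (hnice : IsNice σ β) {F : Face n}
    (hF : F ∈ nearFaces σ β) : F.2.card = deg β - 1 := by
  obtain ⟨u, ℓ, hu, hproj, hℓ, -⟩ := exists_expanding_coordinate hσ hnice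
  exact ((mem_nearFaces_iff hσ hu hproj hℓ F).1 hF).1

theorem zero_mem_nearFaces (hσ : IsPrimitiveUnitPisot σ β) (hnice : IsNice σ β)
    {a : Finset (Fin n)} (ha : a.card = deg β - 1) : ((0, a) : Face n) ∈ nearFaces σ β := by
  obtain ⟨u, ℓ, hu, hproj, hℓ, -⟩ := exists_expanding_coordinate hσ hnice
  have h1 := deg_pos hσ
  have h2 := deg_le hσ
  rw [mem_nearFaces_iff hσ hu hproj hℓ]
  refine ⟨ha, by simp, ?_⟩
  rw [toReal_zero, map_zero, apply_toReal_abelType]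
  refine Finset.sum_pos (fun i _ => hℓ i) (Finset.card_pos.1 ?_)
  rw [Finset.card_compl, Fintype.card_fin]
  dsimp only
  omega

/-- After multiplication by `β`, the lower bound follows from the suffix being non-negative and the
upper bound from the prefix being non-negative. -/
theorem Child.mem_nearFaces (hσ : IsPrimitiveUnitPisot σ β) (hnice : IsNice σ β) {F H : Face n}
    (h : Child σ F H) (hF : F ∈ nearFaces σ β) : H ∈ nearFaces σ β := by
  obtain ⟨u, ℓ, hu, hproj, hℓ, hT⟩ := exists_expanding_coordinate hσ hnice
  have hβ : 0 < β := one_pos.trans hσ.pisot.2.1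
  rw [mem_nearFaces_iff hσ hu hproj hℓ] at hF ⊢
  obtain ⟨hc, h0, h1⟩ := hF
  refine ⟨h.card_eq.trans hc, ?_⟩
  obtain ⟨τ, j, hd, hH⟩ := h
  have hs : 0 ≤ ℓ (toReal (suffixVec σ j)) :=
    apply_toReal_nonneg hℓ (Finset.sum_nonneg fun i _ => abel_nonneg _)
  have hp : 0 ≤ ℓ (toReal (prefixVec σ j)) :=
    apply_toReal_nonneg hℓ (Finset.sum_nonneg fun i _ => abel_nonneg _)
  have e1 := hT (toReal H.1)
  rw [actR_toReal, hH, toReal_add, map_add] at e1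
  have e2 := hT (toReal (abelType H.2ᶜ))
  rw [actR_toReal, incidence_mulVec_abelType hd, toReal_add, toReal_add, map_add, map_add] at e2
  constructor
  · refine nonneg_of_mul_nonneg_right (a := β) ?_ hβ
    linarith
  · refine lt_of_mul_lt_mul_left (a := β) ?_ hβ.le
    linarith

theorem Desc.mem_nearFaces (hσ : IsPrimitiveUnitPisot σ β) (hnice : IsNice σ β) {k : ℕ}
    {F H : Face n} (h : Desc σ k F H) (hF : F ∈ nearFaces σ β) : H ∈ nearFaces σ β := by
  induction k generalizing H with
  | zero => rwa [← show F = H from h]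
  | succ k ih =>
    obtain ⟨G, h1, h2⟩ := h
    exact h2.mem_nearFaces hσ hnice (ih h1)

/-! ### Iteration of the geometric dual map on well-projecting chains -/

/-- A chain that projects well and consists of faces near to the contracting space. -/
def Admissible (σ : Substitution n) (β : ℝ) (P : Chain n) : Prop :=
  ProjectsWell σ β P ∧ ∀ F ∈ P.support, F ∈ nearFaces σ β

theorem mem_support_single_add_single {F G X : Face n} :
    X ∈ (Finsupp.single F (1 : ℤ) + Finsupp.single G 1).support ↔ X = F ∨ X = G := by
  rw [Finsupp.mem_support_iff, Finsupp.add_apply, Finsupp.single_apply, Finsupp.single_apply]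
  by_cases h1 : F = X <;> by_cases h2 : G = X <;> simp [h1, h2, eq_comm]

/-- Well-projection only involves pairs of faces, which lets the two-face hypothesis control chains
with arbitrarily many faces. -/
theorem projectsWell_pair {P : Chain n} (hP : ProjectsWell σ β P) {F G : Face n}
    (hF : F ∈ P.support) (hG : G ∈ P.support) (hFG : F ≠ G) :
    ProjectsWell σ β (Finsupp.single F 1 + Finsupp.single G 1) := by
  refine ⟨fun X hX => Or.inl ?_, fun X hX Y hY hXY => ?_⟩
  · rw [Finsupp.add_apply]
    rcases mem_support_single_add_single.1 hX with rfl | rfl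
    · rw [Finsupp.single_eq_same, Finsupp.single_eq_of_ne hFG, add_zero]
    · rw [Finsupp.single_eq_same, Finsupp.single_eq_of_ne hFG.symm, zero_add]
  · refine hP.2 X ?_ Y ?_ hXY
    · rcases mem_support_single_add_single.1 hX with rfl | rfl <;> assumption
    · rcases mem_support_single_add_single.1 hY with rfl | rfl <;> assumption

theorem admissible_single {F : Face n} (hF : F ∈ nearFaces σ β) :
    Admissible σ β (Finsupp.single F 1) := by
  have h : ∀ X ∈ (Finsupp.single F (1 : ℤ)).support, X = F := fun X hX =>
    Finset.mem_singleton.1 (Finsupp.support_single_subset hX)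
  refine ⟨⟨fun X hX => Or.inl ?_, fun X hX Y hY hXY => ?_⟩, fun X hX => ?_⟩
  · rw [h X hX, Finsupp.single_eq_same]
  · exact absurd ((h X hX).trans (h Y hY).symm) hXY
  · rw [h X hX]; exact hF

namespace Admissible

variable {P : Chain n}

theorem disjoint_children (hσ : IsPrimitiveUnitPisot σ β) (hnice : IsNice σ β)
    (hP : Admissible σ β P) {F G H : Face n} (hF : F ∈ P.support) (hG : G ∈ P.support)
    (h1 : Child σ F H) (h2 : Child σ G H) : F = G := by
  by_contra hFG
  have hd := (hnice.two_faces F (hP.2 F hF) G (hP.2 G hG) hFG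
    (projectsWell_pair hP.1 hF hG hFG)).1
  exact Finset.disjoint_left.1 hd
    ((mem_support_geomDual_single_iff hσ hnice (card_of_mem_nearFaces hσ hnice (hP.2 F hF))).2 h1)
    ((mem_support_geomDual_single_iff hσ hnice (card_of_mem_nearFaces hσ hnice (hP.2 G hG))).2 h2)

/-- Only one face of `P` has `H` as a child, so a single term contributes to this coefficient. -/
theorem geomDual_apply_of_child (hσ : IsPrimitiveUnitPisot σ β) (hnice : IsNice σ β)
    (hP : Admissible σ β P) {F H : Face n} (hF : F ∈ P.support) (h : Child σ F H) :
    geomDual σ P H = P F * geomDualFace σ F H := by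
  have h1 : geomDual σ P = ∑ G ∈ P.support, P G • geomDualFace σ G := by
    conv_lhs => rw [← Finsupp.sum_single P, Finsupp.sum, map_sum]
    refine Finset.sum_congr rfl fun G _ => ?_
    rw [geomDualFace, ← map_smul, Finsupp.smul_single, smul_eq_mul, mul_one]
  rw [h1, Finsupp.finsetSum_apply, Finset.sum_eq_single F]
  · rw [Finsupp.smul_apply, smul_eq_mul]
  · intro G hG hGF
    rw [Finsupp.smul_apply, smul_eq_mul]
    refine mul_eq_zero_of_right _ (Finsupp.notMem_support_iff.1 fun hH => hGF ?_)
    exact hP.disjoint_children hσ hnice hG hF (child_of_mem_support hσ hnice hH) h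
  · exact fun h => absurd hF h

theorem mem_support_geomDual_iff (hσ : IsPrimitiveUnitPisot σ β) (hnice : IsNice σ β)
    (hP : Admissible σ β P) {H : Face n} :
    H ∈ (geomDual σ P).support ↔ ∃ F ∈ P.support, Child σ F H := by
  constructor
  · intro h
    have h1 : geomDual σ P = ∑ G ∈ P.support, P G • geomDualFace σ G := by
      conv_lhs => rw [← Finsupp.sum_single P, Finsupp.sum, map_sum]
      refine Finset.sum_congr rfl fun G _ => ?_
      rw [geomDualFace, ← map_smul, Finsupp.smul_single, smul_eq_mul, mul_one]
    classical
    rw [h1] at h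
    obtain ⟨F, hF, h⟩ := Finset.mem_biUnion.1 (Finsupp.support_finsetSum h)
    exact ⟨F, hF, child_of_mem_support hσ hnice (Finsupp.support_smul h)⟩
  · rintro ⟨F, hF, h⟩
    rw [Finsupp.mem_support_iff, hP.geomDual_apply_of_child hσ hnice hF h]
    exact mul_ne_zero (Finsupp.mem_support_iff.1 hF) (Finsupp.mem_support_iff.1
      ((mem_support_geomDual_single_iff hσ hnice
        (card_of_mem_nearFaces hσ hnice (hP.2 F hF))).2 h))

/-- Two faces of the image have either the same parent or two distinct ones, which is settled by the
one-face and the two-face conditions respectively. Coefficients remain `±1` because parents are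
unique. -/
theorem geomDual (hσ : IsPrimitiveUnitPisot σ β) (hnice : IsNice σ β)
    (hP : Admissible σ β P) : Admissible σ β (geomDual σ P) := by
  have hmem : ∀ {F H : Face n}, F ∈ P.support → Child σ F H →
      H ∈ (geomDualFace σ F).support := fun {F H} hF h =>
    (mem_support_geomDual_single_iff hσ hnice (card_of_mem_nearFaces hσ hnice (hP.2 F hF))).2 h
  refine ⟨⟨fun H hH => ?_, fun H hH K hK hHK => ?_⟩, fun H hH => ?_⟩
  · obtain ⟨F, hF, h⟩ := (hP.mem_support_geomDual_iff hσ hnice).1 hH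
    rw [hP.geomDual_apply_of_child hσ hnice hF h]
    rcases hP.1.1 F hF with h1 | h1 <;>
      rcases (hnice.single_face F (hP.2 F hF)).1 H (hmem hF h) with h2 | h2 <;>
      simp [h1, h2]
  · obtain ⟨F, hF, h⟩ := (hP.mem_support_geomDual_iff hσ hnice).1 hH
    obtain ⟨G, hG, h'⟩ := (hP.mem_support_geomDual_iff hσ hnice).1 hK
    by_cases hFG : F = G
    · subst hFG
      exact (hnice.single_face F (hP.2 F hF)).2 H (hmem hF h) K (hmem hF h') hHK
    · have hpair := projectsWell_pair hP.1 hF hG hFG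
      have hadm : Admissible σ β (Finsupp.single F 1 + Finsupp.single G 1) :=
        ⟨hpair, fun X hX => by
          rcases mem_support_single_add_single.1 hX with rfl | rfl
          exacts [hP.2 _ hF, hP.2 _ hG]⟩
      refine (hnice.two_faces F (hP.2 F hF) G (hP.2 G hG) hFG hpair).2.2 H ?_ K ?_ hHK
      · exact (hadm.mem_support_geomDual_iff hσ hnice).2
          ⟨F, mem_support_single_add_single.2 (Or.inl rfl), h⟩
      · exact (hadm.mem_support_geomDual_iff hσ hnice).2
          ⟨G, mem_support_single_add_single.2 (Or.inr rfl), h'⟩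
  · obtain ⟨F, hF, h⟩ := (hP.mem_support_geomDual_iff hσ hnice).1 hH
    exact h.mem_nearFaces hσ hnice (hP.2 F hF)

theorem geomDual_pow (hσ : IsPrimitiveUnitPisot σ β) (hnice : IsNice σ β)
    (hP : Admissible σ β P) (k : ℕ) : Admissible σ β ((RauzyTiling.geomDual σ ^ k) P) := by
  induction k with
  | zero => simpa
  | succ k ih => rw [pow_succ', Module.End.mul_apply]; exact ih.geomDual hσ hnice

theorem mem_support_pow_iff (hσ : IsPrimitiveUnitPisot σ β) (hnice : IsNice σ β)
    (hP : Admissible σ β P) {k : ℕ} {H : Face n} :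
    H ∈ ((RauzyTiling.geomDual σ ^ k) P).support ↔ ∃ F ∈ P.support, Desc σ k F H := by
  induction k generalizing H with
  | zero => simp [Desc]
  | succ k ih =>
    rw [pow_succ', Module.End.mul_apply,
      (hP.geomDual_pow hσ hnice k).mem_support_geomDual_iff hσ hnice]
    constructor
    · rintro ⟨G, hG, h⟩
      obtain ⟨F, hF, h'⟩ := ih.1 hG
      exact ⟨F, hF, G, h', h⟩
    · rintro ⟨F, hF, G, h', h⟩
      exact ⟨G, ih.2 ⟨F, hF, h'⟩, h⟩

/-- Each generation is again admissible, so parents are unique at every step and the genealogy can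
be traced back. -/
theorem disjoint_desc (hσ : IsPrimitiveUnitPisot σ β) (hnice : IsNice σ β)
    (hP : Admissible σ β P) {k : ℕ} {F G H : Face n} (hF : F ∈ P.support) (hG : G ∈ P.support)
    (h1 : Desc σ k F H) (h2 : Desc σ k G H) : F = G := by
  induction k generalizing H with
  | zero => exact h1.trans h2.symm
  | succ k ih =>
    obtain ⟨F', h1, h3⟩ := h1
    obtain ⟨G', h2, h4⟩ := h2
    have h5 : F' = G' := (hP.geomDual_pow hσ hnice k).disjoint_children hσ hnice
      ((hP.mem_support_pow_iff hσ hnice).2 ⟨F, hF, h1⟩)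
      ((hP.mem_support_pow_iff hσ hnice).2 ⟨G, hG, h2⟩) h3 h4
    subst h5
    exact ih h1 h2

end Admissible

/-- The set of faces of the `k`-th iterate of the geometric dual map on a face. -/
noncomputable def patch (σ : Substitution n) (k : ℕ) (F : Face n) : Finset (Face n) :=
  ((geomDual σ ^ k) (Finsupp.single F 1)).support

theorem mem_patch_iff (hσ : IsPrimitiveUnitPisot σ β) (hnice : IsNice σ β) {F H : Face n}
    (hF : F ∈ nearFaces σ β) {k : ℕ} : H ∈ patch σ k F ↔ Desc σ k F H := by
  rw [patch, (admissible_single hF).mem_support_pow_iff hσ hnice]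
  constructor
  · rintro ⟨G, hG, h⟩
    rwa [Finset.mem_singleton.1 (Finsupp.support_single_subset hG)] at h
  · intro h
    exact ⟨F, by simp, h⟩

/-! ### The reachability of all types -/

/-- A non-zero minor has a non-zero Leibniz term, whose permutation matches each letter `i` of `b`
with a letter of `a` occurring in `σ(i)`. -/
theorem exists_isDecomp_of_dualMatrix_ne_zero {k : ℕ} {b a : {a : Finset (Fin n) // a.card = k}}
    (h : dualMatrix σ k b a ≠ 0) :
    ∃ (τ : b.1 ≃ a.1) (j : Positions σ b.1), IsDecomp σ τ j := by
  rw [dualMatrix, Matrix.of_apply, Matrix.det_apply] at h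
  obtain ⟨π, -, hπ⟩ := Finset.exists_ne_zero_of_sum_ne_zero h
  have h1 : ∀ i, incidence σ (a.1.orderEmbOfFin a.2 i) (b.1.orderEmbOfFin b.2 (π i)) ≠ 0 := by
    intro i
    have h2 : ∏ i, ((incidence σ).transpose.submatrix (b.1.orderEmbOfFin b.2)
        (a.1.orderEmbOfFin a.2)) (π i) i ≠ 0 := fun h0 => hπ (by rw [h0, smul_zero])
    exact Finset.prod_ne_zero_iff.1 h2 i (Finset.mem_univ i)
  let τ : b.1 ≃ a.1 := (b.1.orderIsoOfFin b.2).symm.toEquiv.trans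
    (π.symm.trans (a.1.orderIsoOfFin a.2).toEquiv)
  have h3 : ∀ i : b.1, (τ i : Fin n) ∈ σ.word i := by
    intro i
    have h4 := h1 (π.symm ((b.1.orderIsoOfFin b.2).symm i))
    rw [Equiv.apply_symm_apply] at h4
    have h5 : b.1.orderEmbOfFin b.2 ((b.1.orderIsoOfFin b.2).symm i) = i := by
      rw [← Finset.coe_orderIsoOfFin_apply, OrderIso.apply_symm_apply]
    rw [h5] at h4
    have h6 : (τ i : Fin n) =
        a.1.orderEmbOfFin a.2 (π.symm ((b.1.orderIsoOfFin b.2).symm i)) := rfl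
    rw [h6]
    by_contra h7
    exact h4 (by simp [incidence, abel, List.count_eq_zero_of_not_mem h7])
  choose j hj using fun i => List.mem_iff_get.1 (h3 i)
  exact ⟨τ, j, hj⟩

theorem exists_child_of_isDecomp (hσ : IsPrimitiveUnitPisot σ β) (hnice : IsNice σ β)
    {b a : Finset (Fin n)} {τ : b ≃ a} {j : Positions σ b} (h : IsDecomp σ τ j)
    (x : Fin n → ℤ) : ∃ y, Child σ (x, aᶜ) (y, bᶜ) := by
  have key : ∀ b' a' : Finset (Fin n), b' = b → a' = a → ∃ (τ : b' ≃ a') (j : Positions σ b'),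
      IsDecomp σ τ j := by
    rintro b' a' rfl rfl
    exact ⟨τ, j, h⟩
  obtain ⟨τ', j', h'⟩ := key bᶜᶜ aᶜᶜ (compl_compl b) (compl_compl a)
  exact ⟨(incidence σ)⁻¹.mulVec (x + suffixVec σ j'), τ', j', h', mulVec_inv_incidence hσ hnice _⟩

theorem card_compl_of_card (hσ : IsPrimitiveUnitPisot σ β) {a : Finset (Fin n)}
    (ha : a.card = deg β - 1) : (aᶜ).card = n + 1 - deg β := by
  have h1 := deg_pos hσ
  have h2 := deg_le hσ
  rw [Finset.card_compl, Fintype.card_fin, ha]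
  omega

/-- Every type occurs among the descendants of a fixed generation of any face. -/
theorem exists_desc_of_type (hσ : IsPrimitiveUnitPisot σ β) (hnice : IsNice σ β) :
    ∃ p, 1 ≤ p ∧ ∀ F : Face n, F.2.card = deg β - 1 → ∀ c : Finset (Fin n),
      c.card = deg β - 1 → ∃ y, Desc σ p F (y, c) := by
  obtain ⟨ε, -, hprim⟩ := hnice.positivity
  set Q := Matrix.of fun b a => (ε b : ℤ) * dualMatrix σ (n + 1 - deg β) b a * (ε a : ℤ) with hQ
  -- A non-zero entry of `Q ^ k` yields a chain of non-zero minors, hence a line of descent; the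
  -- signs play no role in this step.
  have hstep : ∀ (k : ℕ) (b a : {a : Finset (Fin n) // a.card = n + 1 - deg β}),
      (Q ^ k) b a ≠ 0 → ∀ x, ∃ y, Desc σ k (x, a.1ᶜ) (y, b.1ᶜ) := by
    intro k
    induction k with
    | zero =>
      intro b a h x
      rw [pow_zero] at h
      obtain rfl : b = a := by
        by_contra hne
        exact h (Matrix.one_apply_ne hne)
      exact ⟨x, rfl⟩
    | succ k ih =>
      intro b a h x
      rw [pow_succ', Matrix.mul_apply] at h
      obtain ⟨c, -, hc⟩ := Finset.exists_ne_zero_of_sum_ne_zero h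
      obtain ⟨y, hy⟩ := ih c a (right_ne_zero_of_mul hc) x
      have h1 : dualMatrix σ (n + 1 - deg β) b c ≠ 0 :=
        right_ne_zero_of_mul (left_ne_zero_of_mul (left_ne_zero_of_mul hc))
      obtain ⟨τ, j, hd⟩ := exists_isDecomp_of_dualMatrix_ne_zero h1
      obtain ⟨z, hz⟩ := exists_child_of_isDecomp hσ hnice hd y
      exact ⟨z, _, hy, hz⟩
  obtain ⟨p, hp, hpos⟩ := hprim.exists_pos_pow
  refine ⟨p, hp, fun F hF c hc => ?_⟩
  obtain ⟨y, hy⟩ := hstep p ⟨cᶜ, card_compl_of_card hσ hc⟩ ⟨F.2ᶜ, card_compl_of_card hσ hF⟩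
    (hpos _ _).ne' F.1
  refine ⟨y, ?_⟩
  simpa only [compl_compl] using hy

theorem exists_child (hσ : IsPrimitiveUnitPisot σ β) (hnice : IsNice σ β) {F : Face n}
    (hF : F.2.card = deg β - 1) : ∃ H, Child σ F H := by
  obtain ⟨p, hp, h⟩ := exists_desc_of_type hσ hnice
  obtain ⟨y, hy⟩ := h F hF F.2 hF
  obtain ⟨k, rfl⟩ := Nat.exists_eq_add_of_le hp
  obtain ⟨G, hG, -⟩ := desc_add.1 hy
  exact ⟨G, desc_one.1 hG⟩

theorem exists_desc (hσ : IsPrimitiveUnitPisot σ β) (hnice : IsNice σ β) {F : Face n}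
    (hF : F.2.card = deg β - 1) (k : ℕ) : ∃ H, Desc σ k F H := by
  induction k with
  | zero => exact ⟨F, rfl⟩
  | succ k ih =>
    obtain ⟨G, hG⟩ := ih
    obtain ⟨H, hH⟩ := exists_child hσ hnice (hG.card_eq.trans hF)
    exact ⟨H, G, hG, hH⟩

/-- Every type occurs among the descendants of some generation divisible by `m`. -/
theorem exists_desc_of_type_mul (hσ : IsPrimitiveUnitPisot σ β) (hnice : IsNice σ β) {m : ℕ}
    (hm : 1 ≤ m) : ∃ p, ∀ F : Face n, F.2.card = deg β - 1 → ∀ c : Finset (Fin n),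
      c.card = deg β - 1 → ∃ y, Desc σ (m * p) F (y, c) := by
  obtain ⟨p, -, h⟩ := exists_desc_of_type hσ hnice
  refine ⟨p, fun F hF c hc => ?_⟩
  -- With `m = l + 1`, the first `l * p` generations are arbitrary and the last `p` reach the
  -- prescribed type.
  obtain ⟨l, rfl⟩ := Nat.exists_eq_add_of_le' hm
  obtain ⟨G, hG⟩ := exists_desc hσ hnice hF (l * p)
  obtain ⟨y, hy⟩ := h G (hG.card_eq.trans hF) c hc
  exact ⟨y, by rw [Nat.succ_mul]; exact desc_add.2 ⟨G, hG, hy⟩⟩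

/-! ### The transfer operator -/

/-- The operator that sums a function of the type over the faces of the image of `(0, a)`. -/
noncomputable def transfer (σ : Substitution n) (φ : Finset (Fin n) → ℝ) :
    Finset (Fin n) → ℝ := fun a => ∑ H ∈ patch σ 1 (0, a), φ H.2

theorem exists_pow_mulVec_eq (hσ : IsPrimitiveUnitPisot σ β) (hnice : IsNice σ β) (k : ℕ)
    (x : Fin n → ℤ) : ∃ z, (incidence σ ^ k).mulVec z = x := by
  induction k generalizing x with
  | zero => exact ⟨x, by simp⟩
  | succ k ih =>
    obtain ⟨z, hz⟩ := ih x
    exact ⟨(incidence σ)⁻¹.mulVec z, by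
      rw [pow_succ, ← Matrix.mulVec_mulVec, mulVec_inv_incidence hσ hnice, hz]⟩

theorem sum_patch_one (hσ : IsPrimitiveUnitPisot σ β) (hnice : IsNice σ β) {F : Face n}
    (hF : F ∈ nearFaces σ β) (φ : Finset (Fin n) → ℝ) :
    ∑ H ∈ patch σ 1 F, φ H.2 = transfer σ φ F.2 := by
  have h0 := zero_mem_nearFaces hσ hnice (card_of_mem_nearFaces hσ hnice hF)
  obtain ⟨z, hz⟩ := exists_pow_mulVec_eq hσ hnice 1 F.1
  refine Finset.sum_nbij' (fun H => (H.1 - z, H.2)) (fun H => (H.1 + z, H.2)) ?_ ?_ ?_ ?_ ?_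
  · intro H hH
    rw [mem_patch_iff hσ hnice h0]
    have := ((mem_patch_iff hσ hnice hF).1 hH).translate (-z)
    rwa [Matrix.mulVec_neg, hz, add_neg_cancel, ← sub_eq_add_neg] at this
  · intro H hH
    rw [mem_patch_iff hσ hnice hF]
    have := ((mem_patch_iff hσ hnice h0).1 hH).translate z
    rwa [hz, zero_add] at this
  · intro H _; simp
  · intro H _; simp
  · intro H _; rfl

/-- The patches of distinct faces of generation `k` are disjoint by uniqueness of ancestors, so the
sum regroups without multiplicity. -/
theorem sum_patch_add (hσ : IsPrimitiveUnitPisot σ β) (hnice : IsNice σ β) {F : Face n}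
    (hF : F ∈ nearFaces σ β) (φ : Face n → ℝ) (k l : ℕ) :
    ∑ H ∈ patch σ (k + l) F, φ H = ∑ G ∈ patch σ k F, ∑ H ∈ patch σ l G, φ H := by
  classical
  have hnear : ∀ G ∈ patch σ k F, G ∈ nearFaces σ β := fun G hG =>
    ((mem_patch_iff hσ hnice hF).1 hG).mem_nearFaces hσ hnice hF
  have h1 : patch σ (k + l) F = (patch σ k F).biUnion fun G => patch σ l G := by
    ext H
    rw [mem_patch_iff hσ hnice hF, Finset.mem_biUnion, desc_add]
    constructor
    · rintro ⟨G, hG, h⟩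
      have hG := (mem_patch_iff hσ hnice hF).2 hG
      exact ⟨G, hG, (mem_patch_iff hσ hnice (hnear G hG)).2 h⟩
    · rintro ⟨G, hG, h⟩
      exact ⟨G, (mem_patch_iff hσ hnice hF).1 hG, (mem_patch_iff hσ hnice (hnear G hG)).1 h⟩
  rw [h1, Finset.sum_biUnion]
  intro G hG G' hG' hne
  refine Finset.disjoint_left.2 fun H hH hH' => hne ?_
  exact ((admissible_single hF).geomDual_pow hσ hnice k).disjoint_desc hσ hnice hG hG'
    ((mem_patch_iff hσ hnice (hnear G hG)).1 hH) ((mem_patch_iff hσ hnice (hnear G' hG')).1 hH')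

/-- If all types occur among the descendants of generation `p`, then the number of descendants of
generation `j` is controlled by the faces of any given type of generation `j + p`. -/
theorem card_patch_mul_le (hσ : IsPrimitiveUnitPisot σ β) (hnice : IsNice σ β) {p : ℕ}
    {c : Finset (Fin n)} (hp : ∀ F : Face n, F.2.card = deg β - 1 → ∃ y, Desc σ p F (y, c))
    {φ : Finset (Fin n) → ℝ} (hφ : ∀ a, a.card = deg β - 1 → 0 ≤ φ a) {F : Face n}
    (hF : F ∈ nearFaces σ β) (j : ℕ) :
    (patch σ j F).card * φ c ≤ ∑ H ∈ patch σ (j + p) F, φ H.2 := by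
  rw [sum_patch_add hσ hnice hF (fun H => φ H.2), ← nsmul_eq_mul]
  -- Every face of generation `j` has a descendant of type `c` after `p` steps and thus contributes
  -- at least `φ c`.
  refine Finset.card_nsmul_le_sum _ _ _ fun G hG => ?_
  have hG := ((mem_patch_iff hσ hnice hF).1 hG).mem_nearFaces hσ hnice hF
  have hGc := card_of_mem_nearFaces hσ hnice hG
  obtain ⟨y, hy⟩ := hp G hGc
  exact Finset.single_le_sum (f := fun H : Face n => φ H.2)
    (fun H hH => hφ H.2 (((mem_patch_iff hσ hnice hG).1 hH).card_eq.trans hGc))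
    ((mem_patch_iff hσ hnice hG).2 hy)

/-! ### Projections of faces -/

/-- The projection to the contracting space of an integer point. -/
noncomputable def basePoint (σ : Substitution n) (β : ℝ) (x : Fin n → ℤ) : contrSpace σ β :=
  projC σ β (toReal x)

theorem basePoint_add (x y : Fin n → ℤ) :
    basePoint σ β (x + y) = basePoint σ β x + basePoint σ β y := by
  rw [basePoint, toReal_add, map_add, basePoint, basePoint]

theorem basePoint_sub (x y : Fin n → ℤ) :
    basePoint σ β (x - y) = basePoint σ β x - basePoint σ β y := by
  rw [basePoint, toReal_sub, map_sub, basePoint, basePoint]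

@[simp] theorem basePoint_zero : basePoint σ β 0 = 0 := by
  rw [basePoint, toReal_zero, map_zero]

theorem actC_pow_basePoint (hσ : IsPrimitiveUnitPisot σ β) (hnice : IsNice σ β) (k : ℕ)
    (x : Fin n → ℤ) :
    (actC σ β ^ k) (basePoint σ β x) = basePoint σ β ((incidence σ ^ k).mulVec x) := by
  induction k generalizing x with
  | zero => simp
  | succ k ih =>
    rw [pow_succ, Module.End.mul_apply, basePoint, ← projC_actR hσ hnice, actR_toReal]
    change (actC σ β ^ k) (basePoint σ β _) = _
    rw [ih, Matrix.mulVec_mulVec, ← pow_succ]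

theorem projFace_eq_image (F : Face n) :
    projFace σ β F = (fun z => z + basePoint σ β F.1) '' projFace σ β (0, F.2) := by
  ext z
  constructor
  · rintro ⟨_, ⟨t, ht, rfl⟩, rfl⟩
    refine ⟨_, ⟨_, ⟨t, ht, rfl⟩, rfl⟩, ?_⟩
    simp only [map_add, toReal_zero, zero_add, basePoint]
    exact add_comm _ _
  · rintro ⟨_, ⟨_, ⟨t, ht, rfl⟩, rfl⟩, rfl⟩
    refine ⟨_, ⟨t, ht, rfl⟩, ?_⟩
    simp only [map_add, toReal_zero, zero_add, basePoint]
    exact add_comm _ _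

theorem isCompact_projFace (F : Face n) : IsCompact (projFace σ β F) := by
  have h : faceSupport F = (fun t : Fin n → ℝ =>
      toReal F.1 + ∑ i ∈ F.2, t i • (Pi.single i 1 : Fin n → ℝ)) ''
      Set.pi Set.univ fun _ => Set.Icc (0 : ℝ) 1 := by
    ext y
    constructor
    · rintro ⟨t, ht, rfl⟩
      exact ⟨t, fun i _ => ht i, rfl⟩
    · rintro ⟨t, ht, rfl⟩
      exact ⟨t, fun i => ht i (Set.mem_univ i), rfl⟩
  rw [projFace, h]
  refine ((isCompact_univ_pi fun _ => isCompact_Icc).image ?_).image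
    (projC σ β).continuous_of_finiteDimensional
  fun_prop

theorem basePoint_mem_projFace (F : Face n) : basePoint σ β F.1 ∈ projFace σ β F :=
  ⟨toReal F.1, ⟨0, fun _ => ⟨le_rfl, zero_le_one⟩, by simp⟩, rfl⟩

theorem exists_bound_projFace (σ : Substitution n) (β : ℝ) :
    ∃ C, 0 ≤ C ∧ ∀ F : Face n, ∀ z ∈ projFace σ β F, ‖z - basePoint σ β F.1‖ ≤ C := by
  have h : ∀ a : Finset (Fin n), ∃ C, ∀ z ∈ projFace σ β (0, a), ‖z‖ ≤ C := fun a =>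
    (isCompact_projFace _).isBounded.exists_norm_le
  choose C hC using h
  have hC0 : ∀ a, 0 ≤ C a := fun a =>
    (norm_nonneg _).trans (hC a _ (basePoint_mem_projFace (0, a)))
  refine ⟨∑ a, C a, Finset.sum_nonneg fun a _ => hC0 a, fun F z hz => ?_⟩
  rw [projFace_eq_image] at hz
  obtain ⟨w, hw, rfl⟩ := hz
  rw [add_sub_cancel_right]
  exact (hC F.2 w hw).trans (Finset.single_le_sum (fun a _ => hC0 a) (Finset.mem_univ F.2))

theorem exists_bound_child (hσ : IsPrimitiveUnitPisot σ β) (hnice : IsNice σ β) :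
    ∃ C, 0 ≤ C ∧ ∀ F H : Face n, Child σ F H →
      ‖actC σ β (basePoint σ β H.1) - basePoint σ β F.1‖ ≤ C := by
  -- The displacement is a projected suffix vector, and only finitely many of these occur.
  refine ⟨∑ b : Finset (Fin n), ∑ j : Positions σ b, ‖basePoint σ β (suffixVec σ j)‖,
    by positivity, fun F H h => ?_⟩
  obtain ⟨τ, j, -, hj⟩ := h
  have h1 := actC_pow_basePoint hσ hnice 1 H.1
  rw [pow_one, pow_one, hj, basePoint_add] at h1
  rw [h1, add_sub_cancel_left]
  exact (Finset.single_le_sum (f := fun j : Positions σ H.2ᶜ => ‖basePoint σ β (suffixVec σ j)‖)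
    (fun _ _ => norm_nonneg _) (Finset.mem_univ j)).trans
    (Finset.single_le_sum (f := fun b : Finset (Fin n) =>
      ∑ j : Positions σ b, ‖basePoint σ β (suffixVec σ j)‖)
      (fun _ _ => by positivity) (Finset.mem_univ H.2ᶜ))

theorem exists_bound_desc (hσ : IsPrimitiveUnitPisot σ β) (hnice : IsNice σ β) :
    ∃ C, 0 ≤ C ∧ ∀ (k : ℕ) (F H : Face n), Desc σ k F H →
      ‖(actC σ β ^ k) (basePoint σ β H.1) - basePoint σ β F.1‖ ≤ C := by
  obtain ⟨C₁, hC₁, h1⟩ := exists_bound_child hσ hnice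
  obtain ⟨C, ρ, hC, hρ0, hρ, h2⟩ := exists_norm_actC_pow_le hσ hnice
  have hρ' : 0 < 1 - ρ := by linarith
  -- The factor `1 - ρ ^ k` records the partial geometric sum and makes the induction close.
  have key : ∀ (k : ℕ) (F H : Face n), Desc σ k F H →
      ‖(actC σ β ^ k) (basePoint σ β H.1) - basePoint σ β F.1‖ ≤
        C * C₁ / (1 - ρ) * (1 - ρ ^ k) := by
    intro k
    induction k with
    | zero =>
      intro F H h
      rw [show F = H from h]
      simp
    | succ k ih =>
      rintro F H ⟨G, hG, h⟩
      have h3 : (actC σ β ^ (k + 1)) (basePoint σ β H.1) - basePoint σ β F.1 =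
          (actC σ β ^ k) (actC σ β (basePoint σ β H.1) - basePoint σ β G.1) +
          ((actC σ β ^ k) (basePoint σ β G.1) - basePoint σ β F.1) := by
        rw [pow_succ, Module.End.mul_apply, map_sub]; abel
      have h4 : ‖(actC σ β ^ k) (actC σ β (basePoint σ β H.1) - basePoint σ β G.1)‖ ≤
          C * ρ ^ k * C₁ :=
        (h2 k _).trans (mul_le_mul_of_nonneg_left (h1 G H h) (by positivity))
      rw [h3]
      calc _ ≤ C * ρ ^ k * C₁ + C * C₁ / (1 - ρ) * (1 - ρ ^ k) :=
            (norm_add_le _ _).trans (add_le_add h4 (ih F G hG))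
        _ = _ := by field_simp; ring
  refine ⟨C * C₁ / (1 - ρ), by positivity, fun k F H h => (key k F H h).trans ?_⟩
  exact mul_le_of_le_one_right (by positivity) (by linarith [pow_pos hρ0 k])

/-! ### Renormalized patches -/

theorem mem_renormPatch_iff {F : Face n} {k : ℕ} {z : contrSpace σ β} :
    z ∈ renormPatch σ β F k ↔
      ∃ G ∈ patch σ k F, ∃ y ∈ projFace σ β G, (actC σ β ^ k) y = z := by
  simp only [renormPatch, chainSupport, projFace, patch, Set.mem_image, Set.mem_iUnion]
  constructor
  · rintro ⟨_, ⟨w, ⟨G, hG, hw⟩, rfl⟩, rfl⟩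
    exact ⟨G, hG, _, ⟨w, hw, rfl⟩, rfl⟩
  · rintro ⟨G, hG, _, ⟨w, hw, rfl⟩, rfl⟩
    exact ⟨_, ⟨w, ⟨G, hG, hw⟩, rfl⟩, rfl⟩

theorem exists_bound_renormPatch (hσ : IsPrimitiveUnitPisot σ β) (hnice : IsNice σ β) :
    ∃ C, 0 ≤ C ∧ ∀ F ∈ nearFaces σ β, ∀ k, ∀ z ∈ renormPatch σ β F k,
      ‖z - basePoint σ β F.1‖ ≤ C := by
  obtain ⟨C₁, hC₁, h1⟩ := exists_bound_desc hσ hnice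
  obtain ⟨C₂, hC₂, h2⟩ := exists_bound_projFace σ β
  obtain ⟨C, ρ, hC, hρ0, hρ, h3⟩ := exists_norm_actC_pow_le hσ hnice
  refine ⟨C * C₂ + C₁, by positivity, fun F hF k z hz => ?_⟩
  obtain ⟨G, hG, y, hy, rfl⟩ := mem_renormPatch_iff.1 hz
  have h4 : (actC σ β ^ k) y - basePoint σ β F.1 = (actC σ β ^ k) (y - basePoint σ β G.1) +
      ((actC σ β ^ k) (basePoint σ β G.1) - basePoint σ β F.1) := by
    rw [map_sub]; abel
  rw [h4]
  refine (norm_add_le _ _).trans (add_le_add ((h3 k _).trans ?_)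
    (h1 k F G ((mem_patch_iff hσ hnice hF).1 hG)))
  have h5 : C * ρ ^ k ≤ C := mul_le_of_le_one_right hC (pow_le_one₀ hρ0.le hρ.le)
  exact mul_le_mul h5 (h2 G y hy) (norm_nonneg _) hC

theorem isCompact_renormPatch (F : Face n) (k : ℕ) : IsCompact (renormPatch σ β F k) := by
  have h : renormPatch σ β F k = ⋃ G ∈ patch σ k F, (actC σ β ^ k) '' projFace σ β G := by
    ext z
    simp only [mem_renormPatch_iff, Set.mem_iUnion, Set.mem_image, exists_prop]
  rw [h]
  exact (patch σ k F).isCompact_biUnion fun G _ =>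
    (isCompact_projFace G).image (actC σ β ^ k).continuous_of_finiteDimensional

theorem nonempty_renormPatch (hσ : IsPrimitiveUnitPisot σ β) (hnice : IsNice σ β) {F : Face n}
    (hF : F ∈ nearFaces σ β) (k : ℕ) : (renormPatch σ β F k).Nonempty := by
  obtain ⟨H, hH⟩ := exists_desc hσ hnice (card_of_mem_nearFaces hσ hnice hF) k
  exact ⟨_, mem_renormPatch_iff.2 ⟨H, (mem_patch_iff hσ hnice hF).2 hH, _,
    basePoint_mem_projFace H, rfl⟩⟩

/-- A point of a projected face and the image under `M_σ` of a point of a child's projection are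
boundedly close; applying `M_σ ^ k` contracts the gap. Every face has a child and every later face a
parent, so both halves of the Hausdorff distance are controlled. -/
theorem exists_hausdorffEDist_renormPatch_le (hσ : IsPrimitiveUnitPisot σ β)
    (hnice : IsNice σ β) : ∃ C ρ : ℝ, 0 ≤ C ∧ 0 < ρ ∧ ρ < 1 ∧ ∀ F ∈ nearFaces σ β, ∀ k,
      Metric.hausdorffEDist (renormPatch σ β F k) (renormPatch σ β F (k + 1)) ≤
        ENNReal.ofReal (C * ρ ^ k) := by
  obtain ⟨C₁, hC₁, h1⟩ := exists_bound_child hσ hnice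
  obtain ⟨C₂, hC₂, h2⟩ := exists_bound_projFace σ β
  obtain ⟨C, ρ, hC, hρ0, hρ, h3⟩ := exists_norm_actC_pow_le hσ hnice
  refine ⟨C * (C₂ + C₁ + C * C₂), ρ, by positivity, hρ0, hρ, fun F hF k => ?_⟩
  have key : ∀ G H : Face n, Child σ G H → ∀ y ∈ projFace σ β G, ∀ w ∈ projFace σ β H,
      edist ((actC σ β ^ k) y) ((actC σ β ^ (k + 1)) w) ≤
        ENNReal.ofReal (C * (C₂ + C₁ + C * C₂) * ρ ^ k) := by
    intro G H h y hy w hw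
    rw [edist_dist]
    refine ENNReal.ofReal_le_ofReal ?_
    rw [pow_succ, Module.End.mul_apply, dist_eq_norm, ← map_sub]
    refine (h3 k _).trans ?_
    have h4 : y - actC σ β w = (y - basePoint σ β G.1) -
        (actC σ β (basePoint σ β H.1) - basePoint σ β G.1) -
        actC σ β (w - basePoint σ β H.1) := by
      rw [map_sub]; abel
    have h5 : ‖actC σ β (w - basePoint σ β H.1)‖ ≤ C * C₂ := by
      have := h3 1 (w - basePoint σ β H.1)
      rw [pow_one, pow_one] at this
      exact this.trans (mul_le_mul (mul_le_of_le_one_right hC hρ.le) (h2 H w hw)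
        (norm_nonneg _) hC)
    have h6 : ‖y - actC σ β w‖ ≤ C₂ + C₁ + C * C₂ := by
      rw [h4]
      exact (norm_sub_le _ _).trans (add_le_add ((norm_sub_le _ _).trans
        (add_le_add (h2 G y hy) (h1 G H h))) h5)
    calc C * ρ ^ k * ‖y - actC σ β w‖ ≤ C * ρ ^ k * (C₂ + C₁ + C * C₂) :=
          mul_le_mul_of_nonneg_left h6 (by positivity)
      _ = _ := by ring
  refine Metric.hausdorffEDist_le_of_mem_edist ?_ ?_
  · intro x hx
    obtain ⟨G, hG, y, hy, rfl⟩ := mem_renormPatch_iff.1 hx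
    have hG := (mem_patch_iff hσ hnice hF).1 hG
    obtain ⟨H, hH⟩ := exists_child hσ hnice
      (hG.card_eq.trans (card_of_mem_nearFaces hσ hnice hF))
    exact ⟨_, mem_renormPatch_iff.2 ⟨H, (mem_patch_iff hσ hnice hF).2 ⟨G, hG, hH⟩, _,
      basePoint_mem_projFace H, rfl⟩, key G H hH y hy _ (basePoint_mem_projFace H)⟩
  · intro x hx
    obtain ⟨H, hH, y, hy, rfl⟩ := mem_renormPatch_iff.1 hx
    obtain ⟨G, hG, h⟩ := (mem_patch_iff hσ hnice hF).1 hH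
    refine ⟨_, mem_renormPatch_iff.2 ⟨G, (mem_patch_iff hσ hnice hF).2 hG, _,
      basePoint_mem_projFace G, rfl⟩, ?_⟩
    rw [edist_comm]
    exact key G H h _ (basePoint_mem_projFace G) y hy

/-! ### Rauzy fractals -/

/-- The patches form a Cauchy sequence in the complete space of non-empty compact sets. -/
theorem exists_isHausdorffLimit_renormPatch (hσ : IsPrimitiveUnitPisot σ β)
    (hnice : IsNice σ β) {F : Face n} (hF : F ∈ nearFaces σ β) :
    ∃ L, IsHausdorffLimit (renormPatch σ β F) L := by
  obtain ⟨C, ρ, hC, hρ0, hρ, h⟩ := exists_hausdorffEDist_renormPatch_le hσ hnice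
  let f : ℕ → TopologicalSpace.NonemptyCompacts (contrSpace σ β) := fun k =>
    ⟨⟨renormPatch σ β F k, isCompact_renormPatch F k⟩, nonempty_renormPatch hσ hnice hF k⟩
  have hf : ∀ k, edist (f k) (f (k + 1)) ≤ ENNReal.ofReal C * ENNReal.ofReal ρ ^ k := by
    intro k
    rw [← ENNReal.ofReal_pow hρ0.le, ← ENNReal.ofReal_mul hC]
    exact h F hF k
  have hcauchy : CauchySeq f := cauchySeq_of_edist_le_geometric _ _
    (by rw [← ENNReal.ofReal_one]; exact (ENNReal.ofReal_lt_ofReal_iff one_pos).2 hρ)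
    ENNReal.ofReal_ne_top hf
  obtain ⟨L, hL⟩ := cauchySeq_tendsto_of_complete hcauchy
  exact ⟨L, L.nonempty, L.isCompact, tendsto_iff_edist_tendsto_0.1 hL⟩

theorem isHausdorffLimit_rauzyFractal (hσ : IsPrimitiveUnitPisot σ β) (hnice : IsNice σ β)
    {a : Finset (Fin n)} (ha : a.card = deg β - 1) :
    IsHausdorffLimit (renormPatch σ β (0, a)) (rauzyFractal σ β a) :=
  Classical.epsilon_spec
    (exists_isHausdorffLimit_renormPatch hσ hnice (zero_mem_nearFaces hσ hnice ha))

theorem renormPatch_eq_image (hσ : IsPrimitiveUnitPisot σ β) (hnice : IsNice σ β)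
    {F : Face n} (hF : F ∈ nearFaces σ β) (k : ℕ) :
    renormPatch σ β F k = (fun z => z + basePoint σ β F.1) '' renormPatch σ β (0, F.2) k := by
  have h0 := zero_mem_nearFaces hσ hnice (card_of_mem_nearFaces hσ hnice hF)
  obtain ⟨z, hz⟩ := exists_pow_mulVec_eq hσ hnice k F.1
  have hzb := actC_pow_basePoint hσ hnice k z
  rw [hz] at hzb
  ext w
  constructor
  · intro hw
    obtain ⟨G, hG, y, hy, rfl⟩ := mem_renormPatch_iff.1 hw
    have h1 := ((mem_patch_iff hσ hnice hF).1 hG).translate (-z)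
    rw [Matrix.mulVec_neg, hz, add_neg_cancel, ← sub_eq_add_neg] at h1
    rw [projFace_eq_image] at hy
    obtain ⟨y, hy, rfl⟩ := hy
    refine ⟨_, mem_renormPatch_iff.2 ⟨_, (mem_patch_iff hσ hnice h0).2 h1,
      y + basePoint σ β (G.1 - z), ?_, rfl⟩, ?_⟩
    · rw [projFace_eq_image]; exact ⟨y, hy, rfl⟩
    · simp only [map_add, basePoint_sub, map_sub, hzb]; abel
  · rintro ⟨w, hw, rfl⟩
    obtain ⟨G, hG, y, hy, rfl⟩ := mem_renormPatch_iff.1 hw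
    have h1 := ((mem_patch_iff hσ hnice h0).1 hG).translate z
    rw [hz, zero_add] at h1
    rw [projFace_eq_image] at hy
    obtain ⟨y, hy, rfl⟩ := hy
    refine mem_renormPatch_iff.2 ⟨_, (mem_patch_iff hσ hnice hF).2 h1,
      y + basePoint σ β (G.1 + z), ?_, ?_⟩
    · rw [projFace_eq_image]; exact ⟨y, hy, rfl⟩
    · simp only [map_add, basePoint_add, hzb]; abel

theorem isHausdorffLimit_tile (hσ : IsPrimitiveUnitPisot σ β) (hnice : IsNice σ β)
    {F : Face n} (hF : F ∈ nearFaces σ β) :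
    IsHausdorffLimit (renormPatch σ β F) (tile σ β F) := by
  obtain ⟨h1, h2, h3⟩ := isHausdorffLimit_rauzyFractal hσ hnice
    (card_of_mem_nearFaces hσ hnice hF)
  refine ⟨h1.image _, h2.image (continuous_id.add continuous_const), ?_⟩
  refine h3.congr fun k => ?_
  rw [renormPatch_eq_image hσ hnice hF]
  exact (Metric.hausdorffEDist_image (isometry_add_right (basePoint σ β F.1))).symm

/-! ### Hausdorff limits described by sequences of points -/

section HausdorffLimit

variable {K : Type*} [PseudoEMetricSpace K] {u : ℕ → Set K} {L : Set K}

theorem IsHausdorffLimit.exists_tendsto (h : IsHausdorffLimit u L) {z : K} (hz : z ∈ L) :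
    ∃ w : ℕ → K, (∀ᶠ k in atTop, w k ∈ u k) ∧ Tendsto w atTop (𝓝 z) := by
  have h1 : ∀ k, ∃ w, Metric.hausdorffEDist (u k) L ≠ ⊤ →
      (w ∈ u k ∧ edist z w ≤ Metric.hausdorffEDist (u k) L + ((k : ENNReal) + 1)⁻¹) := by
    intro k
    by_cases hk : Metric.hausdorffEDist (u k) L = ⊤
    -- At infinite distance no approximating point need exist, so `z` serves as a dummy value; this
    -- happens for only finitely many `k`.
    · exact ⟨z, fun h => absurd hk h⟩
    · have : Metric.hausdorffEDist L (u k) <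
          Metric.hausdorffEDist (u k) L + ((k : ENNReal) + 1)⁻¹ := by
        rw [Metric.hausdorffEDist_comm]
        exact ENNReal.lt_add_right hk (by simp)
      obtain ⟨w, hw, hlt⟩ := Metric.exists_edist_lt_of_hausdorffEDist_lt hz this
      exact ⟨w, fun _ => ⟨hw, hlt.le⟩⟩
  choose w hw using h1
  have h2 : ∀ᶠ k in atTop, Metric.hausdorffEDist (u k) L ≠ ⊤ :=
    (h.2.2.eventually (gt_mem_nhds ENNReal.zero_lt_top)).mono fun k hk => hk.ne
  refine ⟨w, h2.mono fun k hk => (hw k hk).1, ?_⟩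
  rw [tendsto_iff_edist_tendsto_0]
  have h3 : Tendsto (fun k : ℕ => Metric.hausdorffEDist (u k) L + ((k : ENNReal) + 1)⁻¹)
      atTop (𝓝 0) := by
    have h4 : Tendsto (fun k : ℕ => ((k : ENNReal) + 1)⁻¹) atTop (𝓝 0) := by
      have := (tendsto_add_atTop_iff_nat 1).2 ENNReal.tendsto_inv_nat_nhds_zero
      simpa using this
    simpa using h.2.2.add h4
  refine tendsto_of_tendsto_of_tendsto_of_le_of_le' tendsto_const_nhds h3
    (Eventually.of_forall fun _ => zero_le) (h2.mono fun k hk => ?_)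
  rw [edist_comm]
  exact (hw k hk).2

/-- Membership is needed only infinitely often, so this applies after a pigeonhole choice among
finitely many patches. -/
theorem IsHausdorffLimit.mem_of_frequently (h : IsHausdorffLimit u L) (hL : IsClosed L)
    {w : ℕ → K} {z : K} (hw : ∃ᶠ k in atTop, w k ∈ u k) (hz : Tendsto w atTop (𝓝 z)) :
    z ∈ L := by
  rw [← hL.closure_eq, Metric.mem_closure_iff_infEDist_zero]
  by_contra hne
  have hpos : 0 < Metric.infEDist z L := pos_iff_ne_zero.2 hne
  have h1 : Tendsto (fun k => edist z (w k) + Metric.hausdorffEDist (u k) L) atTop (𝓝 0) := by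
    have := (tendsto_iff_edist_tendsto_0.1 hz).add h.2.2
    simpa only [edist_comm z, add_zero] using this
  obtain ⟨k, hk, hlt⟩ := (hw.and_eventually (h1.eventually (gt_mem_nhds hpos))).exists
  refine absurd hlt (not_lt.2 ?_)
  calc Metric.infEDist z L ≤ Metric.infEDist (w k) L + edist z (w k) :=
        Metric.infEDist_le_infEDist_add_edist
    _ ≤ Metric.hausdorffEDist (u k) L + edist z (w k) := by
        gcongr; exact Metric.infEDist_le_hausdorffEDist_of_mem hk
    _ = _ := add_comm _ _

end HausdorffLimit

/-! ### Subdivision of inflated tiles -/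

theorem isCompact_tile (hσ : IsPrimitiveUnitPisot σ β) (hnice : IsNice σ β)
    {F : Face n} (hF : F ∈ nearFaces σ β) : IsCompact (tile σ β F) :=
  (isHausdorffLimit_tile hσ hnice hF).2.1

theorem actC_pow_bijective (hσ : IsPrimitiveUnitPisot σ β) (hnice : IsNice σ β) (k : ℕ) :
    Function.Bijective (actC σ β ^ k) := by
  rw [Module.End.coe_pow]
  exact (actC_bijective hσ hnice).iterate k

/-- This is the subdivision rule before passage to the limit. -/
theorem mem_renormPatch_add_iff (hσ : IsPrimitiveUnitPisot σ β) (hnice : IsNice σ β)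
    {F : Face n} (hF : F ∈ nearFaces σ β) {k l : ℕ} {z : contrSpace σ β} :
    (actC σ β ^ k) z ∈ renormPatch σ β F (k + l) ↔
      ∃ G ∈ patch σ k F, z ∈ renormPatch σ β G l := by
  simp only [mem_renormPatch_iff, mem_patch_iff hσ hnice hF]
  constructor
  · rintro ⟨H, hH, y, hy, h⟩
    obtain ⟨G, h1, h2⟩ := desc_add.1 hH
    refine ⟨G, h1, H, (mem_patch_iff hσ hnice (h1.mem_nearFaces hσ hnice hF)).2 h2, y, hy, ?_⟩
    rw [pow_add, Module.End.mul_apply] at h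
    exact (actC_pow_bijective hσ hnice k).1 h
  · rintro ⟨G, h1, H, h2, y, hy, rfl⟩
    rw [mem_patch_iff hσ hnice (h1.mem_nearFaces hσ hnice hF)] at h2
    exact ⟨H, desc_add.2 ⟨G, h1, h2⟩, y, hy, by rw [pow_add, Module.End.mul_apply]⟩

theorem exists_continuousLinearEquiv_actC_pow (hσ : IsPrimitiveUnitPisot σ β) (hnice : IsNice σ β) (k : ℕ) :
    ∃ e : contrSpace σ β ≃L[ℝ] contrSpace σ β, ∀ z, e z = (actC σ β ^ k) z :=
  ⟨(LinearEquiv.ofBijective _ (actC_pow_bijective hσ hnice k)).toContinuousLinearEquiv,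
    fun _ => rfl⟩

/-- The subdivision of the inflated tiles. -/
theorem preimage_tile (hσ : IsPrimitiveUnitPisot σ β) (hnice : IsNice σ β)
    {F : Face n} (hF : F ∈ nearFaces σ β) (k : ℕ) :
    (actC σ β ^ k) ⁻¹' tile σ β F = ⋃ G ∈ patch σ k F, tile σ β G := by
  obtain ⟨e, he⟩ := exists_continuousLinearEquiv_actC_pow hσ hnice k
  have hnear : ∀ G ∈ patch σ k F, G ∈ nearFaces σ β := fun G hG =>
    ((mem_patch_iff hσ hnice hF).1 hG).mem_nearFaces hσ hnice hF
  have hlim := isHausdorffLimit_tile hσ hnice hF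
  ext z
  simp only [Set.mem_preimage, Set.mem_iUnion, exists_prop]
  constructor
  · intro hz
    obtain ⟨w, hw, hwz⟩ := hlim.exists_tendsto hz
    have h1 : Tendsto (fun l => e.symm (w (k + l))) atTop (𝓝 z) := by
      have h2 := (e.symm.continuous.tendsto _).comp
        (hwz.comp (tendsto_add_atTop_nat k))
      rw [← he, e.symm_apply_apply] at h2
      simpa only [Function.comp_def, add_comm _ k] using h2
    have h2 : ∀ᶠ l in atTop, ∃ G ∈ patch σ k F, e.symm (w (k + l)) ∈ renormPatch σ β G l := by
      have h3 := (tendsto_add_atTop_nat k).eventually hw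
      refine h3.mono fun l hl => ?_
      rw [← mem_renormPatch_add_iff hσ hnice hF, ← he, e.apply_symm_apply, add_comm]
      exact hl
    -- The patch is finite, so one of its faces captures the approximating points infinitely often.
    obtain ⟨G, hG, hfreq⟩ : ∃ G ∈ patch σ k F,
        ∃ᶠ l in atTop, e.symm (w (k + l)) ∈ renormPatch σ β G l := by
      by_contra! hcon
      have h4 : ∀ᶠ l in atTop, ∀ G ∈ patch σ k F, e.symm (w (k + l)) ∉ renormPatch σ β G l := by
        rw [Filter.eventually_all_finset]
        exact fun G hG => hcon G hG
      obtain ⟨l, ⟨G, hG, hl⟩, hl'⟩ := (h2.and h4).exists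
      exact hl' G hG hl
    exact ⟨G, hG, (isHausdorffLimit_tile hσ hnice (hnear G hG)).mem_of_frequently
      (isCompact_tile hσ hnice (hnear G hG)).isClosed hfreq h1⟩
  · rintro ⟨G, hG, hz⟩
    obtain ⟨w, hw, hwz⟩ := (isHausdorffLimit_tile hσ hnice (hnear G hG)).exists_tendsto hz
    -- The truncated subtraction `l - k` only has to be correct for large `l`.
    refine hlim.mem_of_frequently (isCompact_tile hσ hnice hF).isClosed
      (w := fun l => e (w (l - k))) ?_ ?_
    · refine Eventually.frequently ?_
      filter_upwards [(tendsto_sub_atTop_nat k).eventually hw, eventually_ge_atTop k] with l h1 h2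
      obtain ⟨i, rfl⟩ := Nat.exists_eq_add_of_le h2
      rw [he, mem_renormPatch_add_iff hσ hnice hF]
      exact ⟨G, hG, by simpa using h1⟩
    · rw [← he]
      exact (e.continuous.tendsto z).comp (hwz.comp (tendsto_sub_atTop_nat k))

open MeasureTheory Measure

/-! ### Counting faces by volume -/

/-- The factor by which the inverse of `M_σ` multiplies volumes in the contracting space. -/
noncomputable def inflation (σ : Substitution n) (β : ℝ) : ℝ := |(LinearMap.det (actC σ β))⁻¹|

theorem det_actC_ne_zero (hσ : IsPrimitiveUnitPisot σ β) (hnice : IsNice σ β) :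
    LinearMap.det (actC σ β) ≠ 0 :=
  ((LinearMap.isUnit_iff_isUnit_det _).1
    ((Module.End.isUnit_iff _).2 (actC_bijective hσ hnice))).ne_zero

theorem inflation_pos (hσ : IsPrimitiveUnitPisot σ β) (hnice : IsNice σ β) :
    0 < inflation σ β :=
  abs_pos.2 (inv_ne_zero (det_actC_ne_zero hσ hnice))

theorem addHaar_preimage_actC_pow (hσ : IsPrimitiveUnitPisot σ β) (hnice : IsNice σ β) (k : ℕ)
    (s : Set (contrSpace σ β)) : addHaar ((actC σ β ^ k) ⁻¹' s) =
      ENNReal.ofReal (inflation σ β ^ k) * addHaar s := by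
  rw [addHaar_preimage_linearMap _ (by
    rw [map_pow]; exact pow_ne_zero k (det_actC_ne_zero hσ hnice)), map_pow, ← inv_pow, abs_pow,
    inflation]

theorem interior_projFace (F : Face n) : interior (projFace σ β F) =
    (fun z => z + basePoint σ β F.1) '' interior (projFace σ β (0, F.2)) := by
  rw [projFace_eq_image]
  exact ((Homeomorph.addRight (basePoint σ β F.1)).image_interior _).symm

theorem addHaar_add_right (s : Set (contrSpace σ β)) (v : contrSpace σ β) :
    (addHaar ((fun z => z + v) '' s) : ENNReal) = addHaar s := by
  rw [image_add_right, measure_preimage_add_right]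

/-- The projected faces of type `b` have disjoint interiors of equal positive volume, packed in the
preimage of a fixed ball under `M_σ ^ k`, whose volume is a constant times the `k`-th power of the
inflation factor. -/
theorem exists_card_filter_patch_le (hσ : IsPrimitiveUnitPisot σ β) (hnice : IsNice σ β)
    {b : Finset (Fin n)} (hb : (interior (projFace σ β (0, b))).Nonempty) :
    ∃ C, ∀ F ∈ nearFaces σ β, ∀ k,
      (((patch σ k F).filter fun G => G.2 = b).card : ℝ) ≤ C * inflation σ β ^ k := by
  obtain ⟨R, -, hR⟩ := exists_bound_renormPatch hσ hnice
  set μ : Measure (contrSpace σ β) := addHaar with hμ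
  set ι := μ (interior (projFace σ β (0, b))) with hι
  have hι0 : ι ≠ 0 := (isOpen_interior.measure_pos μ hb).ne'
  have hιtop : ι ≠ ⊤ := ((measure_mono interior_subset).trans_lt
    (isCompact_projFace _).measure_lt_top).ne
  set B := μ (Metric.closedBall (0 : contrSpace σ β) R) with hB
  have hBtop : B ≠ ⊤ := measure_closedBall_lt_top.ne
  refine ⟨B.toReal / ι.toReal, fun F hF k => ?_⟩
  set s := (patch σ k F).filter fun G => G.2 = b with hs
  have hsub : ⋃ G ∈ s, interior (projFace σ β G) ⊆
      (actC σ β ^ k) ⁻¹' Metric.closedBall (basePoint σ β F.1) R := by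
    refine Set.iUnion₂_subset fun G hG z hz => ?_
    rw [Set.mem_preimage, mem_closedBall_iff_norm]
    exact hR F hF k _ (mem_renormPatch_iff.2
      ⟨G, (Finset.mem_filter.1 hG).1, z, interior_subset hz, rfl⟩)
  have h1 := measure_mono (μ := μ) hsub
  rw [measure_biUnion_finset ?_ fun G _ => isOpen_interior.measurableSet] at h1
  · have h2 : ∀ G ∈ s, μ (interior (projFace σ β G)) = ι := fun G hG => by
      rw [interior_projFace, (Finset.mem_filter.1 hG).2, hμ, addHaar_add_right]
    rw [Finset.sum_congr rfl h2, Finset.sum_const, nsmul_eq_mul, hμ,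
      addHaar_preimage_actC_pow hσ hnice, ← hμ, addHaar_closedBall_center, ← hB] at h1
    have h3 := ENNReal.toReal_mono (ENNReal.mul_ne_top ENNReal.ofReal_ne_top hBtop) h1
    rw [ENNReal.toReal_mul, ENNReal.toReal_mul, ENNReal.toReal_natCast,
      ENNReal.toReal_ofReal (pow_pos (inflation_pos hσ hnice) k).le] at h3
    rw [div_mul_eq_mul_div, le_div_iff₀ (ENNReal.toReal_pos hι0 hιtop), mul_comm B.toReal]
    exact h3
  · intro G hG H hH hne
    exact ((admissible_single hF).geomDual_pow hσ hnice k).1.2 G (Finset.mem_filter.1 hG).1 H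
      (Finset.mem_filter.1 hH).1 hne

/-- Each face has a descendant of type `b` after `p` generations, distinct for distinct faces, so
counting type `b` in generation `k + p` bounds all faces of generation `k`. -/
theorem exists_card_patch_le (hσ : IsPrimitiveUnitPisot σ β) (hnice : IsNice σ β)
    {b : Finset (Fin n)} (hbc : b.card = deg β - 1)
    (hb : (interior (projFace σ β (0, b))).Nonempty) :
    ∃ C, ∀ F ∈ nearFaces σ β, ∀ k, ((patch σ k F).card : ℝ) ≤ C * inflation σ β ^ k := by
  classical
  obtain ⟨C, hC⟩ := exists_card_filter_patch_le hσ hnice hb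
  obtain ⟨p, -, hp⟩ := exists_desc_of_type hσ hnice
  refine ⟨C * inflation σ β ^ p, fun F hF k => ?_⟩
  have h := card_patch_mul_le hσ hnice (fun F hF => hp F hF b hbc)
    (φ := fun a => if a = b then 1 else 0) (fun a _ => by positivity) hF k
  rw [if_pos rfl, mul_one, Finset.sum_boole] at h
  calc _ ≤ _ := h
    _ ≤ _ := hC F hF (k + p)
    _ = _ := by rw [pow_add]; ring

/-! ### Volumes of Rauzy fractals -/

/-- The volume of the Rauzy fractal of a type. -/
noncomputable def fractalVolume (σ : Substitution n) (β : ℝ) (a : Finset (Fin n)) : ℝ :=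
  (addHaar (rauzyFractal σ β a)).toReal

theorem fractalVolume_nonneg (a : Finset (Fin n)) : 0 ≤ fractalVolume σ β a :=
  ENNReal.toReal_nonneg

theorem addHaar_tile (F : Face n) :
    (addHaar (tile σ β F) : ENNReal) = addHaar (rauzyFractal σ β F.2) :=
  addHaar_add_right _ _

theorem addHaar_tile_ne_top (hσ : IsPrimitiveUnitPisot σ β) (hnice : IsNice σ β) {F : Face n}
    (hF : F ∈ nearFaces σ β) : (addHaar (tile σ β F) : ENNReal) ≠ ⊤ :=
  (isCompact_tile hσ hnice hF).measure_lt_top.ne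

theorem addHaar_biUnion_tile (hσ : IsPrimitiveUnitPisot σ β) (hnice : IsNice σ β) {F : Face n}
    (hF : F ∈ nearFaces σ β) (k : ℕ) :
    (addHaar (⋃ G ∈ patch σ k F, tile σ β G) : ENNReal).toReal =
      inflation σ β ^ k * fractalVolume σ β F.2 := by
  rw [← preimage_tile hσ hnice hF, addHaar_preimage_actC_pow hσ hnice, ENNReal.toReal_mul,
    ENNReal.toReal_ofReal (pow_pos (inflation_pos hσ hnice) k).le, addHaar_tile, fractalVolume]

/-- This is subadditivity of the measure applied to the subdivision of the inflated tile. -/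
theorem inflation_pow_mul_le (hσ : IsPrimitiveUnitPisot σ β) (hnice : IsNice σ β) {F : Face n}
    (hF : F ∈ nearFaces σ β) (k : ℕ) : inflation σ β ^ k * fractalVolume σ β F.2 ≤
      ∑ G ∈ patch σ k F, fractalVolume σ β G.2 := by
  have hnear : ∀ G ∈ patch σ k F, G ∈ nearFaces σ β := fun G hG =>
    ((mem_patch_iff hσ hnice hF).1 hG).mem_nearFaces hσ hnice hF
  have htop : ∀ G ∈ patch σ k F, (addHaar (tile σ β G) : ENNReal) ≠ ⊤ := fun G hG =>
    addHaar_tile_ne_top hσ hnice (hnear G hG)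
  rw [← addHaar_biUnion_tile hσ hnice hF]
  refine (ENNReal.toReal_mono (ENNReal.sum_ne_top.2 htop)
    (measure_biUnion_finset_le _ _)).trans_eq ?_
  rw [ENNReal.toReal_sum htop]
  exact Finset.sum_congr rfl fun G _ => by rw [addHaar_tile, fractalVolume]

/-- The quotient `S k / δ ^ k` is bounded above by `C * R`, yet it gains at least a fixed positive
amount at every step. -/
theorem false_of_growth {S N : ℕ → ℝ} {δ R r s C : ℝ} {p : ℕ} (hδ : 0 < δ) (hR : 0 < R)
    (hr : 0 < r) (hs : 0 < s) (hSle : ∀ k, S k ≤ N k * R) (hSge : ∀ k, δ ^ k * r ≤ S k)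
    (hSsucc : ∀ j, δ * S (j + p) + N j * s ≤ S (j + p + 1)) (hN : ∀ k, N k ≤ C * δ ^ k) :
    False := by
  -- The gain per step: at least `δ ^ j * r / R` faces, each contributing `s`, normalized by `δ ^ (j
  -- + p + 1)`.
  obtain ⟨κ, hκ⟩ : ∃ κ, κ = r * s / (R * δ ^ (p + 1)) := ⟨_, rfl⟩
  have hκ0 : 0 < κ := by rw [hκ]; positivity
  have hgrow : ∀ j : ℕ, j * κ ≤ S (j + p) / δ ^ (j + p) := by
    intro j
    induction j with
    | zero =>
      simp only [Nat.cast_zero, zero_mul]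
      exact div_nonneg (le_trans (by positivity) (hSge _)) (by positivity)
    | succ j ih =>
      have h2 : δ ^ j * r / R ≤ N j := by
        rw [div_le_iff₀ hR]
        exact (hSge j).trans (hSle j)
      have h3 := mul_le_mul_of_nonneg_right h2 hs.le
      have h4 : κ * δ ^ (j + p + 1) = δ ^ j * r / R * s := by
        rw [hκ, add_assoc j, pow_add δ j]; field_simp
      rw [le_div_iff₀ (by positivity)] at ih
      rw [show j + 1 + p = j + p + 1 by ring, le_div_iff₀ (by positivity)]
      push_cast
      calc ((j : ℝ) + 1) * κ * δ ^ (j + p + 1)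
          = δ * (j * κ * δ ^ (j + p)) + κ * δ ^ (j + p + 1) := by ring
        _ ≤ δ * S (j + p) + N j * s := by
          rw [h4]
          exact add_le_add (mul_le_mul_of_nonneg_left ih hδ.le) h3
        _ ≤ _ := hSsucc j
  obtain ⟨j, hj⟩ := exists_nat_gt (C * R / κ)
  have h1 : S (j + p) / δ ^ (j + p) ≤ C * R := by
    rw [div_le_iff₀ (by positivity)]
    calc S (j + p) ≤ N (j + p) * R := hSle _
      _ ≤ C * δ ^ (j + p) * R := mul_le_mul_of_nonneg_right (hN _) hR.le
      _ = _ := by ring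
  rw [div_lt_iff₀ hκ0] at hj
  linarith [hgrow j]

/-- The volumes of the Rauzy fractals form an eigenvector of the transfer operator. -/
theorem sum_fractalVolume_patch_one (hσ : IsPrimitiveUnitPisot σ β) (hnice : IsNice σ β)
    {b : Finset (Fin n)} (hbc : b.card = deg β - 1)
    (hb : (interior (projFace σ β (0, b))).Nonempty) {F : Face n} (hF : F ∈ nearFaces σ β) :
    ∑ G ∈ patch σ 1 F, fractalVolume σ β G.2 = inflation σ β * fractalVolume σ β F.2 := by
  set r := fractalVolume σ β with hr
  set δ := inflation σ β with hδ
  have hδ0 : 0 < δ := inflation_pos hσ hnice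
  have hr0 : ∀ a, 0 ≤ r a := fractalVolume_nonneg
  rw [sum_patch_one hσ hnice hF]
  by_contra hne
  -- The excess of the pieces over the inflated volume; it is non-negative on the relevant types,
  -- and the aim is to rule out a positive value.
  let s : Finset (Fin n) → ℝ := fun a => transfer σ r a - δ * r a
  have hs0 : ∀ a, a.card = deg β - 1 → 0 ≤ s a := fun a ha => by
    have h := inflation_pow_mul_le hσ hnice (zero_mem_nearFaces hσ hnice ha) 1
    rw [pow_one, sum_patch_one hσ hnice (zero_mem_nearFaces hσ hnice ha)] at h
    exact sub_nonneg.2 h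
  have hFc := card_of_mem_nearFaces hσ hnice hF
  have hsF : 0 < s F.2 := lt_of_le_of_ne (hs0 _ hFc) fun h => hne (sub_eq_zero.1 h.symm)
  -- A strict inequality forces some volume to be positive, which provides the lower bound on
  -- growth.
  obtain ⟨a, ha, hra⟩ : ∃ a, a.card = deg β - 1 ∧ 0 < r a := by
    by_contra! hcon
    have h1 : transfer σ r F.2 ≤ 0 := by
      rw [← sum_patch_one hσ hnice hF]
      refine Finset.sum_nonpos fun G hG => hcon G.2 ?_
      exact ((mem_patch_iff hσ hnice hF).1 hG).card_eq.trans hFc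
    have h2 := mul_nonneg hδ0.le (hr0 F.2)
    have h3 : 0 < transfer σ r F.2 - δ * r F.2 := hsF
    linarith
  have hA := zero_mem_nearFaces hσ hnice ha
  set A : Face n := (0, a) with hAdef
  set R := ∑ c, r c with hRdef
  have hrR : ∀ c, r c ≤ R := fun c => Finset.single_le_sum (fun c _ => hr0 c) (Finset.mem_univ c)
  have hR : 0 < R := hra.trans_le (hrR a)
  obtain ⟨p, -, hp⟩ := exists_desc_of_type hσ hnice
  obtain ⟨C, hC⟩ := exists_card_patch_le hσ hnice hbc hb
  refine false_of_growth (S := fun k => ∑ G ∈ patch σ k A, r G.2)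
    (N := fun k => ((patch σ k A).card : ℝ)) (p := p) hδ0 hR hra hsF (fun k => ?_)
    (fun k => inflation_pow_mul_le hσ hnice hA k) (fun j => ?_) (hC A hA)
  · rw [← nsmul_eq_mul]
    exact Finset.sum_le_card_nsmul _ _ _ fun G _ => hrR G.2
  · have h1 := card_patch_mul_le hσ hnice (fun F' hF' => hp F' hF' F.2 hFc) hs0 hA j
    refine (add_le_add_right h1 _).trans_eq ?_
    rw [sum_patch_add hσ hnice hA (fun G => r G.2) (j + p) 1, Finset.mul_sum,
      ← Finset.sum_add_distrib]
    refine Finset.sum_congr rfl fun G hG => ?_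
    rw [sum_patch_one hσ hnice (((mem_patch_iff hσ hnice hA).1 hG).mem_nearFaces hσ hnice hA)]
    exact add_sub_cancel _ _

theorem sum_fractalVolume_patch (hσ : IsPrimitiveUnitPisot σ β) (hnice : IsNice σ β)
    {b : Finset (Fin n)} (hbc : b.card = deg β - 1)
    (hb : (interior (projFace σ β (0, b))).Nonempty) {F : Face n} (hF : F ∈ nearFaces σ β)
    (k : ℕ) : ∑ G ∈ patch σ k F, fractalVolume σ β G.2 =
      inflation σ β ^ k * fractalVolume σ β F.2 := by
  induction k with
  | zero => simp [patch]
  | succ k ih =>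
    rw [sum_patch_add hσ hnice hF fun G => fractalVolume σ β G.2, pow_succ', mul_assoc, ← ih,
      Finset.mul_sum]
    exact Finset.sum_congr rfl fun G hG => sum_fractalVolume_patch_one hσ hnice hbc hb
      (((mem_patch_iff hσ hnice hF).1 hG).mem_nearFaces hσ hnice hF)

/-- The sum counts the overlap of two pieces twice, so equality with the measure of the union leaves
no room for a positive overlap; finiteness permits the cancellation. -/
theorem measure_inter_eq_zero_of_sum_le {α ι : Type*} [MeasurableSpace α] {μ : Measure α}
    {s : Finset ι} {T : ι → Set α} (hT : ∀ i ∈ s, MeasurableSet (T i))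
    (htop : ∀ i ∈ s, μ (T i) ≠ ⊤) (hsum : ∑ i ∈ s, μ (T i) ≤ μ (⋃ i ∈ s, T i)) {i j : ι}
    (hi : i ∈ s) (hj : j ∈ s) (hij : i ≠ j) : μ (T i ∩ T j) = 0 := by
  classical
  set t := (s.erase i).erase j with ht
  have hj' : j ∈ s.erase i := Finset.mem_erase.2 ⟨hij.symm, hj⟩
  have h1 : ∑ i ∈ s, μ (T i) = μ (T i ∪ T j) + μ (T i ∩ T j) + ∑ i ∈ t, μ (T i) := by
    rw [measure_union_add_inter _ (hT j hj), ← Finset.add_sum_erase s _ hi,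
      ← Finset.add_sum_erase _ _ hj', add_assoc]
  have h2 : μ (⋃ i ∈ s, T i) ≤ μ (T i ∪ T j) + ∑ i ∈ t, μ (T i) := by
    refine (measure_mono ?_).trans ((measure_union_le (T i ∪ T j) (⋃ i ∈ t, T i)).trans
      (add_le_add_right (measure_biUnion_finset_le t T) _))
    refine Set.iUnion₂_subset fun l hl z hz => ?_
    by_cases h : l = i
    · exact Or.inl (Or.inl (h ▸ hz))
    by_cases h' : l = j
    · exact Or.inl (Or.inr (h' ▸ hz))
    · exact Or.inr (Set.mem_biUnion (Finset.mem_erase.2 ⟨h', Finset.mem_erase.2 ⟨h, hl⟩⟩) hz)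
  have h3 : μ (T i ∪ T j) + ∑ i ∈ t, μ (T i) ≠ ⊤ := by
    refine ENNReal.add_ne_top.2 ⟨?_, ENNReal.sum_ne_top.2 fun l hl =>
      htop l (Finset.mem_of_mem_erase (Finset.mem_of_mem_erase hl))⟩
    exact ((measure_union_le _ _).trans_lt
      (ENNReal.add_lt_top.2 ⟨(htop i hi).lt_top, (htop j hj).lt_top⟩)).ne
  have h4 : μ (T i ∩ T j) + (μ (T i ∪ T j) + ∑ i ∈ t, μ (T i)) ≤
      0 + (μ (T i ∪ T j) + ∑ i ∈ t, μ (T i)) := by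
    rw [zero_add]
    refine le_trans (le_of_eq ?_) (hsum.trans h2)
    rw [h1]; ring
  exact le_antisymm ((ENNReal.add_le_add_iff_right h3).1 h4) zero_le

/-- The tiles of distinct faces of the image of one face overlap in a null set. -/
theorem addHaar_inter_tile_of_mem_patch (hσ : IsPrimitiveUnitPisot σ β) (hnice : IsNice σ β)
    {b : Finset (Fin n)} (hbc : b.card = deg β - 1)
    (hb : (interior (projFace σ β (0, b))).Nonempty) {F : Face n} (hF : F ∈ nearFaces σ β)
    {k : ℕ} {G H : Face n} (hG : G ∈ patch σ k F) (hH : H ∈ patch σ k F) (hGH : G ≠ H) :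
    (addHaar (tile σ β G ∩ tile σ β H) : ENNReal) = 0 := by
  have hnear : ∀ G ∈ patch σ k F, G ∈ nearFaces σ β := fun G hG =>
    ((mem_patch_iff hσ hnice hF).1 hG).mem_nearFaces hσ hnice hF
  have htop : ∀ G ∈ patch σ k F, (addHaar (tile σ β G) : ENNReal) ≠ ⊤ := fun G hG =>
    addHaar_tile_ne_top hσ hnice (hnear G hG)
  refine measure_inter_eq_zero_of_sum_le (s := patch σ k F)
    (fun G hG => (isCompact_tile hσ hnice (hnear G hG)).isClosed.measurableSet) htop ?_ hG hH hGH
  have h1 : (addHaar (⋃ G ∈ patch σ k F, tile σ β G) : ENNReal) ≠ ⊤ :=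
    ((measure_biUnion_finset_le _ _).trans_lt
      (ENNReal.sum_ne_top.2 htop).lt_top).ne
  rw [← ENNReal.toReal_le_toReal (ENNReal.sum_ne_top.2 htop) h1,
    addHaar_biUnion_tile hσ hnice hF, ENNReal.toReal_sum htop,
    ← sum_fractalVolume_patch hσ hnice hbc hb hF]
  exact le_of_eq (Finset.sum_congr rfl fun G _ => by rw [addHaar_tile, fractalVolume])

/-! ### Coincidences -/

/-- Duality reverses edges: `σ(a) = p b s` makes a face of type `aᶜ` a child of one of type `bᶜ`. -/
theorem exists_child_of_suffixEdge {a b : Finset (Fin n)} {s : Fin n → ℤ}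
    (h : SuffixEdge σ a b s) {x : Fin n → ℤ} :
    Child σ ((incidence σ).mulVec x - s, bᶜ) (x, aᶜ) := by
  obtain ⟨τ, j, hd, rfl⟩ := h
  have key : ∀ a' b' : Finset (Fin n), a' = a → b' = b → ∃ (τ' : a' ≃ b') (j' : Positions σ a'),
      IsDecomp σ τ' j' ∧ suffixVec σ j' = suffixVec σ j := by
    rintro a' b' rfl rfl
    exact ⟨τ, j, hd, rfl⟩
  obtain ⟨τ', j', h1, h2⟩ := key aᶜᶜ bᶜᶜ (compl_compl a) (compl_compl b)
  exact ⟨τ', j', h1, by rw [h2, sub_add_cancel]⟩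

theorem desc_of_suffixPath {k : ℕ} {a c : Finset (Fin n)} {v : Fin n → ℤ}
    (h : SuffixPath σ k a c v) : Desc σ k (-v, cᶜ) (0, aᶜ) := by
  obtain ⟨w, s, rfl, rfl, hedge, rfl⟩ := h
  induction k with
  | zero => simp [Desc]
  | succ k ih =>
    -- Because descent runs backwards, the last edge of the path supplies the first generation, and
    -- the shorter path supplies the rest.
    have h1 := exists_child_of_suffixEdge (hedge k (Nat.lt_succ_self k))
      (x := -∑ i ∈ Finset.range k, ((incidence σ) ^ (k - 1 - i)).mulVec (s i))
    have h2 : (incidence σ).mulVec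
        (-∑ i ∈ Finset.range k, ((incidence σ) ^ (k - 1 - i)).mulVec (s i)) - s k =
        -∑ i ∈ Finset.range (k + 1), ((incidence σ) ^ (k + 1 - 1 - i)).mulVec (s i) := by
      rw [Finset.sum_range_succ, Matrix.mulVec_neg, Matrix.mulVec_sum, neg_add, ← sub_eq_add_neg]
      congr 1
      · congr 1
        refine Finset.sum_congr rfl fun i hi => ?_
        have := Finset.mem_range.1 hi
        rw [Matrix.mulVec_mulVec, ← pow_succ']
        congr 2
        omega
      · simp
    rw [h2] at h1
    rw [add_comm k 1]
    refine desc_add.2 ⟨_, desc_one.2 ?_, ih fun i hi => hedge i (hi.trans (Nat.lt_succ_self k))⟩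
    rwa [add_comm 1 k]

theorem tile_translate (F : Face n) (z : Fin n → ℤ) :
    tile σ β (F.1 + z, F.2) = (fun w => w + basePoint σ β z) '' tile σ β F := by
  rw [tile, tile, Set.image_image]
  congr 1
  ext1 w
  rw [add_assoc]
  congr 1
  exact basePoint_add F.1 z

/-- Equal endpoints and equal suffix sums put translates of the two faces, by one common vector,
into the patch of a single face, where overlaps are null. -/
theorem addHaar_inter_tile_of_hasCoincidence (hσ : IsPrimitiveUnitPisot σ β)
    (hnice : IsNice σ β) {b : Finset (Fin n)} (hbc : b.card = deg β - 1)
    (hb : (interior (projFace σ β (0, b))).Nonempty) {a a' : Finset (Fin n)}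
    (ha : a.card = deg β - 1) (haa' : a ≠ a') (h : HasCoincidence σ aᶜ a'ᶜ) :
    (addHaar (tile σ β (0, a) ∩ tile σ β (0, a')) : ENNReal) = 0 := by
  obtain ⟨k, -, c, v, h1, h2⟩ := h
  obtain ⟨z, hz⟩ := exists_pow_mulVec_eq hσ hnice k v
  have h3 := (desc_of_suffixPath h1).translate z
  have h4 := (desc_of_suffixPath h2).translate z
  rw [hz, neg_add_cancel, zero_add, compl_compl] at h3 h4
  have hF : ((0, cᶜ) : Face n) ∈ nearFaces σ β :=
    zero_mem_nearFaces hσ hnice (h3.card_eq.symm.trans ha)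
  have h5 := addHaar_inter_tile_of_mem_patch hσ hnice hbc hb hF
    ((mem_patch_iff hσ hnice hF).2 h3) ((mem_patch_iff hσ hnice hF).2 h4)
    (fun h => haa' (Prod.mk.inj h).2)
  have h6 := tile_translate (σ := σ) (β := β) (0, a) z
  have h7 := tile_translate (σ := σ) (β := β) (0, a') z
  rw [zero_add] at h6 h7
  rwa [h6, h7, ← Set.image_inter (add_left_injective _), addHaar_add_right] at h5

/-! ### Stepped surfaces -/

section SteppedSurface

variable {U : Chain n} {m : ℕ}

theorem admissible_of_base_zero (hσ : IsPrimitiveUnitPisot σ β) (hnice : IsNice σ β)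
    (hUdim : ∀ F ∈ U.support, F.2.card = deg β - 1) (hUbase : ∀ F ∈ U.support, F.1 = 0)
    (hUwell : ProjectsWell σ β U) : Admissible σ β U := by
  refine ⟨hUwell, fun F hF => ?_⟩
  have h := zero_mem_nearFaces hσ hnice (hUdim F hF)
  rwa [← hUbase F hF] at h

theorem mem_steppedSurface_iff (hσ : IsPrimitiveUnitPisot σ β) (hnice : IsNice σ β)
    (hU : Admissible σ β U) {F : Face n} :
    F ∈ steppedSurface σ m U ↔ ∃ k, ∃ F₀ ∈ U.support, Desc σ (m * k) F₀ F :=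
  exists_congr fun _ => hU.mem_support_pow_iff hσ hnice

theorem mem_nearFaces_of_mem_steppedSurface (hσ : IsPrimitiveUnitPisot σ β)
    (hnice : IsNice σ β) (hU : Admissible σ β U) {F : Face n} (hF : F ∈ steppedSurface σ m U) :
    F ∈ nearFaces σ β := by
  obtain ⟨k, hk⟩ := hF
  exact (hU.geomDual_pow hσ hnice _).2 F hk

/-- Since `U` recurs inside its own image, every face of a generation recurs in the next one. Thus
any two faces of the surface can be studied in a common admissible iterate. -/
theorem support_pow_mono (hσ : IsPrimitiveUnitPisot σ β) (hnice : IsNice σ β)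
    (hU : Admissible σ β U) (hsub : U.support ⊆ ((geomDual σ ^ m) U).support) {k l : ℕ}
    (hkl : k ≤ l) :
    ((geomDual σ ^ (m * k)) U).support ⊆ ((geomDual σ ^ (m * l)) U).support := by
  induction l, hkl using Nat.le_induction with
  | base => exact subset_rfl
  | succ l _ ih =>
    intro F hF
    obtain ⟨F₀, hF₀, h⟩ := (hU.mem_support_pow_iff hσ hnice).1 (ih hF)
    obtain ⟨F₁, hF₁, h'⟩ := (hU.mem_support_pow_iff hσ hnice).1 (hsub hF₀)
    refine (hU.mem_support_pow_iff hσ hnice).2 ⟨F₁, hF₁, ?_⟩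
    rw [Nat.mul_succ, add_comm]
    exact desc_add.2 ⟨F₀, h', h⟩

theorem exists_common_generation (hσ : IsPrimitiveUnitPisot σ β) (hnice : IsNice σ β)
    (hU : Admissible σ β U) (hsub : U.support ⊆ ((geomDual σ ^ m) U).support) {F G : Face n}
    (hF : F ∈ steppedSurface σ m U) (hG : G ∈ steppedSurface σ m U) :
    ∃ k, F ∈ ((geomDual σ ^ (m * k)) U).support ∧ G ∈ ((geomDual σ ^ (m * k)) U).support := by
  obtain ⟨k, hk⟩ := hF
  obtain ⟨l, hl⟩ := hG
  exact ⟨max k l, support_pow_mono hσ hnice hU hsub (le_max_left k l) hk,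
    support_pow_mono hσ hnice hU hsub (le_max_right k l) hl⟩

theorem disjoint_interior_of_mem_steppedSurface (hσ : IsPrimitiveUnitPisot σ β)
    (hnice : IsNice σ β) (hU : Admissible σ β U)
    (hsub : U.support ⊆ ((geomDual σ ^ m) U).support) {F G : Face n}
    (hF : F ∈ steppedSurface σ m U) (hG : G ∈ steppedSurface σ m U) (hFG : F ≠ G) :
    Disjoint (interior (projFace σ β F)) (interior (projFace σ β G)) := by
  obtain ⟨k, h1, h2⟩ := exists_common_generation hσ hnice hU hsub hF hG
  exact (hU.geomDual_pow hσ hnice _).1.2 F h1 G h2 hFG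

theorem eq_of_common_desc (hσ : IsPrimitiveUnitPisot σ β)
    (hnice : IsNice σ β) (hU : Admissible σ β U)
    (hsub : U.support ⊆ ((geomDual σ ^ m) U).support) {F G H : Face n}
    (hF : F ∈ steppedSurface σ m U) (hG : G ∈ steppedSurface σ m U) {j : ℕ}
    (hFH : Desc σ j F H) (hGH : Desc σ j G H) : F = G := by
  obtain ⟨k, h1, h2⟩ := exists_common_generation hσ hnice hU hsub hF hG
  exact (hU.geomDual_pow hσ hnice _).disjoint_desc hσ hnice h1 h2 hFH hGH

theorem mem_steppedSurface_of_desc (hσ : IsPrimitiveUnitPisot σ β) (hnice : IsNice σ β)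
    (hU : Admissible σ β U) {F H : Face n} (hF : F ∈ steppedSurface σ m U) {j : ℕ}
    (h : Desc σ (m * j) F H) : H ∈ steppedSurface σ m U := by
  obtain ⟨k, F₀, hF₀, h'⟩ := (mem_steppedSurface_iff hσ hnice hU).1 hF
  exact (mem_steppedSurface_iff hσ hnice hU).2
    ⟨k + j, F₀, hF₀, by rw [mul_add]; exact desc_add.2 ⟨F, h', h⟩⟩

/-- Monotonicity lets `H` be seen in generation `k + j`, so its line of descent can be cut `j`
blocks before the end. -/
theorem exists_ancestor (hσ : IsPrimitiveUnitPisot σ β)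
    (hnice : IsNice σ β) (hU : Admissible σ β U)
    (hsub : U.support ⊆ ((geomDual σ ^ m) U).support) {H : Face n}
    (hH : H ∈ steppedSurface σ m U) (j : ℕ) :
    ∃ F ∈ steppedSurface σ m U, Desc σ (m * j) F H := by
  obtain ⟨k, hk⟩ := hH
  obtain ⟨F₀, hF₀, h⟩ := (hU.mem_support_pow_iff hσ hnice).1
    (support_pow_mono hσ hnice hU hsub (Nat.le_add_right k j) hk)
  rw [mul_add] at h
  obtain ⟨F, h1, h2⟩ := desc_add.1 h
  exact ⟨F, (mem_steppedSurface_iff hσ hnice hU).2 ⟨k, F₀, hF₀, h1⟩, h2⟩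

theorem isSelfReplicating_steppedSurface (hσ : IsPrimitiveUnitPisot σ β)
    (hnice : IsNice σ β) (hU : Admissible σ β U)
    (hsub : U.support ⊆ ((geomDual σ ^ m) U).support) :
    IsSelfReplicating σ β m (steppedSurface σ m U) where
  expansion_bijective := actC_bijective hσ hnice
  stable := by
    ext H
    simp only [Set.mem_iUnion, exists_prop, Finset.mem_coe]
    constructor
    · rintro ⟨F, hF, h⟩
      have hFn := mem_nearFaces_of_mem_steppedSurface hσ hnice hU hF
      exact mem_steppedSurface_of_desc hσ hnice hU hF (j := 1) (by
        rw [mul_one]; exact (mem_patch_iff hσ hnice hFn).1 h)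
    · intro hH
      obtain ⟨F, hF, h⟩ := exists_ancestor hσ hnice hU hsub hH 1
      rw [mul_one] at h
      exact ⟨F, hF, (mem_patch_iff hσ hnice
        (mem_nearFaces_of_mem_steppedSurface hσ hnice hU hF)).2 h⟩
  disjoint := fun F hF G hG hFG => Finset.disjoint_left.2 fun H h1 h2 =>
    hFG (eq_of_common_desc hσ hnice hU hsub hF hG
      ((mem_patch_iff hσ hnice (mem_nearFaces_of_mem_steppedSurface hσ hnice hU hF)).1 h1)
      ((mem_patch_iff hσ hnice (mem_nearFaces_of_mem_steppedSurface hσ hnice hU hG)).1 h2))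
  subdivide := fun F hF =>
    preimage_tile hσ hnice (mem_nearFaces_of_mem_steppedSurface hσ hnice hU hF) m

/-! ### Null overlaps, local finiteness and covering -/

/-- Some projected face has interior points. -/
theorem exists_interior_projFace_nonempty (hσ : IsPrimitiveUnitPisot σ β)
    (hnice : IsNice σ β) (hU : Admissible σ β U)
    (hcov : ⋃ F ∈ steppedSurface σ m U, projFace σ β F = Set.univ) :
    ∃ b : Finset (Fin n), b.card = deg β - 1 ∧ (interior (projFace σ β (0, b))).Nonempty := by
  -- Baire's theorem applies to this countable cover by closed sets.
  rw [Set.biUnion_eq_iUnion] at hcov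
  obtain ⟨⟨F, hF⟩, h⟩ := nonempty_interior_of_iUnion_of_closed
    (fun F : steppedSurface σ m U => (isCompact_projFace (F : Face n)).isClosed) hcov
  refine ⟨F.2, card_of_mem_nearFaces hσ hnice
    (mem_nearFaces_of_mem_steppedSurface hσ hnice hU hF), ?_⟩
  rw [interior_projFace] at h
  exact h.of_image

/-- Distinct tiles of the stepped surface overlap in a null set. -/
theorem addHaar_inter_tile_of_mem_steppedSurface (hσ : IsPrimitiveUnitPisot σ β)
    (hnice : IsNice σ β) (hscc : StrongCoincidence σ β) (hU : Admissible σ β U)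
    (hUbase : ∀ F ∈ U.support, F.1 = 0)
    (hfin : GeometricFiniteness σ β m U) {F G : Face n}
    (hF : F ∈ steppedSurface σ m U) (hG : G ∈ steppedSurface σ m U) (hFG : F ≠ G) :
    (addHaar (tile σ β F ∩ tile σ β G) : ENNReal) = 0 := by
  obtain ⟨b, hbc, hb⟩ := exists_interior_projFace_nonempty hσ hnice hU hfin.2.2
  obtain ⟨k, h1, h2⟩ := exists_common_generation hσ hnice hU hfin.2.1 hF hG
  obtain ⟨F₀, hF₀, h1⟩ := (hU.mem_support_pow_iff hσ hnice).1 h1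
  obtain ⟨G₀, hG₀, h2⟩ := (hU.mem_support_pow_iff hσ hnice).1 h2
  have hFn := hU.2 F₀ hF₀
  have hGn := hU.2 G₀ hG₀
  by_cases h : F₀ = G₀
  · subst h
    exact addHaar_inter_tile_of_mem_patch hσ hnice hbc hb hFn
      ((mem_patch_iff hσ hnice hFn).2 h1) ((mem_patch_iff hσ hnice hFn).2 h2) hFG
  · have hF0 : F₀ = (0, F₀.2) := Prod.ext (hUbase F₀ hF₀) rfl
    have hG0 : G₀ = (0, G₀.2) := Prod.ext (hUbase G₀ hG₀) rfl
    have hne : F₀.2 ≠ G₀.2 := fun he => h (by rw [hF0, hG0, he])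
    have hFc := card_of_mem_nearFaces hσ hnice hFn
    have hGc := card_of_mem_nearFaces hσ hnice hGn
    have h3 : (addHaar (tile σ β F₀ ∩ tile σ β G₀) : ENNReal) = 0 := by
      rw [hF0, hG0]
      refine addHaar_inter_tile_of_hasCoincidence hσ hnice hbc hb hFc hne ?_
      refine hscc _ _ (card_compl_of_card hσ hFc) (card_compl_of_card hσ hGc) ?_
      rw [compl_compl, compl_compl, ← hF0, ← hG0]
      exact projectsWell_pair hU.1 hF₀ hG₀ h
    -- Inflation sends the null overlap of the ancestors' tiles to a null set containing the overlap
    -- of the descendants' tiles.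
    have hsub : tile σ β F ∩ tile σ β G ⊆
        (actC σ β ^ (m * k)) ⁻¹' (tile σ β F₀ ∩ tile σ β G₀) := by
      rw [Set.preimage_inter, preimage_tile hσ hnice hFn, preimage_tile hσ hnice hGn]
      exact Set.inter_subset_inter
        (Set.subset_biUnion_of_mem (u := fun G => tile σ β G) ((mem_patch_iff hσ hnice hFn).2 h1))
        (Set.subset_biUnion_of_mem (u := fun G => tile σ β G) ((mem_patch_iff hσ hnice hGn).2 h2))
    refine measure_mono_null hsub ?_
    rw [addHaar_preimage_actC_pow hσ hnice, h3, mul_zero]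

/-- The stepped surface is locally finite. -/
theorem finite_steppedSurface_inter (hσ : IsPrimitiveUnitPisot σ β)
    (hnice : IsNice σ β) (hU : Admissible σ β U) (hfin : GeometricFiniteness σ β m U) (R : ℝ) :
    {F ∈ steppedSurface σ m U | ‖basePoint σ β F.1‖ ≤ R}.Finite := by
  obtain ⟨b, hbc, hb⟩ := exists_interior_projFace_nonempty hσ hnice hU hfin.2.2
  obtain ⟨C₂, -, hC₂⟩ := exists_bound_projFace σ β
  -- For the single type `b`, disjoint interiors of one fixed positive volume inside a bounded
  -- region must be finite in number.
  have hT : ∀ R', {G ∈ steppedSurface σ m U | G.2 = b ∧ ‖basePoint σ β G.1‖ ≤ R'}.Finite := by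
    intro R'
    set T := {G ∈ steppedSurface σ m U | G.2 = b ∧ ‖basePoint σ β G.1‖ ≤ R'} with hTdef
    set μ : Measure (contrSpace σ β) := addHaar with hμ
    have hι0 : 0 < μ (interior (projFace σ β (0, b))) := isOpen_interior.measure_pos μ hb
    have h := Measure.finite_const_le_meas_of_disjoint_iUnion μ
      (As := fun G : T => interior (projFace σ β (G : Face n))) hι0
      (fun G => isOpen_interior.measurableSet)
      (fun G G' hne => disjoint_interior_of_mem_steppedSurface hσ hnice hU hfin.2.1 G.2.1 G'.2.1
        fun he => hne (Subtype.ext he))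
      (ne_top_of_le_ne_top (measure_closedBall_lt_top (μ := μ) (x := 0) (r := C₂ + R')).ne
        (measure_mono (Set.iUnion_subset fun G z hz => ?_)))
    · have huniv : {G : T | μ (interior (projFace σ β (0, b))) ≤
          μ (interior (projFace σ β (G : Face n)))} = Set.univ := by
        refine Set.eq_univ_of_forall fun G => ?_
        rw [Set.mem_ofPred_eq, interior_projFace (G : Face n), G.2.2.1, hμ, addHaar_add_right]
      rw [huniv, Set.finite_univ_iff] at h
      exact Set.toFinite T
    · rw [mem_closedBall_zero_iff]
      have h1 := hC₂ G z (interior_subset hz)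
      have h2 := G.2.2.2
      calc ‖z‖ = ‖(z - basePoint σ β (G : Face n).1) + basePoint σ β (G : Face n).1‖ := by
            rw [sub_add_cancel]
        _ ≤ C₂ + R' := (norm_add_le _ _).trans (add_le_add h1 h2)
  -- The remaining types are injected into type `b` by choosing a descendant `m * p` generations
  -- later; multiples of `m` keep it in the surface, and bounded displacement keeps it in a bounded
  -- region.
  obtain ⟨p, hp⟩ := exists_desc_of_type_mul hσ hnice hfin.1
  obtain ⟨C, -, hC⟩ := exists_bound_desc hσ hnice
  obtain ⟨e, he⟩ := exists_continuousLinearEquiv_actC_pow hσ hnice (m * p)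
  have hdesc : ∀ F : Face n, ∃ y, F.2.card = deg β - 1 → Desc σ (m * p) F (y, b) := fun F => by
    by_cases hF : F.2.card = deg β - 1
    · obtain ⟨y, hy⟩ := hp F hF b hbc
      exact ⟨y, fun _ => hy⟩
    · exact ⟨0, fun h => absurd h hF⟩
  choose y hy using hdesc
  have hcard : ∀ F ∈ steppedSurface σ m U, F.2.card = deg β - 1 := fun F hF =>
    card_of_mem_nearFaces hσ hnice (mem_nearFaces_of_mem_steppedSurface hσ hnice hU hF)
  refine Set.Finite.of_finite_image ((hT (‖(e.symm : contrSpace σ β →L[ℝ] contrSpace σ β)‖ *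
    (C + R))).subset ?_) (f := fun F => ((y F, b) : Face n)) ?_
  · rintro _ ⟨F, ⟨hF, hFR⟩, rfl⟩
    have hd := hy F (hcard F hF)
    refine ⟨mem_steppedSurface_of_desc hσ hnice hU hF hd, rfl, ?_⟩
    have h1 := hC _ _ _ hd
    rw [← he] at h1
    have h2 : ‖e (basePoint σ β (y F))‖ ≤ C + R := by
      calc ‖e (basePoint σ β (y F))‖
          = ‖(e (basePoint σ β (y F)) - basePoint σ β F.1) + basePoint σ β F.1‖ := by
            rw [sub_add_cancel]
        _ ≤ C + R := (norm_add_le _ _).trans (add_le_add h1 hFR)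
    have h3 := (e.symm : contrSpace σ β →L[ℝ] contrSpace σ β).le_opNorm (e (basePoint σ β (y F)))
    rw [ContinuousLinearEquiv.coe_coe, e.symm_apply_apply] at h3
    exact h3.trans (mul_le_mul_of_nonneg_left h2 (norm_nonneg _))
  · intro F hF G hG hFG
    have h1 := hy F (hcard F hF.1)
    have h2 := hy G (hcard G hG.1)
    rw [show y F = y G from (Prod.mk.inj hFG).1] at h1
    exact eq_of_common_desc hσ hnice hU hfin.2.1 hF.1 hG.1 h1 h2

/-- For each `k`, the point `M_σ ^ (-m k) z` lies in a projected face, so `z` lies in a renormalized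
patch of an ancestor. By local finiteness one ancestor recurs for infinitely many `k`, and its tile
contains the limit `z`. -/
theorem iUnion_tile_steppedSurface (hσ : IsPrimitiveUnitPisot σ β)
    (hnice : IsNice σ β) (hU : Admissible σ β U) (hfin : GeometricFiniteness σ β m U)
    (z : contrSpace σ β) : ∃ F ∈ steppedSurface σ m U, z ∈ tile σ β F := by
  obtain ⟨C, -, hC⟩ := exists_bound_renormPatch hσ hnice
  have h1 : ∀ k, ∃ F ∈ steppedSurface σ m U, z ∈ renormPatch σ β F (m * k) := by
    intro k
    obtain ⟨w, rfl⟩ := (actC_pow_bijective hσ hnice (m * k)).2 z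
    have hw : w ∈ ⋃ F ∈ steppedSurface σ m U, projFace σ β F := hfin.2.2 ▸ Set.mem_univ w
    obtain ⟨H, hH, hw⟩ := Set.mem_iUnion₂.1 hw
    obtain ⟨F, hF, hd⟩ := exists_ancestor hσ hnice hU hfin.2.1 hH k
    exact ⟨F, hF, mem_renormPatch_iff.2 ⟨H, (mem_patch_iff hσ hnice
      (mem_nearFaces_of_mem_steppedSurface hσ hnice hU hF)).2 hd, w, hw, rfl⟩⟩
  choose F hF hz using h1
  have hfinite := finite_steppedSurface_inter hσ hnice hU hfin (C + ‖z‖)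
  have hmem : ∀ k, F k ∈ {F ∈ steppedSurface σ m U | ‖basePoint σ β F.1‖ ≤ C + ‖z‖} := by
    intro k
    refine ⟨hF k, ?_⟩
    have h2 := hC (F k) (mem_nearFaces_of_mem_steppedSurface hσ hnice hU (hF k)) _ z (hz k)
    calc ‖basePoint σ β (F k).1‖ = ‖z - (z - basePoint σ β (F k).1)‖ := by rw [sub_sub_cancel]
      _ ≤ ‖z‖ + C := (norm_sub_le _ _).trans (add_le_add le_rfl h2)
      _ = _ := add_comm _ _
  obtain ⟨G, hG, hfreq⟩ : ∃ G ∈ steppedSurface σ m U, ∃ᶠ k in atTop, F k = G := by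
    by_contra! hcon
    have h4 : ∀ᶠ k in atTop, ∀ G ∈ hfinite.toFinset, F k ≠ G := by
      rw [Filter.eventually_all_finset]
      exact fun G hG => hcon G (hfinite.mem_toFinset.1 hG).1
    obtain ⟨k, hk⟩ := h4.exists
    exact hk (F k) (hfinite.mem_toFinset.2 (hmem k)) rfl
  have hGn := mem_nearFaces_of_mem_steppedSurface hσ hnice hU hG
  refine ⟨G, hG, (isHausdorffLimit_tile hσ hnice hGn).mem_of_frequently
    (isCompact_tile hσ hnice hGn).isClosed (w := fun _ => z) ?_ tendsto_const_nhds⟩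
  have htend : Tendsto (fun k => m * k) atTop atTop :=
    tendsto_id.const_mul_atTop' hfin.1
  exact htend.frequently (hfreq.mono fun k hk => hk ▸ hz k)

theorem isTiling_steppedSurface (hσ : IsPrimitiveUnitPisot σ β)
    (hnice : IsNice σ β) (hscc : StrongCoincidence σ β) (hU : Admissible σ β U)
    (hUbase : ∀ F ∈ U.support, F.1 = 0) (hfin : GeometricFiniteness σ β m U) :
    IsTiling (fun F : steppedSurface σ m U => tile σ β (F : Face n)) where
  isCompact := fun F =>
    isCompact_tile hσ hnice (mem_nearFaces_of_mem_steppedSurface hσ hnice hU F.2)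
  covers := Set.eq_univ_of_forall fun z => by
    obtain ⟨F, hF, hz⟩ := iUnion_tile_steppedSurface hσ hnice hU hfin z
    exact Set.mem_iUnion.2 ⟨⟨F, hF⟩, hz⟩
  ae_unique := by
    have h : ∀ᵐ z ∂(addHaar : Measure (contrSpace σ β)), ∀ F G : steppedSurface σ m U,
        F ≠ G → z ∉ tile σ β (F : Face n) ∩ tile σ β (G : Face n) := by
      -- There are only countably many faces, so the pairwise null sets may be discarded together.
      rw [ae_all_iff]
      intro F
      rw [ae_all_iff]
      intro G
      by_cases hFG : F = G
      · exact Eventually.of_forall fun z h => absurd hFG h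
      · have h0 := addHaar_inter_tile_of_mem_steppedSurface hσ hnice hscc hU hUbase hfin F.2 G.2
          fun h => hFG (Subtype.ext h)
        filter_upwards [measure_eq_zero_iff_ae_notMem.1 h0] with z hz _ using hz
    filter_upwards [h] with z hz
    obtain ⟨F, hF, hzF⟩ := iUnion_tile_steppedSurface hσ hnice hU hfin z
    refine ⟨⟨F, hF⟩, hzF, fun G hG => ?_⟩
    by_contra hne
    exact hz G ⟨F, hF⟩ hne ⟨hG, hzF⟩

/-! ### Aperiodicity -/

/-- Otherwise the set would contain all points `z + k (v - w)`, contradicting boundedness. -/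
theorem eq_of_image_add_eq {K : Type*} [NormedAddCommGroup K] [NormedSpace ℝ K] {T : Set K}
    (hT : IsCompact T) (hne : T.Nonempty) {v w : K}
    (h : (fun z => z + v) '' T = (fun z => z + w) '' T) : v = w := by
  obtain ⟨C, hC⟩ := hT.isBounded.exists_norm_le
  obtain ⟨z, hz⟩ := hne
  have hstep : ∀ k : ℕ, z + (k : ℝ) • (v - w) ∈ T := by
    intro k
    induction k with
    | zero => simpa
    | succ k ih =>
      have h1 : z + (k : ℝ) • (v - w) + v ∈ (fun z => z + w) '' T := h ▸ ⟨_, ih, rfl⟩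
      obtain ⟨y, hy, hyw⟩ := h1
      have h2 : y = z + ((k + 1 : ℕ) : ℝ) • (v - w) := by
        rw [← add_right_cancel_iff (a := w)]
        dsimp only at hyw
        rw [hyw]
        push_cast
        rw [add_smul, one_smul]
        abel
      exact h2 ▸ hy
  by_contra hvw
  have hpos : 0 < ‖v - w‖ := norm_pos_iff.2 (sub_ne_zero.2 hvw)
  obtain ⟨k, hk⟩ := exists_nat_gt ((C + ‖z‖) / ‖v - w‖)
  rw [div_lt_iff₀ hpos] at hk
  have h1 := hC _ (hstep k)
  have h2 : (k : ℝ) * ‖v - w‖ ≤ C + ‖z‖ := by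
    calc (k : ℝ) * ‖v - w‖ = ‖(k : ℝ) • (v - w)‖ := by
          rw [norm_smul, Real.norm_of_nonneg (Nat.cast_nonneg k)]
      _ = ‖(z + (k : ℝ) • (v - w)) - z‖ := by rw [add_sub_cancel_left]
      _ ≤ C + ‖z‖ := (norm_sub_le _ _).trans (add_le_add h1 le_rfl)
  linarith

theorem isAperiodic_steppedSurface (hσ : IsPrimitiveUnitPisot σ β)
    (hnice : IsNice σ β) (hU : Admissible σ β U) (hfin : GeometricFiniteness σ β m U) :
    IsAperiodic (tile σ β '' steppedSurface σ m U) := by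
  intro v hv
  obtain ⟨u, ℓ, hu, hproj, hℓ, -⟩ := exists_expanding_coordinate hσ hnice
  obtain ⟨F, hF, -⟩ := iUnion_tile_steppedSurface hσ hnice hU hfin 0
  have hFn := mem_nearFaces_of_mem_steppedSurface hσ hnice hU hF
  have hstep : ∀ k : ℕ, ∃ G ∈ steppedSurface σ m U,
      tile σ β G = (fun z => z + (k : ℝ) • v) '' tile σ β F := by
    intro k
    induction k with
    | zero => exact ⟨F, hF, by simp⟩
    | succ k ih =>
      obtain ⟨G, hG, hGt⟩ := ih
      have h1 : (fun z => z + v) '' tile σ β G ∈ tile σ β '' steppedSurface σ m U :=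
        hv.subset ⟨_, ⟨G, hG, rfl⟩, rfl⟩
      obtain ⟨H, hH, h2⟩ := h1
      refine ⟨H, hH, ?_⟩
      rw [h2, hGt, Set.image_image]
      congr 1
      ext1 z
      push_cast
      rw [add_smul, one_smul, add_assoc]
  choose G hG hGt using hstep
  have hGn : ∀ k, G k ∈ nearFaces σ β := fun k =>
    mem_nearFaces_of_mem_steppedSurface hσ hnice hU (hG k)
  -- Infinitely many of the translated tiles come from faces of one type; for these, equality of
  -- tiles determines the difference of the projected base points.
  obtain ⟨c, hc⟩ := Finite.exists_infinite_fiber fun k => (G k).2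
  rw [Set.infinite_coe_iff] at hc
  have hdiff : ∀ k l : ℕ, (G k).2 = c → (G l).2 = c →
      basePoint σ β ((G l).1 - (G k).1) = ((l : ℝ) - k) • v := by
    intro k l hk hl
    have h1 : tile σ β (G l) =
        (fun w => w + basePoint σ β ((G l).1 - (G k).1)) '' tile σ β (G k) := by
      rw [← tile_translate]
      congr 1
      exact Prod.ext (by simp) (hl.trans hk.symm)
    have h2 : tile σ β (G l) = (fun w => w + ((l : ℝ) - k) • v) '' tile σ β (G k) := by
      rw [hGt l, hGt k, Set.image_image]
      congr 1
      ext1 z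
      rw [add_assoc, ← add_smul, add_sub_cancel]
    exact eq_of_image_add_eq (isCompact_tile hσ hnice (hGn k))
      (isHausdorffLimit_tile hσ hnice (hGn k)).1 (h1.symm.trans h2)
  obtain ⟨k₀, hk₀⟩ := hc.nonempty
  obtain ⟨k₁, hk₁, hlt⟩ := hc.exists_gt k₀
  set z := (G k₁).1 - (G k₀).1 with hz
  have hzv : basePoint σ β z = ((k₁ : ℝ) - k₀) • v := hdiff k₀ k₁ hk₀ hk₁
  have hq : (0 : ℝ) < (k₁ : ℝ) - k₀ := sub_pos.2 (by exact_mod_cast hlt)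
  have hker : ∀ x : Fin n → ℤ, basePoint σ β x = 0 ↔ ℓ (toReal x) = 0 := by
    intro x
    rw [basePoint, projC_toReal_eq_zero_iff hσ hnice, hproj, smul_eq_zero, or_iff_left hu]
  suffices hℓz : ℓ (toReal z) = 0 by
    rw [(hker z).2 hℓz] at hzv
    exact (smul_eq_zero.1 hzv.symm).resolve_left hq.ne'
  set B := ∑ i, ℓ (Pi.single i 1) with hB
  have hbound : ∀ k, 0 ≤ ℓ (toReal (G k).1) ∧ ℓ (toReal (G k).1) ≤ B := by
    intro k
    obtain ⟨-, h1, h2⟩ := (mem_nearFaces_iff hσ hu hproj hℓ (G k)).1 (hGn k)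
    refine ⟨h1, h2.le.trans ?_⟩
    rw [apply_toReal_abelType]
    exact Finset.sum_le_sum_of_subset_of_nonneg (Finset.subset_univ _) fun i _ _ => (hℓ i).le
  -- The integer combination `(k₁ - k₀)(x_l - x_{k₀}) - (l - k₀) z` of base points has no
  -- contracting component, hence no expanding one: the linear advance transfers to the coordinate
  -- `ℓ`.
  have hlin : ∀ l, (G l).2 = c → ((l : ℝ) - k₀) * ℓ (toReal z) =
      ((k₁ : ℝ) - k₀) * (ℓ (toReal (G l).1) - ℓ (toReal (G k₀).1)) := by
    intro l hl
    have h1 : basePoint σ β (((k₁ : ℤ) - k₀) • ((G l).1 - (G k₀).1) - ((l : ℤ) - k₀) • z) = 0 := by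
      have h2 : ∀ (a : ℤ) x, basePoint σ β (a • x) = (a : ℝ) • basePoint σ β x := fun a x => by
        rw [basePoint, toReal_smul, map_smul, basePoint]
      rw [basePoint_sub, h2, h2, hdiff k₀ l hk₀ hl, hzv, smul_smul, smul_smul, sub_eq_zero]
      push_cast
      rw [mul_comm]
    rw [hker, toReal_sub, toReal_smul, toReal_smul, map_sub, map_smul, map_smul, toReal_sub,
      map_sub, smul_eq_mul, smul_eq_mul] at h1
    push_cast at h1
    linarith
  by_contra hne
  have hpos : 0 < |ℓ (toReal z)| := abs_pos.2 hne
  -- Beyond this index the linear advance of `ℓ` exceeds the range `[0, B]` available to faces near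
  -- `K_c`.
  obtain ⟨N, hN⟩ := exists_nat_gt (k₀ + ((k₁ : ℝ) - k₀) * B / |ℓ (toReal z)|)
  obtain ⟨l, hl, hlN⟩ := hc.exists_gt N
  have h1 := congrArg abs (hlin l hl)
  rw [abs_mul, abs_mul, abs_of_pos hq] at h1
  have h2 : |ℓ (toReal (G l).1) - ℓ (toReal (G k₀).1)| ≤ B := by
    rw [abs_le]
    constructor <;> linarith [(hbound l).1, (hbound l).2, (hbound k₀).1, (hbound k₀).2]
  have h3 : ((k₁ : ℝ) - k₀) * B / |ℓ (toReal z)| < (l : ℝ) - k₀ := by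
    have : (N : ℝ) < l := by exact_mod_cast hlN
    linarith
  rw [div_lt_iff₀ hpos] at h3
  have h4 := mul_le_mul_of_nonneg_left h2 hq.le
  have h5 := mul_le_mul_of_nonneg_right (le_abs_self ((l : ℝ) - k₀)) hpos.le
  linarith

end SteppedSurface

end RauzyTiling

open RauzyTiling in
theorem mainTheorem2 {n : ℕ} (σ : Substitution n) (β : ℝ)
    (hσ : IsPrimitiveUnitPisot σ β) (hnice : IsNice σ β) (hscc : StrongCoincidence σ β)
    (U : Chain n) (hUdim : ∀ F ∈ U.support, F.2.card = deg β - 1)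
    (hUbase : ∀ F ∈ U.support, F.1 = 0) (hUwell : ProjectsWell σ β U)
    (m : ℕ) (hfin : GeometricFiniteness σ β m U) :
    (∀ F ∈ nearFaces σ β, IsHausdorffLimit (renormPatch σ β F) (tile σ β F)) ∧
    IsTiling (fun F : steppedSurface σ m U => tile σ β (F : Face n)) ∧
    IsSelfReplicating σ β m (steppedSurface σ m U) ∧
    IsAperiodic (tile σ β '' steppedSurface σ m U) := by
  have hU := admissible_of_base_zero hσ hnice hUdim hUbase hUwell
  exact ⟨fun F hF => isHausdorffLimit_tile hσ hnice hF,
    isTiling_steppedSurface hσ hnice hscc hU hUbase hfin,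
    isSelfReplicating_steppedSurface hσ hnice hU hfin.2.1,
    isAperiodic_steppedSurface hσ hnice hU hfin⟩
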